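/- Let $k$ be a field, let $n>1$ and $1\le\nu<N$ be integers with $n\mid N$, let $q\in k$ be a primitive $n$th root of unity, and let $r$ be the order of $q^\nu$. Let $\alpha,\beta,\gamma\in k$. If $\alpha=\beta=0$, assume $n\nmid\nu$ (i.e. $r>1$). If $(\alpha,\beta)\neq(0,0)$, assume $\gcd(n,\nu)=1$ (so $r=n$) and $N\nmid\nu n$. Let $U_{\alpha,\beta,\gamma}=U_{(n,N,\nu,q,\alpha,\beta,\gamma)}$ be the Hopf algebra over $k$ generated as an algebra by $a,x,y$ with relations $$a^N=1,\quad x^r=\alpha(a^{\nu n}-1),\quad y^r=\beta(a^{\nu n}-1),\quad xa=qax,\quad ya=q^{-1}ay,\quad yx-q^{-\nu}xy=\gamma(a^{2\nu}-1)$$ (so $x^r=y^r=0$ if $\alpha=\beta=0$), with $\Delta(a)=a\otimes a$, $\Delta(x)=x\otimes a^\nu+1\otimes x$, $\Delta(y)=y\otimes a^\nu+1\otimes y$, $\varepsilon(a)=1$, $\varepsilon(x)=\varepsilon(y)=0$ and antipode $s(a)=a^{-1}$, $s(x)=-q^{-\nu}a^{-\nu}x$, $s(y)=-q^{\nu}a^{-\nu}y$.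 For grouplike $g,h$ put $P_{g,h}=\{z\mid\Delta(z)=z\otimes g+h\otimes z\}$. For integers $1\le\mu<M$ with $M\nmid\mu^2$ and a primitive $M$th root of unity $\omega\in k$, Radford's Hopf algebra is $U_{(M,\mu,\omega)}=U_{(M/\gcd(M,\mu),\,M,\,\mu,\,\omega^\mu,\,0,0,1)}$. Then: 1. $U_{\alpha,\beta,\gamma}$ is a pointed Hopf algebra, and its group of grouplike elements is $(a)$, cyclic of order $N$. 2. $\{a^ix^jy^l\mid 0\le i\le N-1,\ 0\le j,l\le r-1\}$ is a linear basis of $U_{\alpha,\beta,\gamma}$; hence $\dim U_{\alpha,\beta,\gamma}=Nr^2$. 3. $P_{a^\nu,1}=\mathrm{span}\{a^\nu-1,x,y\}$; $P_{a^v,1}=\mathrm{span}\{a^v-1\}$ for all $v\not\equiv\nu \pmod N$; and the first term of the coradical filtration is $(U_{\alpha,\beta,\gamma})_1=\mathrm{span}\{a^i,\ a^jx,\ a^ly\mid 0\le i,j,l\le N-1\}$. 4. The element $\left(\sum_{i=0}^{N-1}a^i\right)x^{r-1}y^{r-1}$ is a non-zero 2-sided integral of $U_{\alpha,\beta,\gamma}$,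 and so is $\left(\frac1N\sum_{i=0}^{N-1}a^i\right)x^{r-1}y^{r-1}$ if $N$ is invertible in $k$. In particular $U_{\alpha,\beta,\gamma}$ is unimodular. 5. If $\alpha,\beta,\gamma\ne0$ and $\sqrt\gamma\in k$, then as an algebra $U_{\alpha,\beta,\gamma}$ is isomorphic to a crossed product $k\mathbb Z_{N/n}\#_\sigma U_{(n,\nu,\omega)}$ for some primitive $n$th root of unity $\omega\in k$ (where $\nu$ is read modulo $n$) and some cocycle $\sigma$. 6. Let $\alpha,\beta,\alpha',\beta'\in k^*$. (a) If $\alpha/\alpha'$ and $\beta/\beta'$ have $n$th roots in $k$, then $U_{\alpha,\beta,0}\cong U_{\alpha',\beta',0}$ as Hopf algebras. (b) Let $\gamma,\gamma'\in k^*$ and suppose $N\nmid2\nu$. If $n>2$ and $U_{\alpha,\beta,\gamma}\cong U_{\alpha',\beta',\gamma'}$ as Hopf algebras, then $\frac{\alpha\beta}{\gamma^n}=\frac{\alpha'\beta'}{\gamma'^n}$. Conversely, if $\frac{\alpha\beta}{\gamma^n}=\frac{\alpha'\beta'}{\gamma'^n}$ and $\alpha/\alpha'$ has an $n$th root in $k$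 (for instance, if $k$ is algebraically closed), then $U_{\alpha,\beta,\gamma}\cong U_{\alpha',\beta',\gamma'}$ as Hopf algebras. -/

import Mathlib

open scoped TensorProduct

namespace PointedHopf

universe u v w

/-! ### General notions for coalgebras and Hopf algebras -/

section Coalgebras

variable (k : Type u) [Field k] (C : Type v)

/-- A subspace `V` of a coalgebra is a subcoalgebra if `Δ(V) ⊆ V ⊗ V`. -/
def IsSubcoalgebra [AddCommGroup C] [Module k C] [Coalgebra k C] (V : Submodule k C) : Prop :=
  ∀ c ∈ V, Coalgebra.comul (R := k) c ∈
    LinearMap.range (TensorProduct.map V.subtype V.subtype)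

/-- A simple subcoalgebra: nonzero, with no subcoalgebras other than `0` and itself. -/
def IsSimpleSubcoalgebra [AddCommGroup C] [Module k C] [Coalgebra k C]
    (V : Submodule k C) : Prop :=
  IsSubcoalgebra k C V ∧ V ≠ ⊥ ∧ ∀ W : Submodule k C, IsSubcoalgebra k C W → W ≤ V → W = ⊥ ∨ W = V

/-- A coalgebra is pointed if all its simple subcoalgebras are one-dimensional. -/
def IsPointed [AddCommGroup C] [Module k C] [Coalgebra k C] : Prop :=
  ∀ V : Submodule k C, IsSimpleSubcoalgebra k C V → Module.finrank k V = 1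

/-- The coradical filtration: `C_0` is the sum of all simple subcoalgebras and
`C_{m+1} = Δ⁻¹(C ⊗ C_m + C_0 ⊗ C)`. -/
def coradicalFiltration [AddCommGroup C] [Module k C] [Coalgebra k C] : ℕ → Submodule k C
  | 0 => sSup {V | IsSimpleSubcoalgebra k C V}
  | m + 1 => Submodule.comap (Coalgebra.comul (R := k) (A := C))
      (LinearMap.range
          (TensorProduct.map (LinearMap.id : C →ₗ[k] C) (coradicalFiltration m).subtype) ⊔
        LinearMap.range
          (TensorProduct.map (sSup {V | IsSimpleSubcoalgebra k C V}).subtype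
            (LinearMap.id : C →ₗ[k] C)))

variable {C}

/-- The space `P_{g,h} = {z | Δ(z) = z ⊗ g + h ⊗ z}` of `g:h` skew primitives. -/
def skewPrimitives [AddCommGroup C] [Module k C] [Coalgebra k C] (g h : C) : Submodule k C where
  carrier := {z | Coalgebra.comul (R := k) z = z ⊗ₜ[k] g + h ⊗ₜ[k] z}
  add_mem' {z w} hz hw := by
    simp only [Set.mem_ofPred_eq] at hz hw ⊢
    rw [map_add, hz, hw, TensorProduct.add_tmul, TensorProduct.tmul_add]
    abel
  zero_mem' := by simp
  smul_mem' c z hz := by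
    simp only [Set.mem_ofPred_eq] at hz ⊢
    rw [map_smul, hz, smul_add, TensorProduct.smul_tmul', TensorProduct.tmul_smul]

variable (H : Type v) [Ring H] [HopfAlgebra k H]

/-- The space of left integrals `{t | h t = ε(h) t for all h}`. -/
def leftIntegrals : Submodule k H where
  carrier := {t | ∀ h : H, h * t = Coalgebra.counit (R := k) h • t}
  add_mem' {s t} hs ht h := by rw [mul_add, hs h, ht h, smul_add]
  zero_mem' h := by simp
  smul_mem' c t ht h := by rw [mul_smul_comm, ht h, smul_comm]

/-- The space of right integrals `{t | t h = ε(h) t for all h}`. -/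
def rightIntegrals : Submodule k H where
  carrier := {t | ∀ h : H, t * h = Coalgebra.counit (R := k) h • t}
  add_mem' {s t} hs ht h := by rw [add_mul, hs h, ht h, smul_add]
  zero_mem' h := by simp
  smul_mem' c t ht h := by rw [smul_mul_assoc, ht h, smul_comm]

/-- A (finite dimensional) Hopf algebra is unimodular if its left and right integrals coincide. -/
def IsUnimodular : Prop := leftIntegrals k H = rightIntegrals k H

end Coalgebras

/-! ### Crossed products -/

section CrossedProducts

open Coalgebra

variable (k : Type u) [Field k] (A : Type v) [Ring A] [Algebra k A]
  (H : Type v) [Ring H] [HopfAlgebra k H]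

/-- The data of a crossed product `A #_σ H`: a measuring (weak action) of the Hopf algebra `H` on
the algebra `A` and a convolution invertible normal 2-cocycle `σ : H ⊗ H → A` making `A` a twisted
`H`-module. Sweedler sums are written over arbitrary representations of the comultiplication; all
the expressions are multilinear, so they do not depend on the representation. -/
structure CrossedSystem where
  /-- the weak action `h · a` -/
  act : H →ₗ[k] A →ₗ[k] A
  /-- the cocycle -/
  σ : H →ₗ[k] H →ₗ[k] A
  /-- `h · (a b) = ∑ (h₁ · a) (h₂ · b)` -/
  act_mul : ∀ (h : H) (a b : A) (R : Repr k h (H × H)),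
    act h (a * b) = ∑ i ∈ R.index, act (R.left i) a * act (R.right i) b
  /-- `h · 1 = ε(h) 1` -/
  act_one : ∀ h : H, act h 1 = algebraMap k A (counit h)
  /-- `1 · a = a` -/
  one_act : ∀ a : A, act 1 a = a
  /-- `∑ (h₁ · (l₁ · a)) σ(h₂, l₂) = ∑ σ(h₁, l₁) (h₂ l₂ · a)` -/
  twisted : ∀ (h l : H) (a : A) (R : Repr k h (H × H)) (S : Repr k l (H × H)),
    ∑ i ∈ R.index, ∑ j ∈ S.index,
        act (R.left i) (act (S.left j) a) * σ (R.right i) (S.right j) =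
      ∑ i ∈ R.index, ∑ j ∈ S.index,
        σ (R.left i) (S.left j) * act (R.right i * S.right j) a
  /-- `σ(h, 1) = ε(h) 1` -/
  σ_one : ∀ h : H, σ h 1 = algebraMap k A (counit h)
  /-- `σ(1, h) = ε(h) 1` -/
  one_σ : ∀ h : H, σ 1 h = algebraMap k A (counit h)
  /-- `∑ (h₁ · σ(l₁, m₁)) σ(h₂, l₂ m₂) = ∑ σ(h₁, l₁) σ(h₂ l₂, m)` -/
  cocycle : ∀ (h l m : H) (R : Repr k h (H × H)) (S : Repr k l (H × H)) (T : Repr k m (H × H)),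
    ∑ i ∈ R.index, ∑ j ∈ S.index, ∑ t ∈ T.index,
        act (R.left i) (σ (S.left j) (T.left t)) * σ (R.right i) (S.right j * T.right t) =
      ∑ i ∈ R.index, ∑ j ∈ S.index, σ (R.left i) (S.left j) * σ (R.right i * S.right j) m
  /-- `σ` is convolution invertible -/
  exists_inv : ∃ τ : H →ₗ[k] H →ₗ[k] A, ∀ (h l : H) (R : Repr k h (H × H)) (S : Repr k l (H × H)),
    ∑ i ∈ R.index, ∑ j ∈ S.index, σ (R.left i) (S.left j) * τ (R.right i) (S.right j) =
        algebraMap k A (counit h * counit l) ∧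
      ∑ i ∈ R.index, ∑ j ∈ S.index, τ (R.left i) (S.left j) * σ (R.right i) (S.right j) =
        algebraMap k A (counit h * counit l)

/-- The algebra `B` is isomorphic to a crossed product `A #_σ H`, that is, to the space `A ⊗ H`
with unit `1 # 1` and multiplication
`(a # h) (b # g) = ∑ a (h₁ · b) σ(h₂, g₁) # h₃ g₂` for some crossed system. -/
def IsCrossedProduct (B : Type w) [Ring B] [Algebra k B] : Prop :=
  ∃ (c : CrossedSystem k A H) (φ : A ⊗[k] H ≃ₗ[k] B),
    φ (1 ⊗ₜ 1) = 1 ∧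
    ∀ (a b : A) (h g : H) (R : Repr k h (H × H)) (R' : ∀ i, Repr k (R.right i) (H × H))
      (S : Repr k g (H × H)),
      φ (a ⊗ₜ h) * φ (b ⊗ₜ g) =
        φ (∑ i ∈ R.index, ∑ j ∈ (R' i).index, ∑ l ∈ S.index,
          (a * c.act (R.left i) b * c.σ ((R' i).left j) (S.left l)) ⊗ₜ
            ((R' i).right j * S.right l))

end CrossedProducts

/-! ### The `q`-binomial theorem at a root of unity -/

section QBinomial

variable {k : Type u} [Field k]

/-- Gaussian binomial coefficients evaluated at `p`. -/
def qChoose (p : k) : ℕ → ℕ → k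
  | _, 0 => 1
  | 0, _ + 1 => 0
  | n + 1, j + 1 => qChoose p n j + p ^ (j + 1) * qChoose p n (j + 1)

theorem qChoose_of_lt (p : k) : ∀ n j, n < j → qChoose p n j = 0
  | n, 0, h => by omega
  | 0, j + 1, _ => by simp [qChoose]
  | n + 1, j + 1, h => by
    simp [qChoose, qChoose_of_lt p n j (by omega), qChoose_of_lt p n (j + 1) (by omega)]

theorem qChoose_self (p : k) : ∀ n, qChoose p n n = 1
  | 0 => by simp [qChoose]
  | n + 1 => by simp [qChoose, qChoose_self p n, qChoose_of_lt p n (n + 1) (by omega)]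

theorem qChoose_step (p : k) : ∀ n j, j ≤ n →
    qChoose p n (j + 1) * (p ^ (j + 1) - 1) = qChoose p n j * (p ^ (n - j) - 1)
  | 0, j, h => by
    obtain rfl : j = 0 := by omega
    simp [qChoose]
  | n + 1, 0, _ => by
    have := qChoose_step p n 0 (by omega)
    simp only [qChoose, zero_add, pow_one, Nat.sub_zero, one_mul] at this ⊢
    linear_combination p * this
  | n + 1, j + 1, h => by
    rcases Nat.lt_or_ge j n with hj | hj
    · have h1 := qChoose_step p n j (by omega)
      have h2 := qChoose_step p n (j + 1) (by omega)
      obtain ⟨d, rfl⟩ : ∃ d, n = j + 1 + d := ⟨n - (j + 1), by omega⟩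
      have e1 : j + 1 + d - (j + 1) = d := by omega
      have e2 : j + 1 + d - j = d + 1 := by omega
      have e3 : j + 1 + d + 1 - (j + 1) = d + 1 := by omega
      rw [e1] at h2
      rw [e2] at h1
      rw [e3]
      simp only [qChoose]
      linear_combination p ^ (j + 1 + 1) * h2 + h1
    · obtain rfl : j = n := by omega
      have e3 : j + 1 - (j + 1) = 0 := by omega
      rw [e3, qChoose_of_lt p (j + 1) (j + 1 + 1) (by omega)]
      simp

theorem qChoose_eq_zero {p : k} {r : ℕ} (hp : IsPrimitiveRoot p r) :
    ∀ j, 0 < j → j < r → qChoose p r j = 0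
  | 0, h, _ => by omega
  | j + 1, _, h => by
    have hs := qChoose_step p r j (by omega)
    have hne : p ^ (j + 1) - 1 ≠ 0 := sub_ne_zero.2 (hp.pow_ne_one_of_pos_of_lt (by omega) h)
    have hz : qChoose p r j * (p ^ (r - j) - 1) = 0 := by
      rcases Nat.eq_zero_or_pos j with rfl | hj
      · simp [hp.pow_eq_one]
      · rw [qChoose_eq_zero hp j hj (by omega), zero_mul]
    rw [hz] at hs
    exact (mul_eq_zero.1 hs).resolve_right hne

variable {B : Type v} [Ring B] [Algebra k B]

theorem mul_pow_of_smul {p : k} {u v : B} (h : v * u = p • (u * v)) (m : ℕ) :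
    v * u ^ m = p ^ m • (u ^ m * v) := by
  induction m with
  | zero => simp
  | succ m ih =>
    rw [pow_succ, ← mul_assoc, ih, smul_mul_assoc, mul_assoc, h, mul_smul_comm, smul_smul,
      mul_assoc, ← pow_succ]

theorem add_pow_qChoose {p : k} {u v : B} (h : v * u = p • (u * v)) (m : ℕ) :
    (u + v) ^ m = ∑ j ∈ Finset.range (m + 1), qChoose p m j • (u ^ j * v ^ (m - j)) := by
  induction m with
  | zero => simp [qChoose]
  | succ m ih =>
    rw [pow_succ', ih, add_mul, Finset.mul_sum, Finset.mul_sum, Finset.sum_range_succ' _ (m + 1)]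
    have hv : ∑ j ∈ Finset.range (m + 1), v * qChoose p m j • (u ^ j * v ^ (m - j)) =
        ∑ j ∈ Finset.range (m + 1),
          (p ^ (j + 1) * qChoose p m (j + 1)) • (u ^ (j + 1) * v ^ (m - j)) + v ^ (m + 1) := by
      have e : ∀ j ∈ Finset.range (m + 1), v * qChoose p m j • (u ^ j * v ^ (m - j)) =
          (p ^ j * qChoose p m j) • (u ^ j * v ^ (m + 1 - j)) := by
        intro j hj
        have hj' : j < m + 1 := Finset.mem_range.1 hj
        rw [mul_smul_comm, ← mul_assoc, mul_pow_of_smul h, smul_mul_assoc, mul_assoc,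
          ← pow_succ', smul_smul, mul_comm (qChoose p m j)]
        congr 4
        omega
      rw [Finset.sum_congr rfl e, Finset.sum_range_succ' _ m, Finset.sum_range_succ _ m,
        qChoose_of_lt p m (m + 1) (by omega)]
      simp [qChoose]
    rw [hv, ← add_assoc, ← Finset.sum_add_distrib]
    congr 1
    · refine Finset.sum_congr rfl fun j hj => ?_
      have e3 : m + 1 - (j + 1) = m - j := by omega
      rw [e3, qChoose, add_smul, mul_smul_comm, ← mul_assoc, ← pow_succ']
    · simp [qChoose]

/-- If `v u = p u v` and `p` is a primitive `r`-th root of unity, then `(u + v)^r = u^r + v^r`. -/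
theorem add_pow_of_isPrimitiveRoot {p : k} {r : ℕ} (hr : 0 < r) (hp : IsPrimitiveRoot p r)
    {u v : B} (h : v * u = p • (u * v)) : (u + v) ^ r = u ^ r + v ^ r := by
  obtain ⟨s, rfl⟩ : ∃ s, r = s + 1 := ⟨r - 1, by omega⟩
  rw [add_pow_qChoose h, Finset.sum_range_succ, Finset.sum_range_succ']
  rw [Finset.sum_eq_zero]
  · rw [qChoose_self]
    simp [qChoose, add_comm]
  · intro j hj
    have hj' : j < s := Finset.mem_range.1 hj
    rw [qChoose_eq_zero hp (j + 1) (by omega) (by omega), zero_smul]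

theorem prod_pow_of_isPrimitiveRoot {p : k} {r : ℕ} (hr : 0 < r) (hp : IsPrimitiveRoot p r) :
    (-1) ^ r * ∏ j ∈ Finset.range r, p ^ j = -1 := by
  rw [Finset.prod_pow_eq_pow_sum, Finset.sum_range_id]
  rcases Nat.even_or_odd' r with ⟨m, rfl | rfl⟩
  · have hm : p ^ m = -1 := by
      have h1 : (p ^ m) ^ 2 = 1 := by rw [← pow_mul, mul_comm, hp.pow_eq_one]
      rcases (sq_eq_sq_iff_eq_or_eq_neg (a := p ^ m) (b := 1)).1 (by rw [h1, one_pow]) with h | h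
      · exact absurd h (hp.pow_ne_one_of_pos_of_lt (by omega) (by omega))
      · exact h
    have e : 2 * m * (2 * m - 1) / 2 = m * (2 * m - 1) := by
      rw [mul_assoc, Nat.mul_div_cancel_left _ (by norm_num)]
    have ho : Odd (2 * m - 1) := ⟨m - 1, by omega⟩
    rw [e, pow_mul p, hm, ho.neg_one_pow, (even_two_mul m).neg_one_pow, one_mul]
  · have e : (2 * m + 1) * (2 * m + 1 - 1) / 2 = (2 * m + 1) * m := by
      have : (2 * m + 1) * (2 * m + 1 - 1) = 2 * ((2 * m + 1) * m) := by
        rw [Nat.add_sub_cancel]; ring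
      rw [this, Nat.mul_div_cancel_left _ (by norm_num)]
    rw [e, pow_mul p, hp.pow_eq_one, one_pow, (odd_two_mul_add_one m).neg_one_pow, mul_one]

end QBinomial

/-! ### The algebras `U_{(n,N,ν,q,α,β,γ)}` -/

/-- The discrete parameters: integers `n > 1`, `1 ≤ ν < N` with `n ∣ N`, and a primitive `n`-th
root of unity `q ∈ k`. -/
structure Datum (k : Type u) [Field k] where
  n : ℕ
  N : ℕ
  ν : ℕ
  q : k
  one_lt_n : 1 < n
  one_le_ν : 1 ≤ ν
  ν_lt_N : ν < N
  n_dvd_N : n ∣ N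
  isPrimitiveRoot : IsPrimitiveRoot q n

/-- Names for the generators. -/
inductive Gen : Type
  | a
  | x
  | y

namespace Datum

variable {k : Type u} [Field k] (D : Datum k)

/-- The order `r = |q^ν|` of `q^ν`. -/
noncomputable def r : ℕ := orderOf (D.q ^ D.ν)

/-- The conditions on the parameters. If `α = β = 0`, it is required that `q^ν ≠ 1`, that is
`r > 1`. Otherwise it is required that `(n, ν) = 1` (so that `r = n`) and `N ∤ ν n`. -/
structure Admissible (α β : k) : Prop where
  of_eq_zero : α = 0 ∧ β = 0 → ¬ D.n ∣ D.ν
  of_ne_zero : ¬ (α = 0 ∧ β = 0) → Nat.Coprime D.n D.ν ∧ ¬ D.N ∣ D.ν * D.n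

/-- Elements `A, X, Y` of an algebra `B` satisfy the defining relations of `U_{α,β,γ}`:
`A^N = 1`, `X^r = α (A^{νn} - 1)`, `Y^r = β (A^{νn} - 1)`, `X A = q A X`, `Y A = q⁻¹ A Y` and
`Y X - q^{-ν} X Y = γ (A^{2ν} - 1)`.
For `α = β = 0` the second and third relations read `X^r = 0 = Y^r`; otherwise `r = n`. -/
structure Satisfies (α β γ : k) {B : Type v} [Ring B] [Algebra k B] (A X Y : B) : Prop where
  a_pow : A ^ D.N = 1
  x_pow : X ^ D.r = α • (A ^ (D.ν * D.n) - 1)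
  y_pow : Y ^ D.r = β • (A ^ (D.ν * D.n) - 1)
  x_a : X * A = D.q • (A * X)
  y_a : Y * A = D.q⁻¹ • (A * Y)
  y_x : Y * X - (D.q ^ D.ν)⁻¹ • (X * Y) = γ • (A ^ (2 * D.ν) - 1)

open FreeAlgebra in
/-- The defining relations, as a relation on the free algebra on `a, x, y`. -/
inductive Rel (α β γ : k) : FreeAlgebra k Gen → FreeAlgebra k Gen → Prop
  | a_pow : Rel α β γ (ι k Gen.a ^ D.N) 1
  | x_pow : Rel α β γ (ι k Gen.x ^ D.r) (α • (ι k Gen.a ^ (D.ν * D.n) - 1))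
  | y_pow : Rel α β γ (ι k Gen.y ^ D.r) (β • (ι k Gen.a ^ (D.ν * D.n) - 1))
  | x_a : Rel α β γ (ι k Gen.x * ι k Gen.a) (D.q • (ι k Gen.a * ι k Gen.x))
  | y_a : Rel α β γ (ι k Gen.y * ι k Gen.a) (D.q⁻¹ • (ι k Gen.a * ι k Gen.y))
  | y_x : Rel α β γ (ι k Gen.y * ι k Gen.x - (D.q ^ D.ν)⁻¹ • (ι k Gen.x * ι k Gen.y))
      (γ • (ι k Gen.a ^ (2 * D.ν) - 1))

/-- The algebra `U_{α,β,γ} = U_{(n,N,ν,q,α,β,γ)}`, generated by `a, x, y` subject to the defining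
relations. The conditions on the parameters are carried by the last argument. -/
def U (α β γ : k) (_h : D.Admissible α β) : Type u := RingQuot (D.Rel α β γ)

variable {D}

theorem q_ne_zero (D : Datum k) : D.q ≠ 0 :=
  D.isPrimitiveRoot.ne_zero (by have := D.one_lt_n; omega)

theorem r_pos (D : Datum k) : 0 < D.r := by
  have h : (D.q ^ D.ν) ^ D.n = 1 := by
    rw [← pow_mul, mul_comm, pow_mul, D.isPrimitiveRoot.pow_eq_one, one_pow]
  exact orderOf_pos_iff.2 (isOfFinOrder_iff_pow_eq_one.2 ⟨D.n, by have := D.one_lt_n; omega, h⟩)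

theorem isPrimitiveRoot_r (D : Datum k) : IsPrimitiveRoot (D.q ^ D.ν) D.r :=
  IsPrimitiveRoot.orderOf _

theorem q_pow_N (D : Datum k) : D.q ^ D.N = 1 := by
  obtain ⟨m, hm⟩ := D.n_dvd_N
  rw [hm, pow_mul, D.isPrimitiveRoot.pow_eq_one, one_pow]

variable {α β γ : k}

theorem Admissible.r_eq (h : D.Admissible α β) (h0 : ¬ (α = 0 ∧ β = 0)) : D.r = D.n := by
  have := D.isPrimitiveRoot.pow_of_coprime D.ν (h.of_ne_zero h0).1.symm
  exact this.eq_orderOf.symm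

namespace Satisfies

variable {B : Type v} [Ring B] [Algebra k B] {A X Y : B}

theorem x_a_pow (hs : D.Satisfies α β γ A X Y) (m : ℕ) :
    X * A ^ m = D.q ^ m • (A ^ m * X) := mul_pow_of_smul hs.x_a m

theorem y_a_pow (hs : D.Satisfies α β γ A X Y) (m : ℕ) :
    Y * A ^ m = (D.q ^ m)⁻¹ • (A ^ m * Y) := by
  rw [← inv_pow]; exact mul_pow_of_smul hs.y_a m

theorem a_pow_x (hs : D.Satisfies α β γ A X Y) (m : ℕ) :
    A ^ m * X = (D.q ^ m)⁻¹ • (X * A ^ m) := by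
  rw [hs.x_a_pow, smul_smul, inv_mul_cancel₀ (pow_ne_zero _ D.q_ne_zero), one_smul]

theorem a_pow_y (hs : D.Satisfies α β γ A X Y) (m : ℕ) :
    A ^ m * Y = D.q ^ m • (Y * A ^ m) := by
  rw [hs.y_a_pow, smul_smul, mul_inv_cancel₀ (pow_ne_zero _ D.q_ne_zero), one_smul]

theorem tmul_pow_aux (h : D.Admissible α β) {c : k} (hc : c = α ∨ c = β) {p : k}
    (hp : IsPrimitiveRoot p D.r) {Z : B} (hZ : Z ^ D.r = c • (A ^ (D.ν * D.n) - 1))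
    (hA : A ^ D.ν * Z = p • (Z * A ^ D.ν)) :
    (Z ⊗ₜ[k] (A ^ D.ν) + 1 ⊗ₜ[k] Z) ^ D.r = c • ((A ⊗ₜ[k] A) ^ (D.ν * D.n) - 1) := by
  have hcomm : (Z ⊗ₜ[k] (A ^ D.ν)) * ((1 : B) ⊗ₜ[k] Z) =
      p • (((1 : B) ⊗ₜ[k] Z) * (Z ⊗ₜ[k] (A ^ D.ν))) := by
    rw [Algebra.TensorProduct.tmul_mul_tmul, Algebra.TensorProduct.tmul_mul_tmul, hA, mul_one,
      one_mul, TensorProduct.tmul_smul]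
  rw [add_comm, add_pow_of_isPrimitiveRoot D.r_pos hp hcomm, Algebra.TensorProduct.tmul_pow,
    Algebra.TensorProduct.tmul_pow, Algebra.TensorProduct.tmul_pow, hZ, one_pow]
  by_cases hc0 : c = 0
  · simp [hc0]
  · have h0 : ¬ (α = 0 ∧ β = 0) := by
      rintro ⟨rfl, rfl⟩
      rcases hc with h | h <;> exact hc0 h
    rw [h.r_eq h0, ← pow_mul, TensorProduct.tmul_smul, ← TensorProduct.smul_tmul', ← smul_add,
      TensorProduct.tmul_sub, TensorProduct.sub_tmul, Algebra.TensorProduct.one_def]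
    congr 1
    abel

/-- The elements `a ⊗ a`, `x ⊗ a^ν + 1 ⊗ x`, `y ⊗ a^ν + 1 ⊗ y` satisfy the relations. -/
theorem comul (hs : D.Satisfies α β γ A X Y) (h : D.Admissible α β) :
    D.Satisfies α β γ (A ⊗ₜ[k] A) (X ⊗ₜ[k] (A ^ D.ν) + 1 ⊗ₜ[k] X)
      (Y ⊗ₜ[k] (A ^ D.ν) + 1 ⊗ₜ[k] Y) where
  a_pow := by
    rw [Algebra.TensorProduct.tmul_pow, hs.a_pow, Algebra.TensorProduct.one_def]
  x_pow := tmul_pow_aux h (Or.inl rfl) D.isPrimitiveRoot_r.inv hs.x_pow (hs.a_pow_x _)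
  y_pow := tmul_pow_aux h (Or.inr rfl) D.isPrimitiveRoot_r hs.y_pow (hs.a_pow_y _)
  x_a := by
    simp only [add_mul, mul_add, Algebra.TensorProduct.tmul_mul_tmul, hs.x_a, one_mul, mul_one,
      smul_add, ← TensorProduct.smul_tmul', TensorProduct.tmul_smul, ← pow_succ, ← pow_succ']
  y_a := by
    simp only [add_mul, mul_add, Algebra.TensorProduct.tmul_mul_tmul, hs.y_a, one_mul, mul_one,
      smul_add, ← TensorProduct.smul_tmul', TensorProduct.tmul_smul, ← pow_succ, ← pow_succ']
  y_x := by
    have e : Y * X = (D.q ^ D.ν)⁻¹ • (X * Y) + γ • (A ^ (2 * D.ν) - 1) := by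
      rw [← hs.y_x]; abel
    have hq : (D.q ^ D.ν)⁻¹ * D.q ^ D.ν = 1 := inv_mul_cancel₀ (pow_ne_zero _ D.q_ne_zero)
    simp only [add_mul, mul_add, Algebra.TensorProduct.tmul_mul_tmul, one_mul, mul_one,
      smul_add, hs.a_pow_x, hs.a_pow_y, TensorProduct.tmul_smul, smul_smul, hq, one_smul, e,
      TensorProduct.add_tmul, TensorProduct.tmul_add, ← TensorProduct.smul_tmul',
      TensorProduct.tmul_sub, TensorProduct.sub_tmul, Algebra.TensorProduct.tmul_pow, two_mul,
      pow_add, Algebra.TensorProduct.one_def, smul_sub]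
    abel

/-- The scalars `1, 0, 0` satisfy the relations. -/
theorem counit (D : Datum k) (α β γ : k) : D.Satisfies α β γ (1 : k) 0 0 where
  a_pow := one_pow _
  x_pow := by rw [zero_pow D.r_pos.ne']; simp
  y_pow := by rw [zero_pow D.r_pos.ne']; simp
  x_a := by simp
  y_a := by simp
  y_x := by simp

theorem a_mul_inv (hs : D.Satisfies α β γ A X Y) : A * A ^ (D.N - 1) = 1 := by
  rw [← pow_succ', Nat.sub_add_cancel (by have := D.ν_lt_N; omega), hs.a_pow]

theorem inv_mul_a (hs : D.Satisfies α β γ A X Y) : A ^ (D.N - 1) * A = 1 := by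
  rw [← pow_succ, Nat.sub_add_cancel (by have := D.ν_lt_N; omega), hs.a_pow]

theorem inv_pow_mul (hs : D.Satisfies α β γ A X Y) (m : ℕ) :
    (A ^ (D.N - 1)) ^ m * A ^ m = 1 := by
  have hc : Commute (A ^ (D.N - 1)) A := (Commute.refl A).pow_left _
  rw [← hc.mul_pow, hs.inv_mul_a, one_pow]

theorem q_pow_N_sub (D : Datum k) : D.q ^ (D.N - 1) = D.q⁻¹ := by
  refine eq_inv_of_mul_eq_one_left ?_
  rw [← pow_succ, Nat.sub_add_cancel (by have := D.ν_lt_N; omega), D.q_pow_N]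

theorem x_inv_pow (hs : D.Satisfies α β γ A X Y) (m : ℕ) :
    X * (A ^ (D.N - 1)) ^ m = (D.q ^ m)⁻¹ • ((A ^ (D.N - 1)) ^ m * X) := by
  rw [← pow_mul, hs.x_a_pow, pow_mul D.q, q_pow_N_sub, inv_pow]

theorem y_inv_pow (hs : D.Satisfies α β γ A X Y) (m : ℕ) :
    Y * (A ^ (D.N - 1)) ^ m = D.q ^ m • ((A ^ (D.N - 1)) ^ m * Y) := by
  rw [← pow_mul, hs.y_a_pow, pow_mul D.q, q_pow_N_sub, inv_pow, inv_inv]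

theorem mul_pow_prod {p : k} {Z E : B} (hZ : Z * E = p • (E * Z)) (m : ℕ) :
    (E * Z) ^ m = (∏ j ∈ Finset.range m, p ^ j) • (E ^ m * Z ^ m) := by
  induction m with
  | zero => simp
  | succ m ih =>
    have e : Z ^ m * E = p ^ m • (E * Z ^ m) := by
      clear ih
      induction m with
      | zero => simp
      | succ m ih =>
        rw [pow_succ, mul_assoc, hZ, mul_smul_comm, ← mul_assoc, ih, smul_mul_assoc, smul_smul,
          mul_assoc, ← pow_succ']
    rw [pow_succ, ih, Finset.prod_range_succ, smul_mul_assoc, mul_assoc (E ^ m), ← mul_assoc (Z ^ m),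
      e, smul_mul_assoc, mul_smul_comm, smul_smul, mul_assoc E, ← pow_succ, ← mul_assoc (E ^ m),
      ← pow_succ]

theorem antipode_pow_aux (h : D.Admissible α β) {c : k} (hc : c = α ∨ c = β) {p : k}
    (hp : IsPrimitiveRoot p D.r) {Z E : B} (hZ : Z ^ D.r = c • (A ^ (D.ν * D.n) - 1))
    (hE : Z * E ^ D.ν = p • (E ^ D.ν * Z))
    (hEA : E ^ (D.ν * D.n) * A ^ (D.ν * D.n) = 1) :
    (-(p • (E ^ D.ν * Z))) ^ D.r = c • (E ^ (D.ν * D.n) - 1) := by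
  have h1 : (-(p • (E ^ D.ν * Z))) ^ D.r = -((E ^ D.ν) ^ D.r * Z ^ D.r) := by
    have e : -(p • (E ^ D.ν * Z)) = ((-1) * p) • (E ^ D.ν * Z) := by
      rw [neg_one_mul, neg_smul]
    rw [e, smul_pow, mul_pow, mul_pow_prod hE, smul_smul, hp.pow_eq_one, mul_one,
      prod_pow_of_isPrimitiveRoot D.r_pos hp, neg_one_smul]
  rw [h1, hZ]
  by_cases hc0 : c = 0
  · simp [hc0]
  · have h0 : ¬ (α = 0 ∧ β = 0) := by
      rintro ⟨rfl, rfl⟩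
      rcases hc with h | h <;> exact hc0 h
    rw [h.r_eq h0, ← pow_mul, mul_smul_comm, mul_sub, hEA, mul_one, ← smul_neg, neg_sub]

open MulOpposite in
/-- The elements `a⁻¹`, `-q^{-ν} a^{-ν} x`, `-q^ν a^{-ν} y` satisfy the relations in the opposite
algebra. -/
theorem antipode (hs : D.Satisfies α β γ A X Y) (h : D.Admissible α β) :
    D.Satisfies α β γ (op (A ^ (D.N - 1)))
      (op (-((D.q ^ D.ν)⁻¹ • ((A ^ (D.N - 1)) ^ D.ν * X))))
      (op (-(D.q ^ D.ν • ((A ^ (D.N - 1)) ^ D.ν * Y)))) where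
  a_pow := by
    rw [← op_pow, ← pow_mul, mul_comm, pow_mul, hs.a_pow, one_pow, op_one]
  x_pow := by
    rw [← op_pow, ← op_pow, ← op_one, ← op_sub, ← op_smul]
    exact congrArg op (antipode_pow_aux h (Or.inl rfl) D.isPrimitiveRoot_r.inv hs.x_pow
      (hs.x_inv_pow _) (hs.inv_pow_mul _))
  y_pow := by
    rw [← op_pow, ← op_pow, ← op_one, ← op_sub, ← op_smul]
    exact congrArg op (antipode_pow_aux h (Or.inr rfl) D.isPrimitiveRoot_r hs.y_pow
      (hs.y_inv_pow _) (hs.inv_pow_mul _))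
  x_a := by
    rw [← op_mul, ← op_mul, ← op_smul]
    congr 1
    have := hs.x_inv_pow 1
    simp only [pow_one] at this
    simp only [neg_mul, mul_neg, smul_mul_assoc, mul_smul_comm, mul_assoc, this, smul_neg, smul_smul]
    rw [← mul_assoc _ _ X, ← mul_assoc _ _ X, ← pow_succ', ← pow_succ (A ^ (D.N - 1)),
      mul_left_comm, mul_inv_cancel₀ D.q_ne_zero, mul_one]
  y_a := by
    rw [← op_mul, ← op_mul, ← op_smul]
    congr 1
    have := hs.y_inv_pow 1
    simp only [pow_one] at this
    simp only [neg_mul, mul_neg, smul_mul_assoc, mul_smul_comm, mul_assoc, this, smul_neg, smul_smul]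
    rw [← mul_assoc _ _ Y, ← mul_assoc _ _ Y, ← pow_succ', ← pow_succ (A ^ (D.N - 1)),
      mul_left_comm, inv_mul_cancel₀ D.q_ne_zero, mul_one]
  y_x := by
    rw [← op_mul, ← op_mul, ← op_smul, ← op_sub, ← op_pow, ← op_one, ← op_sub, ← op_smul]
    congr 1
    have hq : (D.q ^ D.ν)⁻¹ * D.q ^ D.ν = 1 := inv_mul_cancel₀ (pow_ne_zero _ D.q_ne_zero)
    have hq' : D.q ^ D.ν * (D.q ^ D.ν)⁻¹ = 1 := mul_inv_cancel₀ (pow_ne_zero _ D.q_ne_zero)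
    set E := (A ^ (D.N - 1)) with hE
    have e1 : E ^ D.ν * X * (E ^ D.ν * Y) = (D.q ^ D.ν)⁻¹ • (E ^ (2 * D.ν) * (X * Y)) := by
      rw [mul_assoc, ← mul_assoc X, hs.x_inv_pow, smul_mul_assoc, mul_smul_comm, mul_assoc _ X,
        ← mul_assoc _ _ (X * Y), ← pow_add, two_mul]
    have e2 : E ^ D.ν * Y * (E ^ D.ν * X) = D.q ^ D.ν • (E ^ (2 * D.ν) * (Y * X)) := by
      rw [mul_assoc, ← mul_assoc Y, hs.y_inv_pow, smul_mul_assoc, mul_smul_comm, mul_assoc _ Y,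
        ← mul_assoc _ _ (Y * X), ← pow_add, two_mul]
    have e : Y * X = (D.q ^ D.ν)⁻¹ • (X * Y) + γ • (A ^ (2 * D.ν) - 1) := by
      rw [← hs.y_x]; abel
    have e3 := hs.inv_pow_mul (2 * D.ν)
    rw [← hE] at e3
    have k1 : D.q ^ D.ν * ((D.q ^ D.ν)⁻¹ * (D.q ^ D.ν)⁻¹) = (D.q ^ D.ν)⁻¹ := by
      rw [← mul_assoc, hq', one_mul]
    have k2 : (D.q ^ D.ν)⁻¹ * ((D.q ^ D.ν)⁻¹ * (D.q ^ D.ν * D.q ^ D.ν)) = 1 := by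
      rw [← mul_assoc (D.q ^ D.ν)⁻¹ (D.q ^ D.ν), hq, one_mul, hq]
    simp only [neg_mul_neg, smul_mul_assoc, mul_smul_comm, smul_smul, e1, e2, k1, k2, one_smul]
    simp only [e, mul_add, mul_smul_comm, mul_sub, e3, mul_one, smul_sub]
    abel

end Satisfies

namespace U

variable (h : D.Admissible α β)

noncomputable instance : Ring (D.U α β γ h) := inferInstanceAs (Ring (RingQuot (D.Rel α β γ)))

noncomputable instance : Algebra k (D.U α β γ h) :=
  inferInstanceAs (Algebra k (RingQuot (D.Rel α β γ)))

/-- The quotient map from the free algebra. -/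
noncomputable def mk : FreeAlgebra k Gen →ₐ[k] D.U α β γ h := RingQuot.mkAlgHom k (D.Rel α β γ)

/-- The generator `a`. -/
noncomputable def a : D.U α β γ h := mk h (FreeAlgebra.ι k Gen.a)

/-- The generator `x`. -/
noncomputable def x : D.U α β γ h := mk h (FreeAlgebra.ι k Gen.x)

/-- The generator `y`. -/
noncomputable def y : D.U α β γ h := mk h (FreeAlgebra.ι k Gen.y)

theorem mk_rel {s t : FreeAlgebra k Gen} (hst : D.Rel α β γ s t) :
    mk (γ := γ) h s = mk h t := RingQuot.mkAlgHom_rel k hst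

theorem satisfies : D.Satisfies α β γ (a h : D.U α β γ h) (x h) (y h) where
  a_pow := by simpa [a] using mk_rel h (Rel.a_pow (D := D) (α := α) (β := β) (γ := γ))
  x_pow := by simpa [a, x] using mk_rel h (Rel.x_pow (D := D) (α := α) (β := β) (γ := γ))
  y_pow := by simpa [a, y] using mk_rel h (Rel.y_pow (D := D) (α := α) (β := β) (γ := γ))
  x_a := by simpa [a, x] using mk_rel h (Rel.x_a (D := D) (α := α) (β := β) (γ := γ))
  y_a := by simpa [a, y] using mk_rel h (Rel.y_a (D := D) (α := α) (β := β) (γ := γ))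
  y_x := by simpa [a, x, y] using mk_rel h (Rel.y_x (D := D) (α := α) (β := β) (γ := γ))

variable {h} {B : Type v} [Ring B] [Algebra k B]

/-- The universal property of `U_{α,β,γ}`. -/
noncomputable def lift {A X Y : B} (hs : D.Satisfies α β γ A X Y) : D.U α β γ h →ₐ[k] B :=
  RingQuot.liftAlgHom k ⟨FreeAlgebra.lift k (fun g : Gen => Gen.casesOn g A X Y), by
    intro s t hst
    cases hst with
    | a_pow => simpa using hs.a_pow
    | x_pow => simpa using hs.x_pow
    | y_pow => simpa using hs.y_pow
    | x_a => simpa using hs.x_a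
    | y_a => simpa using hs.y_a
    | y_x => simpa using hs.y_x⟩

theorem lift_mk {A X Y : B} (hs : D.Satisfies α β γ A X Y) (s : FreeAlgebra k Gen) :
    lift (h := h) hs (mk h s) = FreeAlgebra.lift k (fun g : Gen => Gen.casesOn g A X Y) s :=
  RingQuot.liftAlgHom_mkAlgHom_apply k _ _ _

@[simp] theorem lift_a {A X Y : B} (hs : D.Satisfies α β γ A X Y) : lift hs (a h) = A := by
  rw [a, lift_mk, FreeAlgebra.lift_ι_apply]

@[simp] theorem lift_x {A X Y : B} (hs : D.Satisfies α β γ A X Y) : lift hs (x h) = X := by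
  rw [x, lift_mk, FreeAlgebra.lift_ι_apply]

@[simp] theorem lift_y {A X Y : B} (hs : D.Satisfies α β γ A X Y) : lift hs (y h) = Y := by
  rw [y, lift_mk, FreeAlgebra.lift_ι_apply]

theorem algHom_ext {f g : D.U α β γ h →ₐ[k] B} (ha : f (a h) = g (a h)) (hx : f (x h) = g (x h))
    (hy : f (y h) = g (y h)) : f = g := by
  refine RingQuot.ringQuot_ext' k f g (FreeAlgebra.hom_ext ?_)
  funext i
  cases i
  · exact ha
  · exact hx
  · exact hy

theorem mk_surjective : Function.Surjective (mk (γ := γ) h) :=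
  RingQuot.mkAlgHom_surjective k _

/-- Induction principle: a property that holds for scalars and generators and is stable under sums
and products holds on `U_{α,β,γ}`. -/
theorem induction {P : D.U α β γ h → Prop} (hk : ∀ c : k, P (algebraMap k _ c)) (ha : P (a h))
    (hx : P (x h)) (hy : P (y h)) (hadd : ∀ u v, P u → P v → P (u + v))
    (hmul : ∀ u v, P u → P v → P (u * v)) (u : D.U α β γ h) : P u := by
  obtain ⟨s, rfl⟩ := mk_surjective u
  induction s using FreeAlgebra.induction with
  | grade0 c => rw [AlgHom.commutes]; exact hk c
  | grade1 i =>
    cases i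
    · exact ha
    · exact hx
    · exact hy
  | mul s t hs ht => rw [map_mul]; exact hmul _ _ hs ht
  | add s t hs ht => rw [map_add]; exact hadd _ _ hs ht

variable (h)

/-- The comultiplication `Δ(a) = a ⊗ a`, `Δ(x) = x ⊗ a^ν + 1 ⊗ x`, `Δ(y) = y ⊗ a^ν + 1 ⊗ y`. -/
noncomputable def comulHom : D.U α β γ h →ₐ[k] D.U α β γ h ⊗[k] D.U α β γ h :=
  lift ((satisfies h).comul h)

/-- The counit `ε(a) = 1`, `ε(x) = 0`, `ε(y) = 0`. -/
noncomputable def counitHom : D.U α β γ h →ₐ[k] k := lift (Satisfies.counit D α β γ)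

/-- The antipode `s(a) = a⁻¹`, `s(x) = -q^{-ν} a^{-ν} x`, `s(y) = -q^ν a^{-ν} y`, as an algebra map
to the opposite algebra (here `a⁻¹ = a^{N-1}`). -/
noncomputable def antipodeHom : D.U α β γ h →ₐ[k] (D.U α β γ h)ᵐᵒᵖ :=
  lift ((satisfies h).antipode h)

/-- The antipode as a linear map. -/
noncomputable def antipodeLin : D.U α β γ h →ₗ[k] D.U α β γ h :=
  (MulOpposite.opLinearEquiv k).symm.toLinearMap ∘ₗ (antipodeHom h).toLinearMap

noncomputable instance : Bialgebra k (D.U α β γ h) :=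
  Bialgebra.ofAlgHom (comulHom h) (counitHom h)
    (algHom_ext (by simp [comulHom]) (by
        simp [comulHom, TensorProduct.add_tmul, TensorProduct.tmul_add, add_assoc,
          Algebra.TensorProduct.one_def])
      (by
        simp [comulHom, TensorProduct.add_tmul, TensorProduct.tmul_add, add_assoc,
          Algebra.TensorProduct.one_def]))
    (algHom_ext (by simp [comulHom, counitHom]) (by simp [comulHom, counitHom])
      (by simp [comulHom, counitHom]))
    (algHom_ext (by simp [comulHom, counitHom]) (by simp [comulHom, counitHom])
      (by simp [comulHom, counitHom]))

theorem comul_eq (u : D.U α β γ h) : Coalgebra.comul (R := k) u = comulHom h u := rfl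

theorem counit_eq (u : D.U α β γ h) : Coalgebra.counit (R := k) u = counitHom h u := rfl

theorem antipodeLin_mul (u v : D.U α β γ h) :
    antipodeLin h (u * v) = antipodeLin h v * antipodeLin h u := by
  simp [antipodeLin]

theorem antipodeLin_algebraMap (c : k) :
    antipodeLin h (algebraMap k (D.U α β γ h) c) = algebraMap k _ c := by
  simp [antipodeLin]

theorem antipode_left_aux (t s : D.U α β γ h ⊗[k] D.U α β γ h) (c : k)
    (ht : LinearMap.mul' k _ ((antipodeLin h).rTensor _ t) = algebraMap k _ c) :
    LinearMap.mul' k _ ((antipodeLin h).rTensor _ (t * s)) =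
      c • LinearMap.mul' k _ ((antipodeLin h).rTensor _ s) := by
  induction s using TensorProduct.induction_on with
  | zero => simp
  | add s₁ s₂ h₁ h₂ => simp only [mul_add, map_add, h₁, h₂, smul_add]
  | tmul v w =>
    have key : ∀ t : D.U α β γ h ⊗[k] D.U α β γ h,
        LinearMap.mul' k _ ((antipodeLin h).rTensor _ (t * v ⊗ₜ[k] w)) =
          antipodeLin h v * LinearMap.mul' k _ ((antipodeLin h).rTensor _ t) * w := by
      intro t
      induction t using TensorProduct.induction_on with
      | zero => simp
      | add s₁ s₂ h₁ h₂ => simp only [add_mul, mul_add, map_add, h₁, h₂]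
      | tmul v' w' => simp [antipodeLin_mul, mul_assoc]
    rw [key, ht, ← Algebra.commutes, mul_assoc, ← Algebra.smul_def]
    simp

theorem antipode_right_aux (t s : D.U α β γ h ⊗[k] D.U α β γ h) (c : k)
    (hs : LinearMap.mul' k _ ((antipodeLin h).lTensor _ s) = algebraMap k _ c) :
    LinearMap.mul' k _ ((antipodeLin h).lTensor _ (t * s)) =
      c • LinearMap.mul' k _ ((antipodeLin h).lTensor _ t) := by
  induction t using TensorProduct.induction_on with
  | zero => simp
  | add s₁ s₂ h₁ h₂ => simp only [add_mul, map_add, h₁, h₂, smul_add]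
  | tmul v w =>
    have key : ∀ s : D.U α β γ h ⊗[k] D.U α β γ h,
        LinearMap.mul' k _ ((antipodeLin h).lTensor _ (v ⊗ₜ[k] w * s)) =
          v * LinearMap.mul' k _ ((antipodeLin h).lTensor _ s) * antipodeLin h w := by
      intro s
      induction s using TensorProduct.induction_on with
      | zero => simp
      | add s₁ s₂ h₁ h₂ => simp only [add_mul, mul_add, map_add, h₁, h₂]
      | tmul v' w' => simp [antipodeLin_mul, mul_assoc]
    rw [key, hs, ← Algebra.commutes, mul_assoc, ← Algebra.smul_def]
    simp

theorem antipode_left (u : D.U α β γ h) :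
    LinearMap.mul' k _ ((antipodeLin h).rTensor _ (comulHom h u)) =
      algebraMap k _ (counitHom h u) := by
  have hs := satisfies (γ := γ) h
  have hq : (D.q ^ D.ν)⁻¹ * D.q ^ D.ν = 1 := inv_mul_cancel₀ (pow_ne_zero _ D.q_ne_zero)
  have hq' : D.q ^ D.ν * (D.q ^ D.ν)⁻¹ = 1 := mul_inv_cancel₀ (pow_ne_zero _ D.q_ne_zero)
  have h1 : antipodeLin h (1 : D.U α β γ h) = 1 := by simp [antipodeLin]
  have hi := hs.inv_pow_mul D.ν
  induction u using induction with
  | hk c => simp [antipodeLin_algebraMap, Algebra.TensorProduct.algebraMap_apply]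
  | ha => simp [comulHom, counitHom, antipodeLin, antipodeHom, hs.inv_mul_a]
  | hx =>
    have e : antipodeLin h (x h : D.U α β γ h) =
      -((D.q ^ D.ν)⁻¹ • ((a h ^ (D.N - 1)) ^ D.ν * x h)) := by simp [antipodeLin, antipodeHom]
    simp only [comulHom, counitHom, lift_x, map_add, LinearMap.rTensor_tmul, LinearMap.mul'_apply,
      e, h1, one_mul, neg_mul, smul_mul_assoc, mul_assoc, hs.x_a_pow, mul_smul_comm, smul_smul, hq,
      one_smul, map_zero]
    rw [← mul_assoc, hi, one_mul, neg_add_cancel]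
  | hy =>
    have e : antipodeLin h (y h : D.U α β γ h) =
      -(D.q ^ D.ν • ((a h ^ (D.N - 1)) ^ D.ν * y h)) := by simp [antipodeLin, antipodeHom]
    simp only [comulHom, counitHom, lift_y, map_add, LinearMap.rTensor_tmul, LinearMap.mul'_apply,
      e, h1, one_mul, neg_mul, smul_mul_assoc, mul_assoc, hs.y_a_pow, mul_smul_comm, smul_smul, hq',
      one_smul, map_zero]
    rw [← mul_assoc, hi, one_mul, neg_add_cancel]
  | hadd u v hu hv => simp only [map_add, hu, hv]
  | hmul u v hu hv =>
    rw [map_mul, antipode_left_aux h _ _ _ hu, hv, map_mul, map_mul, ← Algebra.smul_def]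

theorem antipode_right (u : D.U α β γ h) :
    LinearMap.mul' k _ ((antipodeLin h).lTensor _ (comulHom h u)) =
      algebraMap k _ (counitHom h u) := by
  have hs := satisfies (γ := γ) h
  have h1 : antipodeLin h (1 : D.U α β γ h) = 1 := by simp [antipodeLin]
  have hpow : antipodeLin h ((a h : D.U α β γ h) ^ D.ν) = (a h ^ (D.N - 1)) ^ D.ν := by
    simp [antipodeLin, antipodeHom]
  induction u using induction with
  | hk c => simp [h1, Algebra.TensorProduct.algebraMap_apply]
  | ha => simp [comulHom, counitHom, antipodeLin, antipodeHom, hs.a_mul_inv]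
  | hx =>
    have e : antipodeLin h (x h : D.U α β γ h) =
      -((D.q ^ D.ν)⁻¹ • ((a h ^ (D.N - 1)) ^ D.ν * x h)) := by simp [antipodeLin, antipodeHom]
    simp only [comulHom, counitHom, lift_x, map_add, LinearMap.lTensor_tmul, LinearMap.mul'_apply,
      e, hpow, one_mul, hs.x_inv_pow, map_zero]
    rw [add_neg_cancel]
  | hy =>
    have e : antipodeLin h (y h : D.U α β γ h) =
      -(D.q ^ D.ν • ((a h ^ (D.N - 1)) ^ D.ν * y h)) := by simp [antipodeLin, antipodeHom]
    simp only [comulHom, counitHom, lift_y, map_add, LinearMap.lTensor_tmul, LinearMap.mul'_apply,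
      e, hpow, one_mul, hs.y_inv_pow, map_zero]
    rw [add_neg_cancel]
  | hadd u v hu hv => simp only [map_add, hu, hv]
  | hmul u v hu hv =>
    rw [map_mul, antipode_right_aux h _ _ _ hv, hu, map_mul, mul_comm, map_mul, ← Algebra.smul_def]

noncomputable instance : HopfAlgebra k (D.U α β γ h) where
  antipode := antipodeLin h
  mul_antipode_rTensor_comul := LinearMap.ext (antipode_left h)
  mul_antipode_lTensor_comul := LinearMap.ext (antipode_right h)

theorem comul_a : Coalgebra.comul (R := k) (a h : D.U α β γ h) = a h ⊗ₜ[k] a h := by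
  rw [comul_eq, comulHom, lift_a]

theorem comul_x : Coalgebra.comul (R := k) (x h : D.U α β γ h) =
    x h ⊗ₜ[k] (a h ^ D.ν) + 1 ⊗ₜ[k] x h := by
  rw [comul_eq, comulHom, lift_x]

theorem comul_y : Coalgebra.comul (R := k) (y h : D.U α β γ h) =
    y h ⊗ₜ[k] (a h ^ D.ν) + 1 ⊗ₜ[k] y h := by
  rw [comul_eq, comulHom, lift_y]

theorem isGroupLikeElem_a : IsGroupLikeElem k (a h : D.U α β γ h) where
  counit_eq_one := by rw [counit_eq, counitHom, lift_a]
  comul_eq_tmul_self := by rw [comul_eq, comulHom, lift_a]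

/-- The generator `a` as an element of the group of grouplike elements. -/
noncomputable def aG : GroupLike k (D.U α β γ h) := ⟨a h, isGroupLikeElem_a h⟩

end U

end Datum

/-! ### Radford's algebras `U_{(N,ν,ω)}` -/

/-- The parameters of Radford's algebra `U_{(N,ν,ω)}`: integers `1 ≤ ν < N` with `N ∤ ν²` and a
primitive `N`-th root of unity `ω ∈ k`. -/
structure RadfordDatum (k : Type u) [Field k] where
  N : ℕ
  ν : ℕ
  ω : k
  one_le_ν : 1 ≤ ν
  ν_lt_N : ν < N
  not_dvd : ¬ N ∣ ν ^ 2
  isPrimitiveRoot : IsPrimitiveRoot ω N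

namespace RadfordDatum

variable {k : Type u} [Field k] (R : RadfordDatum k)

/-- The datum `(N/(N,ν), N, ν, ω^ν)`. -/
noncomputable def toDatum : Datum k where
  n := R.N / Nat.gcd R.N R.ν
  N := R.N
  ν := R.ν
  q := R.ω ^ R.ν
  one_lt_n := by
    have h1 : 0 < R.N := by have := R.ν_lt_N; omega
    have hg : 0 < Nat.gcd R.N R.ν := Nat.gcd_pos_of_pos_left _ h1
    have hle : Nat.gcd R.N R.ν ≤ R.ν := Nat.gcd_le_right _ R.one_le_ν
    obtain ⟨m, hm⟩ := Nat.gcd_dvd_left R.N R.ν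
    have hlt := R.ν_lt_N
    have : R.N / Nat.gcd R.N R.ν = m := Nat.div_eq_of_eq_mul_right hg hm
    rw [this]
    by_contra hcon
    have : Nat.gcd R.N R.ν * m ≤ Nat.gcd R.N R.ν * 1 := Nat.mul_le_mul_left _ (by omega)
    omega
  one_le_ν := R.one_le_ν
  ν_lt_N := R.ν_lt_N
  n_dvd_N := Nat.div_dvd_of_dvd (Nat.gcd_dvd_left _ _)
  isPrimitiveRoot := by
    have h := IsPrimitiveRoot.orderOf (R.ω ^ R.ν)
    have hN : 0 < R.N := by have := R.ν_lt_N; omega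
    rwa [orderOf_pow' _ (by have := R.one_le_ν; omega), ← R.isPrimitiveRoot.eq_orderOf] at h

theorem admissible : R.toDatum.Admissible 0 0 where
  of_eq_zero _ hd := by
    refine R.not_dvd ?_
    have h1 : R.N / Nat.gcd R.N R.ν ∣ R.ν := hd
    have h2 := Nat.mul_dvd_mul h1 (Nat.gcd_dvd_right R.N R.ν)
    rwa [Nat.div_mul_cancel (Nat.gcd_dvd_left _ _), ← sq] at h2
  of_ne_zero h := absurd ⟨rfl, rfl⟩ h

/-- Radford's Hopf algebra `U_{(N,ν,ω)} = U_{(N/(N,ν),N,ν,ω^ν,0,0,1)}`: it is generated by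
`a, x, y` with relations `a^N = 1`, `x^r = 0 = y^r`, `x a = q a x`, `y a = q⁻¹ a y` and
`y x - q^{-ν} x y = a^{2ν} - 1`, where `q = ω^ν` and `r = |q^ν|`. -/
abbrev U : Type u := R.toDatum.U 0 0 1 R.admissible

end RadfordDatum

end PointedHopf

open PointedHopf

/-!
The argument rests on the basis of monomials `a^i x^j y^l`. They span because `Y X^m` can be
rewritten with the powers of `X` to the left (`Commutes.y_x_pow`). For linear independence, the
regular representation is constructed by hand: on a commutative algebra `k[g, ξ, η]` with the
same exponents, obtained by adjoining three roots (`exists_commutative_model`), the formulas for the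
left multiplication by `a`, `x`, `y` define operators that satisfy the relations
(`exists_regular_representation`). They are well defined because the `q`-integers `[m]_p`,
`p = q^ν`, are periodic in `m` with period `r`.

By the `q`-binomial theorem `Δ(a^i x^j y^l)` is a sum of tensors of monomials. Read in coordinates,
every coefficient of `Δ(z)` is zero or a nonzero multiple of a single coefficient of `z`
(`coord_tensor_coord_comul`). Contracting `Δ(c)` with the coordinate of a monomial of maximal degree
shows that every nonzero subcoalgebra contains a power of `a`, which gives pointedness and the
grouplike elements; comparing coefficients gives the skew primitive elements and the first term of
the coradical filtration.

For `Λ = (∑ a^i) x^{r-1} y^{r-1}`, moving a generator past `∑ a^i` produces an eigenvector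
`∑ q^{±i} a^i` of the multiplication by `a`, which is killed by `a^{νn} - 1` and, up to an
identity between `q`-integers, by the terms coming from `γ`. Exchanging `x` and `y` and reversing
the multiplication preserves the relations, so that `Λ` is a right integral as well. Left integrals
are multiples of `Λ` by comparison of coordinates, and right integrals because the antipode is
bijective.

If `γ = s²`, then `a ↦ a`, `x ↦ s x`, `y ↦ s y` is a surjection of Hopf algebras onto Radford's
algebra `H`. Its coinvariants are spanned by the powers of the central element `a^n`, and
`a^i x^j y^l ↦ s^{-(j+l)} a^i x^j y^l` (`0 ≤ i < n`) is a colinear section. Such a central extension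
is a crossed product with trivial action (`CentralExtension.isCrossedProduct`) if its cocycle is
convolution invertible. This holds because the cocycle takes invertible values on pairs of grouplike
elements and `H` is pointed (`isUnit_conv`).

An isomorphism of Hopf algebras preserves the skew primitive elements and the commutation relations
with powers of `a`; for `n > 2` the eigenvalues `q` and `q⁻¹` differ, so that `x` and `y` can only
be rescaled. Rescaling by `c` and `d` changes `(α, β, γ)` to `(c^n α, d^n β, c d γ)`, whence the
invariant `α β / γ^n`.
-/

namespace PointedHopf

universe u v w

/-! ### `q`-integers -/

section QInteger

variable {k : Type u} [Field k]

/-- The `q`-integer `[m]_p = 1 + p + ⋯ + p^{m-1}`. -/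
def qInt (p : k) (m : ℕ) : k := ∑ i ∈ Finset.range m, p ^ i

@[simp] theorem qInt_zero (p : k) : qInt p 0 = 0 := by simp [qInt]

theorem qInt_succ' (p : k) (m : ℕ) : qInt p (m + 1) = 1 + p * qInt p m := by
  rw [qInt, Finset.sum_range_succ', qInt, Finset.mul_sum, add_comm]
  simp [pow_succ']

theorem qInt_succ (p : k) (m : ℕ) : qInt p (m + 1) = qInt p m + p ^ m := by
  rw [qInt, Finset.sum_range_succ, qInt]

theorem qInt_eq_zero {p : k} {r : ℕ} (hr : 1 < r) (hp : IsPrimitiveRoot p r) :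
    qInt p r = 0 := hp.geom_sum_eq_zero hr

theorem qInt_add (p : k) {r : ℕ} (hr : qInt p r = 0) (h1 : p ^ r = 1) (m : ℕ) :
    qInt p (m + r) = qInt p m := by
  induction m with
  | zero => simpa using hr
  | succ m ih => rw [Nat.add_right_comm, qInt_succ, ih, qInt_succ, pow_add, h1, mul_one]

theorem qChoose_ne_zero {p : k} {r : ℕ} (hp : IsPrimitiveRoot p r) :
    ∀ m s, s ≤ m → m < r → qChoose p m s ≠ 0
  | 0, 0, _, _ => by simp [qChoose]
  | m + 1, 0, _, _ => by simp [qChoose]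
  | m + 1, s + 1, h, hm => by
    have hs := qChoose_step p (m + 1) s (by omega)
    have ih := qChoose_ne_zero hp (m + 1) s (by omega) hm
    have h2 : p ^ (m + 1 - s) - 1 ≠ 0 :=
      sub_ne_zero.2 (hp.pow_ne_one_of_pos_of_lt (by omega) (by omega))
    intro h0
    rw [h0, zero_mul] at hs
    exact mul_ne_zero ih h2 hs.symm

end QInteger

namespace Datum

variable {k : Type u} [Field k] {D : Datum k} {α β γ : k}

theorem N_pos (D : Datum k) : 0 < D.N := by have := D.ν_lt_N; omega

theorem n_pos (D : Datum k) : 0 < D.n := by have := D.one_lt_n; omega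

theorem Admissible.one_lt_r (h : D.Admissible α β) : 1 < D.r := by
  by_cases h0 : α = 0 ∧ β = 0
  · have h1 := h.of_eq_zero h0
    have h2 : D.r ≠ 1 := by
      intro h3
      exact h1 (D.isPrimitiveRoot.dvd_of_pow_eq_one _ (orderOf_eq_one_iff.1 h3))
    have := D.r_pos
    omega
  · rw [h.r_eq h0]
    exact D.one_lt_n

theorem Admissible.symm (h : D.Admissible α β) : D.Admissible β α where
  of_eq_zero h0 := h.of_eq_zero h0.symm
  of_ne_zero h0 := h.of_ne_zero fun h1 => h0 h1.symm

/-- Either `r = n`, so that `q^r = 1`, or both `α` and `β` vanish. -/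
theorem Admissible.q_pow_r_mul (h : D.Admissible α β) : D.q ^ D.r * α = α := by
  by_cases h0 : α = 0 ∧ β = 0
  · simp [h0.1]
  · rw [h.r_eq h0, D.isPrimitiveRoot.pow_eq_one, one_mul]

theorem q_pow_mul_n (D : Datum k) (m : ℕ) : D.q ^ (m * D.n) = 1 := by
  rw [mul_comm, pow_mul, D.isPrimitiveRoot.pow_eq_one, one_pow]

theorem q_pow_ν_ne_zero (D : Datum k) : D.q ^ D.ν ≠ 0 := pow_ne_zero _ D.q_ne_zero

/-- The three relations of `U_{α,β,γ}` that involve two different generators. -/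
structure Commutes (D : Datum k) (γ : k) {B : Type v} [Ring B] [Algebra k B] (A X Y : B) :
    Prop where
  x_a : X * A = D.q • (A * X)
  y_a : Y * A = D.q⁻¹ • (A * Y)
  y_x : Y * X - (D.q ^ D.ν)⁻¹ • (X * Y) = γ • (A ^ (2 * D.ν) - 1)

namespace Commutes

variable {B : Type v} [Ring B] [Algebra k B] {A X Y : B}

theorem x_a_pow (hs : D.Commutes γ A X Y) (m : ℕ) :
    X * A ^ m = D.q ^ m • (A ^ m * X) := mul_pow_of_smul hs.x_a m

theorem y_a_pow (hs : D.Commutes γ A X Y) (m : ℕ) :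
    Y * A ^ m = (D.q ^ m)⁻¹ • (A ^ m * Y) := by
  rw [← inv_pow]; exact mul_pow_of_smul hs.y_a m

theorem y_pow_a_pow (hs : D.Commutes γ A X Y) (l m : ℕ) :
    Y ^ l * A ^ m = ((D.q ^ (l * m))⁻¹) • (A ^ m * Y ^ l) := by
  induction l with
  | zero => simp
  | succ l ih =>
    rw [pow_succ', mul_assoc, ih, mul_smul_comm, ← mul_assoc, hs.y_a_pow, smul_mul_assoc,
      smul_smul, mul_assoc, ← mul_inv, ← pow_add]
    congr 3
    ring

theorem x_pow_a_pow (hs : D.Commutes γ A X Y) (l m : ℕ) :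
    X ^ l * A ^ m = (D.q ^ (l * m)) • (A ^ m * X ^ l) := by
  induction l with
  | zero => simp
  | succ l ih =>
    rw [pow_succ', mul_assoc, ih, mul_smul_comm, ← mul_assoc, hs.x_a_pow, smul_mul_assoc,
      smul_smul, mul_assoc, ← pow_add]
    congr 2
    ring

theorem y_mul_x (hs : D.Commutes γ A X Y) :
    Y * X = (D.q ^ D.ν)⁻¹ • (X * Y) + γ • (A ^ (2 * D.ν) - 1) := by
  rw [← hs.y_x]; abel

/-- Moving `Y` past a power of `X`. -/
theorem y_x_pow (hs : D.Commutes γ A X Y) (m : ℕ) :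
    Y * X ^ (m + 1) = ((D.q ^ D.ν)⁻¹) ^ (m + 1) • (X ^ (m + 1) * Y) +
      γ • ((qInt (D.q ^ D.ν) (m + 1) • A ^ (2 * D.ν) -
        qInt (D.q ^ D.ν)⁻¹ (m + 1) • 1) * X ^ m) := by
  induction m with
  | zero => simp [hs.y_mul_x, qInt]
  | succ m ih =>
    have hx : X * A ^ (2 * D.ν) = ((D.q ^ D.ν) ^ 2) • (A ^ (2 * D.ν) * X) := by
      rw [hs.x_a_pow, ← pow_mul, mul_comm D.ν 2]
    have hp := D.q_pow_ν_ne_zero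
    have hyx := hs.y_mul_x
    generalize D.q ^ D.ν = p at *
    rw [pow_succ' X (m + 1), ← mul_assoc, hyx, add_mul, smul_mul_assoc, mul_assoc, ih,
      mul_add, smul_add, mul_smul_comm, smul_smul, ← pow_succ', ← mul_assoc, ← pow_succ',
      smul_mul_assoc, mul_smul_comm, ← mul_assoc, mul_sub, mul_smul_comm, mul_smul_comm, hx,
      qInt_succ' p (m + 1), qInt_succ' p⁻¹ (m + 1)]
    simp only [sub_mul, smul_mul_assoc, mul_assoc, ← pow_succ', mul_one, one_mul]
    match_scalars <;> field_simp <;> ring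

open MulOpposite in
/-- The defining relations are preserved if `X` and `Y` are exchanged and the multiplication is
reversed. -/
theorem op_swap (hs : D.Commutes γ A X Y) : D.Commutes γ (op A) (op Y) (op X) where
  x_a := by
    rw [← op_mul, ← op_mul, ← op_smul, hs.y_a, smul_smul, mul_inv_cancel₀ D.q_ne_zero, one_smul]
  y_a := by
    rw [← op_mul, ← op_mul, ← op_smul, hs.x_a, smul_smul, inv_mul_cancel₀ D.q_ne_zero, one_smul]
  y_x := by
    rw [← op_mul, ← op_mul, ← op_smul, ← op_sub, ← op_pow, ← op_one, ← op_sub, ← op_smul, hs.y_x]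

open MulOpposite in
/-- Moving `X` past a power of `Y`; this is `y_x_pow` in the opposite algebra. -/
theorem y_pow_x (hs : D.Commutes γ A X Y) (m : ℕ) :
    Y ^ (m + 1) * X = ((D.q ^ D.ν)⁻¹) ^ (m + 1) • (X * Y ^ (m + 1)) +
      γ • (Y ^ m * (qInt (D.q ^ D.ν) (m + 1) • A ^ (2 * D.ν) -
        qInt (D.q ^ D.ν)⁻¹ (m + 1) • 1)) := by
  have := congrArg unop (hs.op_swap.y_x_pow m)
  simpa only [unop_mul, unop_pow, unop_op, unop_add, unop_smul, unop_sub, unop_one] using this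

end Commutes

namespace Satisfies

variable {B : Type v} [Ring B] [Algebra k B] {A X Y : B}

theorem commutes (hs : D.Satisfies α β γ A X Y) : D.Commutes γ A X Y := ⟨hs.x_a, hs.y_a, hs.y_x⟩

open MulOpposite in
theorem op_swap (hs : D.Satisfies α β γ A X Y) : D.Satisfies β α γ (op A) (op Y) (op X) where
  a_pow := by rw [← op_pow, hs.a_pow, op_one]
  x_pow := by rw [← op_pow, ← op_pow, ← op_one, ← op_sub, ← op_smul, hs.y_pow]
  y_pow := by rw [← op_pow, ← op_pow, ← op_one, ← op_sub, ← op_smul, hs.x_pow]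
  x_a := hs.commutes.op_swap.x_a
  y_a := hs.commutes.op_swap.y_a
  y_x := hs.commutes.op_swap.y_x

end Satisfies

end Datum

/-! ### The regular representation -/

section CommutativeModel

variable {k : Type u} [Field k]

/-- If `b` is a basis of `R`, adjoining an `r`-th root `ξ` of `c` to `R` gives an algebra with basis
`b_i ξ^j`, `j < r`. -/
theorem exists_adjoin_root {ι : Type} [Nonempty ι] {R : Type u} [CommRing R] [Algebra k R]
    (b : Module.Basis ι k R) (c : R) {r : ℕ} (hr : 0 < r) :
    ∃ (S : Type u) (_ : CommRing S) (_ : Algebra k S) (f : R →ₐ[k] S) (ξ : S)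
      (b' : Module.Basis (ι × Fin r) k S), ξ ^ r = f c ∧
        ∀ i j, b' (i, j) = f (b i) * ξ ^ (j : ℕ) := by
  open Polynomial in
  have : Nontrivial R := b.repr.toEquiv.nontrivial
  have hm : (X ^ r - C c : R[X]).Monic := monic_X_pow_sub_C c hr.ne'
  let B := AdjoinRoot.powerBasis' hm
  have hdim : B.dim = r := by
    simp [B]
  let b' := (b.smulTower B.basis).reindex
    ((Equiv.refl ι).prodCongr (finCongr hdim))
  refine ⟨AdjoinRoot (X ^ r - C c : R[X]), inferInstance, inferInstance,
    IsScalarTower.toAlgHom k R _, AdjoinRoot.root _, b', ?_, ?_⟩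
  · have h := AdjoinRoot.eval₂_root (X ^ r - C c : R[X])
    simpa [sub_eq_zero] using h
  · intro i j
    simp [b', Module.Basis.smulTower_apply, Algebra.smul_def, B, AdjoinRoot.powerBasis'_gen]

/-- A commutative algebra with the same basis of monomials as `U_{α,β,γ}`: it is obtained from `k`
by adjoining successively an `N`-th root of `1`, an `r`-th root of `α (g^m - 1)` and an `r`-th root
of `β (g^m - 1)`. -/
theorem exists_commutative_model (α β : k) {N r : ℕ} (hN : 0 < N) (hr : 0 < r) (m : ℕ) :
    ∃ (M : Type u) (_ : CommRing M) (_ : Algebra k M) (g ξ η : M)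
      (b : Module.Basis (Fin N × Fin r × Fin r) k M),
      g ^ N = 1 ∧ ξ ^ r = α • (g ^ m - 1) ∧ η ^ r = β • (g ^ m - 1) ∧
      ∀ i j l, b (i, j, l) = g ^ (i : ℕ) * ξ ^ (j : ℕ) * η ^ (l : ℕ) := by
  have : NeZero N := ⟨hN.ne'⟩
  have : NeZero r := ⟨hr.ne'⟩
  obtain ⟨S₁, _, _, f₁, g, b₁, hg, hb₁⟩ :=
    exists_adjoin_root (Module.Basis.singleton Unit k) (1 : k) hN
  obtain ⟨S₂, _, _, f₂, ξ, b₂, hξ, hb₂⟩ := exists_adjoin_root b₁ (α • (g ^ m - 1)) hr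
  obtain ⟨S₃, _, _, f₃, η, b₃, hη, hb₃⟩ := exists_adjoin_root b₂ (β • (f₂ g ^ m - 1)) hr
  let e : (((Unit × Fin N) × Fin r) × Fin r) ≃ Fin N × Fin r × Fin r :=
    ((Equiv.prodAssoc _ _ _).trans ((Equiv.punitProd _).prodCongr (Equiv.refl _)))
  refine ⟨S₃, inferInstance, inferInstance, f₃ (f₂ g), f₃ ξ, η, b₃.reindex e, ?_, ?_, ?_, ?_⟩
  · rw [← map_pow, ← map_pow, hg]; simp
  · rw [← map_pow, hξ]; simp
  · rw [hη]; simp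
  · intro i j l
    simp [e, hb₃, hb₂, hb₁]

/-- A function of three natural numbers that satisfies the recursions of the exponents in
`g^i ξ^j η^l` factors through the commutative model. -/
theorem exists_linearMap_of_periodic {α β : k} {N r m : ℕ} (hN : 0 < N) (hr : 0 < r)
    {M : Type u} [CommRing M] [Algebra k M] {g ξ η : M}
    (b : Module.Basis (Fin N × Fin r × Fin r) k M)
    (hg : g ^ N = 1) (hξ : ξ ^ r = α • (g ^ m - 1)) (hη : η ^ r = β • (g ^ m - 1))
    (hb : ∀ i j l, b (i, j, l) = g ^ (i : ℕ) * ξ ^ (j : ℕ) * η ^ (l : ℕ))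
    {W : Type u} [AddCommGroup W] [Module k W] (F : ℕ → ℕ → ℕ → W)
    (hi : ∀ i j l, F (i + N) j l = F i j l)
    (hj : ∀ i j l, F i (j + r) l = α • (F (i + m) j l - F i j l))
    (hl : ∀ i j l, F i j (l + r) = β • (F (i + m) j l - F i j l)) :
    ∃ T : M →ₗ[k] W, ∀ i j l : ℕ, T (g ^ i * ξ ^ j * η ^ l) = F i j l := by
  refine ⟨b.constr k fun t => F t.1 t.2.1 t.2.2, fun i j l => ?_⟩
  set T := b.constr k fun t => F t.1 t.2.1 t.2.2 with hT
  induction l using Nat.strong_induction_on generalizing i j with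
  | _ l ihl =>
  rcases Nat.lt_or_ge l r with hlr | hlr
  · induction j using Nat.strong_induction_on generalizing i with
    | _ j ihj =>
    rcases Nat.lt_or_ge j r with hjr | hjr
    · induction i using Nat.strong_induction_on with
      | _ i ihi =>
      rcases Nat.lt_or_ge i N with hiN | hiN
      · have := b.constr_basis k (fun t => F t.1 t.2.1 t.2.2) (⟨i, hiN⟩, ⟨j, hjr⟩, ⟨l, hlr⟩)
        rwa [hb] at this
      · obtain ⟨i, rfl⟩ : ∃ i', i = i' + N := ⟨i - N, by omega⟩
        rw [hi, ← ihi i (by omega), pow_add, hg, mul_one]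
    · obtain ⟨j, rfl⟩ : ∃ j', j = j' + r := ⟨j - r, by omega⟩
      have e : g ^ i * ξ ^ (j + r) * η ^ l =
          α • (g ^ (i + m) * ξ ^ j * η ^ l - g ^ i * ξ ^ j * η ^ l) := by
        rw [pow_add ξ, hξ, pow_add g]
        simp only [Algebra.smul_def]
        ring
      have ih := ihj j (by omega)
      rw [e, map_smul, map_sub, hj, ih, ih]
  · obtain ⟨l, rfl⟩ : ∃ l', l = l' + r := ⟨l - r, by omega⟩
    have e : g ^ i * ξ ^ j * η ^ (l + r) =
        β • (g ^ (i + m) * ξ ^ j * η ^ l - g ^ i * ξ ^ j * η ^ l) := by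
      rw [pow_add η, hη, pow_add g]
      simp only [Algebra.smul_def]
      ring
    rw [e, map_smul, map_sub, hl, ihl l (by omega), ihl l (by omega)]

end CommutativeModel

namespace Datum

variable {k : Type u} [Field k] {D : Datum k} {α β γ : k}

/-- The regular representation of `U_{α,β,γ}`, written on the commutative model: `g^i ξ^j η^l`
plays the role of `a^i x^j y^l`, the vector `o` that of `1`, and the operators `A`, `X`, `Y` are
given by the formulas for the left multiplication by `a`, `x`, `y`. -/
theorem exists_regular_representation (h : D.Admissible α β) (γ : k) :
    ∃ (M : Type u) (_ : AddCommGroup M) (_ : Module k M) (A X Y : Module.End k M) (o : M)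
      (b : Module.Basis (Fin D.N × Fin D.r × Fin D.r) k M), D.Satisfies α β γ A X Y ∧
      ∀ i j l, b (i, j, l) = (A ^ (i : ℕ) * X ^ (j : ℕ) * Y ^ (l : ℕ)) o := by
  obtain ⟨M, _, _, g, ξ, η, b, hg, hξ, hη, hb⟩ :=
    exists_commutative_model α β D.N_pos D.r_pos (D.ν * D.n)
  have hq := D.q_ne_zero
  have hpr := D.isPrimitiveRoot_r
  have hr1 := h.one_lt_r
  have hp0 := D.q_pow_ν_ne_zero
  set p := D.q ^ D.ν with hp
  have hqi : ∀ i, D.q ^ (i + D.ν * D.n) = D.q ^ i := fun i => by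
    rw [pow_add, D.q_pow_mul_n, mul_one]
  have hext {W : Type u} [AddCommGroup W] [Module k W] {f f' : M →ₗ[k] W}
      (hf : ∀ i j l : ℕ, f (g ^ i * ξ ^ j * η ^ l) = f' (g ^ i * ξ ^ j * η ^ l)) : f = f' :=
    b.ext fun ⟨i, j, l⟩ => by rw [hb]; exact hf i j l
  have hξ' (i j l : ℕ) : g ^ i * ξ ^ (j + D.r) * η ^ l =
      α • (g ^ (i + D.ν * D.n) * ξ ^ j * η ^ l - g ^ i * ξ ^ j * η ^ l) := by
    rw [pow_add ξ, hξ, pow_add g]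
    simp only [Algebra.smul_def]
    ring
  have hη' (i j l : ℕ) : g ^ i * ξ ^ j * η ^ (l + D.r) =
      β • (g ^ (i + D.ν * D.n) * ξ ^ j * η ^ l - g ^ i * ξ ^ j * η ^ l) := by
    rw [pow_add η, hη, pow_add g]
    simp only [Algebra.smul_def]
    ring
  have hg' (i j l : ℕ) : g ^ (i + D.N) * ξ ^ j * η ^ l = g ^ i * ξ ^ j * η ^ l := by
    rw [pow_add, hg, mul_one]
  obtain ⟨A, hA⟩ := exists_linearMap_of_periodic D.N_pos D.r_pos b hg hξ hη hb
    (fun i j l => g ^ (i + 1) * ξ ^ j * η ^ l)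
    (fun i j l => by rw [Nat.add_right_comm, hg'])
    (fun i j l => by rw [hξ', Nat.add_right_comm])
    (fun i j l => by rw [hη', Nat.add_right_comm])
  obtain ⟨X, hX⟩ := exists_linearMap_of_periodic D.N_pos D.r_pos b hg hξ hη hb
    (fun i j l => D.q ^ i • (g ^ i * ξ ^ (j + 1) * η ^ l))
    (fun i j l => by rw [hg', pow_add, D.q_pow_N, mul_one])
    (fun i j l => by rw [Nat.add_right_comm, hξ', hqi]; module)
    (fun i j l => by rw [hη', hqi]; module)
  have hqr : qInt p D.r = 0 := qInt_eq_zero hr1 hpr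
  have hqr' : qInt p⁻¹ D.r = 0 := qInt_eq_zero hr1 hpr.inv
  have hpr1 : p ^ D.r = 1 := hpr.pow_eq_one
  have hpr1' : p⁻¹ ^ D.r = 1 := hpr.inv.pow_eq_one
  obtain ⟨Y, hY⟩ := exists_linearMap_of_periodic D.N_pos D.r_pos b hg hξ hη hb
    -- For `j = 0` the truncated exponent `j - 1` is harmless, since `[0]_p = 0`.
    (fun i j l => (D.q ^ i)⁻¹ • (p⁻¹ ^ j • (g ^ i * ξ ^ j * η ^ (l + 1)) +
      γ • (qInt p j • (g ^ (i + 2 * D.ν) * ξ ^ (j - 1) * η ^ l) -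
        qInt p⁻¹ j • (g ^ i * ξ ^ (j - 1) * η ^ l))))
    (fun i j l => by rw [hg', Nat.add_right_comm, hg', hg', pow_add, D.q_pow_N, mul_one])
    (fun i j l => by
      rw [hqi, hξ', qInt_add p hqr hpr1, qInt_add p⁻¹ hqr' hpr1', pow_add p⁻¹, hpr1', mul_one]
      rcases j with _ | j
      · simp only [qInt_zero]
        module
      · have e : j + 1 + D.r - 1 = j + D.r := by omega
        rw [e, Nat.add_sub_cancel, hξ', hξ', Nat.add_right_comm i (D.ν * D.n)]
        module)
    (fun i j l => by
      rw [hqi, Nat.add_right_comm, hη', hη', hη', Nat.add_right_comm i (D.ν * D.n)]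
      module)
  have hAp (m i j l : ℕ) : (A ^ m) (g ^ i * ξ ^ j * η ^ l) = g ^ (i + m) * ξ ^ j * η ^ l := by
    induction m generalizing i with
    | zero => simp
    | succ m ih => rw [pow_succ, Module.End.mul_apply, hA, ih, Nat.add_right_comm, add_assoc]
  have hXp (m i j l : ℕ) : (X ^ m) (g ^ i * ξ ^ j * η ^ l) =
      (D.q ^ m) ^ i • (g ^ i * ξ ^ (j + m) * η ^ l) := by
    induction m generalizing j with
    | zero => simp
    | succ m ih =>
      rw [pow_succ, Module.End.mul_apply, hX, map_smul, ih, smul_smul, Nat.add_right_comm,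
        add_assoc, pow_succ', mul_pow]
  have hYp (m l : ℕ) : (Y ^ m) (g ^ 0 * ξ ^ 0 * η ^ l) = g ^ 0 * ξ ^ 0 * η ^ (l + m) := by
    induction m generalizing l with
    | zero => simp
    | succ m ih =>
      rw [pow_succ, Module.End.mul_apply, hY]
      simp only [pow_zero D.q, pow_zero p⁻¹, qInt_zero, zero_smul, sub_zero, smul_zero, add_zero,
        inv_one, one_smul]
      rw [ih, Nat.add_right_comm, add_assoc]
  have hmon (i j l : ℕ) : (A ^ i * X ^ j * Y ^ l) (g ^ 0 * ξ ^ 0 * η ^ 0) =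
      g ^ i * ξ ^ j * η ^ l := by
    rw [Module.End.mul_apply, Module.End.mul_apply, hYp, hXp, pow_zero (_ ^ j), one_smul,
      hAp, zero_add, zero_add, zero_add]
  have hc : D.Commutes γ A X Y := by
    constructor
    · refine hext fun i j l => ?_
      simp only [Module.End.mul_apply, LinearMap.smul_apply, hA, hX, map_smul, smul_smul]
      rw [pow_succ']
    · refine hext fun i j l => ?_
      simp only [Module.End.mul_apply, LinearMap.smul_apply, hA, hY, map_smul, map_add, map_sub]
      rw [pow_succ', mul_inv, Nat.add_right_comm]
      module
    · refine hext fun i j l => ?_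
      simp only [Module.End.mul_apply, LinearMap.smul_apply, LinearMap.sub_apply, hX, hY, hAp,
        map_smul, map_add, map_sub, Module.End.one_apply]
      rcases j with _ | j
      · simp only [qInt_zero, qInt_succ', zero_add]
        match_scalars <;> field_simp <;> ring
      · simp only [qInt_succ' p (j + 1), qInt_succ' p⁻¹ (j + 1), Nat.add_sub_cancel, pow_add,
          pow_mul']
        match_scalars <;> field_simp <;> ring
  have hqα (i : ℕ) : (D.q ^ D.r) ^ i * α = α := by
    induction i with
    | zero => simp
    | succ i ih => rw [pow_succ, mul_assoc, h.q_pow_r_mul, ih]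
  have hqβ (i : ℕ) : ((D.q ^ D.r) ^ i)⁻¹ * β = β := by
    have hne := pow_ne_zero i (pow_ne_zero D.r hq)
    rw [inv_mul_eq_iff_eq_mul₀ hne]
    induction i with
    | zero => simp
    | succ i ih =>
      rw [pow_succ, mul_assoc, h.symm.q_pow_r_mul]
      exact ih (pow_ne_zero i (pow_ne_zero D.r hq))
  refine ⟨M, inferInstance, inferInstance, A, X, Y, g ^ 0 * ξ ^ 0 * η ^ 0, b,
    ⟨?_, ?_, ?_, hc.x_a, hc.y_a, hc.y_x⟩, fun i j l => by rw [hmon, hb]⟩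
  · exact hext fun i j l => by rw [hAp, hg', Module.End.one_apply]
  · refine hext fun i j l => ?_
    rw [hXp, LinearMap.smul_apply, LinearMap.sub_apply, Module.End.one_apply, hAp, hξ', smul_smul,
      hqα]
  · refine hext fun i j l => ?_
    -- `Y^r` commutes with `X`, so it can be moved next to the cyclic vector.
    have hYX : Commute (Y ^ D.r) X := by
      have := hc.y_pow_x (D.r - 1)
      rwa [Nat.sub_add_cancel D.r_pos, ← hp, hqr, hqr', hpr1', zero_smul, zero_smul, sub_zero,
        mul_zero, smul_zero, add_zero, one_smul] at this
    have e : Y ^ D.r * (A ^ i * X ^ j * Y ^ l) =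
        ((D.q ^ D.r) ^ i)⁻¹ • (A ^ i * X ^ j * Y ^ (l + D.r)) := by
      rw [← mul_assoc, ← mul_assoc, hc.y_pow_a_pow, smul_mul_assoc, smul_mul_assoc,
        mul_assoc _ _ (X ^ j), (hYX.pow_right j).eq, ← pow_mul, mul_assoc, mul_assoc, mul_assoc,
        ← pow_add, add_comm D.r]
    rw [← hmon i j l, ← Module.End.mul_apply, e, LinearMap.smul_apply, hmon, hη', hmon, smul_smul,
      hqβ, LinearMap.smul_apply, LinearMap.sub_apply, Module.End.one_apply, hAp]

end Datum

namespace Datum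

namespace U

variable {k : Type u} [Field k] {D : Datum k} {α β γ : k} (h : D.Admissible α β)

/-! ### The monomial basis -/

/-- The span of all monomials contains `1` and is stable under left multiplication by the
generators. -/
theorem mem_span_monomials (u : D.U α β γ h) :
    u ∈ Submodule.span k {v : D.U α β γ h | ∃ i j l : ℕ, v = a h ^ i * x h ^ j * y h ^ l} := by
  have hc := (satisfies (γ := γ) h).commutes
  set S := Submodule.span k {v : D.U α β γ h | ∃ i j l : ℕ, v = a h ^ i * x h ^ j * y h ^ l}
    with hS
  have hm (i j l : ℕ) : (a h ^ i * x h ^ j * y h ^ l : D.U α β γ h) ∈ S :=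
    Submodule.subset_span ⟨i, j, l, rfl⟩
  have hmul (f : D.U α β γ h) (hf : ∀ i j l : ℕ, f * (a h ^ i * x h ^ j * y h ^ l) ∈ S) :
      ∀ s ∈ S, f * s ∈ S := by
    intro s hs
    induction hs using Submodule.span_induction with
    | mem v hv => obtain ⟨i, j, l, rfl⟩ := hv; exact hf i j l
    | zero => simp
    | add v w _ _ hv hw => rw [mul_add]; exact add_mem hv hw
    | smul c v _ hv => rw [mul_smul_comm]; exact S.smul_mem c hv
  suffices ∀ s ∈ S, u * s ∈ S by
    have h1 := this 1 (by simpa using hm 0 0 0)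
    rwa [mul_one] at h1
  induction u using induction with
  | hk c =>
    intro s hs
    rw [← Algebra.smul_def]
    exact S.smul_mem c hs
  | ha =>
    refine hmul _ fun i j l => ?_
    rw [← mul_assoc, ← mul_assoc, ← pow_succ']
    exact hm _ _ _
  | hx =>
    refine hmul _ fun i j l => ?_
    rw [← mul_assoc, ← mul_assoc, hc.x_a_pow, smul_mul_assoc, smul_mul_assoc, mul_assoc (a h ^ i),
      ← pow_succ']
    exact S.smul_mem _ (hm _ _ _)
  | hy =>
    refine hmul _ fun i j l => ?_
    rw [← mul_assoc, ← mul_assoc, hc.y_a_pow, smul_mul_assoc, smul_mul_assoc]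
    refine S.smul_mem _ ?_
    rcases j with _ | j
    · rw [pow_zero, mul_one, mul_assoc, ← pow_succ']
      simpa using hm i 0 (l + 1)
    · have e : (a h ^ i * y h * x h ^ (j + 1) * y h ^ l : D.U α β γ h) =
          ((D.q ^ D.ν)⁻¹) ^ (j + 1) • (a h ^ i * x h ^ (j + 1) * y h ^ (l + 1)) +
          γ • (qInt (D.q ^ D.ν) (j + 1) • (a h ^ (i + 2 * D.ν) * x h ^ j * y h ^ l) -
            qInt (D.q ^ D.ν)⁻¹ (j + 1) • (a h ^ i * x h ^ j * y h ^ l)) := by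
        rw [mul_assoc (a h ^ i), hc.y_x_pow, pow_succ' (y h), pow_add (a h)]
        simp only [mul_add, add_mul, mul_smul_comm, smul_mul_assoc, mul_assoc, sub_mul, mul_sub,
          one_mul]
      rw [e]
      exact S.add_mem (S.smul_mem _ (hm _ _ _)) (S.smul_mem _
        (S.sub_mem (S.smul_mem _ (hm _ _ _)) (S.smul_mem _ (hm _ _ _))))
  | hadd u v hu hv => intro s hs; rw [add_mul]; exact S.add_mem (hu s hs) (hv s hs)
  | hmul u v hu hv => intro s hs; rw [mul_assoc]; exact hu _ (hv s hs)

/-- The relations for `a^N`, `x^r` and `y^r` reduce the exponents of a monomial. -/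
theorem monomial_mem_span (i j l : ℕ) : (a h ^ i * x h ^ j * y h ^ l : D.U α β γ h) ∈
    Submodule.span k (Set.range fun t : Fin D.N × Fin D.r × Fin D.r =>
      (a h ^ (t.1 : ℕ) * x h ^ (t.2.1 : ℕ) * y h ^ (t.2.2 : ℕ) : D.U α β γ h)) := by
  have hs := satisfies (γ := γ) h
  set S := Submodule.span k (Set.range fun t : Fin D.N × Fin D.r × Fin D.r =>
      (a h ^ (t.1 : ℕ) * x h ^ (t.2.1 : ℕ) * y h ^ (t.2.2 : ℕ) : D.U α β γ h))
  induction l using Nat.strong_induction_on generalizing i j with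
  | _ l ihl =>
  rcases Nat.lt_or_ge l D.r with hlr | hlr
  · induction j using Nat.strong_induction_on generalizing i with
    | _ j ihj =>
    rcases Nat.lt_or_ge j D.r with hjr | hjr
    · rw [← Nat.mod_add_div i D.N, pow_add, pow_mul, hs.a_pow, one_pow, mul_one]
      exact Submodule.subset_span ⟨(⟨i % D.N, Nat.mod_lt _ D.N_pos⟩, ⟨j, hjr⟩, ⟨l, hlr⟩), rfl⟩
    · obtain ⟨j, rfl⟩ : ∃ j', j = D.r + j' := ⟨j - D.r, by omega⟩
      have e : (a h ^ i * x h ^ (D.r + j) * y h ^ l : D.U α β γ h) =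
          α • (a h ^ (i + D.ν * D.n) * x h ^ j * y h ^ l - a h ^ i * x h ^ j * y h ^ l) := by
        rw [pow_add (x h), hs.x_pow, pow_add (a h)]
        simp only [smul_mul_assoc, mul_smul_comm, mul_assoc, sub_mul, mul_sub, one_mul]
      rw [e]
      have ih := ihj j (by have := D.r_pos; omega)
      exact S.smul_mem _ (S.sub_mem (ih _) (ih _))
  · obtain ⟨l, rfl⟩ : ∃ l', l = D.r + l' := ⟨l - D.r, by omega⟩
    have e : (a h ^ i * x h ^ j * y h ^ (D.r + l) : D.U α β γ h) =
        β • (a h ^ (i + D.ν * D.n) * x h ^ j * y h ^ l - a h ^ i * x h ^ j * y h ^ l) := by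
      have hcom : x h ^ j * a h ^ (D.ν * D.n) = a h ^ (D.ν * D.n) * (x h ^ j : D.U α β γ h) := by
        rw [hs.commutes.x_pow_a_pow, ← mul_assoc, D.q_pow_mul_n, one_smul]
      rw [pow_add (y h), hs.y_pow, pow_add (a h), mul_assoc _ (a h ^ (D.ν * D.n)) (x h ^ j), ← hcom]
      simp only [smul_mul_assoc, mul_smul_comm, mul_assoc, sub_mul, mul_sub, one_mul]
    rw [e]
    have ih := ihl l (by have := D.r_pos; omega)
    exact S.smul_mem _ (S.sub_mem (ih _ _) (ih _ _))

/-- The monomials are mapped to a basis by the regular representation. -/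
theorem linearIndependent_monomials :
    LinearIndependent k (fun t : Fin D.N × Fin D.r × Fin D.r =>
      (a h ^ (t.1 : ℕ) * x h ^ (t.2.1 : ℕ) * y h ^ (t.2.2 : ℕ) : D.U α β γ h)) := by
  obtain ⟨M, _, _, A, X, Y, o, b, hs, hb⟩ := exists_regular_representation h γ
  refine LinearIndependent.of_comp
    ((LinearMap.applyₗ o).comp (lift (h := h) hs).toLinearMap) ?_
  convert b.linearIndependent using 1
  funext ⟨i, j, l⟩
  simp [hb]

/-- The basis of the monomials `a^i x^j y^l` with `i < N` and `j, l < r`. -/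
noncomputable def monomialBasis : Module.Basis (Fin D.N × Fin D.r × Fin D.r) k (D.U α β γ h) :=
  Module.Basis.mk (linearIndependent_monomials h) (by
    rintro u -
    refine Submodule.span_le.2 ?_ (mem_span_monomials h u)
    rintro _ ⟨i, j, l, rfl⟩
    exact monomial_mem_span h i j l)

theorem monomialBasis_apply (t : Fin D.N × Fin D.r × Fin D.r) :
    monomialBasis (γ := γ) h t = a h ^ (t.1 : ℕ) * x h ^ (t.2.1 : ℕ) * y h ^ (t.2.2 : ℕ) := by
  simp [monomialBasis]

instance : Module.Finite k (D.U α β γ h) := .of_basis (monomialBasis h)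

theorem finrank_eq : Module.finrank k (D.U α β γ h) = D.N * D.r ^ 2 := by
  rw [Module.finrank_eq_card_basis (monomialBasis h)]
  simp [sq]

instance : NeZero D.N := ⟨D.N_pos.ne'⟩

variable {h} in
/-- The monomial `a^i x^j y^l`, where the exponent of `a` is read modulo `N`. -/
noncomputable def mon (i : ZMod D.N) (j l : ℕ) : D.U α β γ h :=
  a h ^ i.val * x h ^ j * y h ^ l

theorem a_pow_eq_of_cast_eq {i i' : ℕ} (e : (i : ZMod D.N) = i') :
    (a h ^ i : D.U α β γ h) = a h ^ i' := by
  have e' := (ZMod.natCast_eq_natCast_iff' i i' D.N).1 e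
  rw [← Nat.mod_add_div i D.N, ← Nat.mod_add_div i' D.N, pow_add, pow_add, pow_mul, pow_mul,
    (satisfies h).a_pow, one_pow, one_pow, e']

theorem mon_natCast (i j l : ℕ) :
    mon (i : ZMod D.N) j l = (a h ^ i * x h ^ j * y h ^ l : D.U α β γ h) := by
  rw [mon, a_pow_eq_of_cast_eq h (i' := i) (by simp)]

theorem exists_natCast (i : ZMod D.N) : ∃ m : ℕ, i = (m : ZMod D.N) := ⟨i.val, by simp⟩

theorem a_pow_mul_mon (m : ℕ) (i : ZMod D.N) (j l : ℕ) :
    a h ^ m * mon i j l = (mon (m + i) j l : D.U α β γ h) := by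
  obtain ⟨i, rfl⟩ := exists_natCast i
  rw [← Nat.cast_add, mon_natCast, mon_natCast, pow_add, mul_assoc, mul_assoc, mul_assoc]

/-- The basis of monomials, indexed by `ℤ/N`. -/
noncomputable def basis : Module.Basis (ZMod D.N × Fin D.r × Fin D.r) k (D.U α β γ h) :=
  (monomialBasis h).reindex (Equiv.prodCongr
    { toFun := fun i => ((i : ℕ) : ZMod D.N)
      invFun := fun z => ⟨z.val, z.val_lt⟩
      left_inv := fun i => Fin.ext (ZMod.val_cast_of_lt i.2)
      right_inv := fun z => by simp } (Equiv.refl _))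

theorem basis_apply (t : ZMod D.N × Fin D.r × Fin D.r) :
    basis (γ := γ) h t = mon t.1 t.2.1 t.2.2 := by
  simp [basis, monomialBasis_apply, mon]

variable {h} in
theorem linearMap_ext {W : Type*} [AddCommGroup W] [Module k W] {f g : D.U α β γ h →ₗ[k] W}
    (hfg : ∀ i j l, j < D.r → l < D.r → f (mon i j l) = g (mon i j l)) : f = g :=
  (basis h).ext fun ⟨i, j, l⟩ => by rw [basis_apply]; exact hfg i j l j.2 l.2

variable {h} in
/-- The coefficient of `a^i x^j y^l`. The exponents `j`, `l` are arbitrary natural numbers and the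
coefficient is zero by convention unless `j, l < r`, so that exponents may be added freely. -/
noncomputable def coord (i : ZMod D.N) (j l : ℕ) : D.U α β γ h →ₗ[k] k :=
  if hjl : j < D.r ∧ l < D.r then (basis h).coord (i, ⟨j, hjl.1⟩, ⟨l, hjl.2⟩) else 0

variable {h} in
theorem coord_mon {j' l' : ℕ} (hj : j' < D.r) (hl : l' < D.r) (i i' : ZMod D.N) (j l : ℕ) :
    coord i j l (mon i' j' l' : D.U α β γ h) = if i = i' ∧ j = j' ∧ l = l' then 1 else 0 := by
  have e : (mon i' j' l' : D.U α β γ h) = basis h (i', ⟨j', hj⟩, ⟨l', hl⟩) := by rw [basis_apply]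
  rw [coord]
  split_ifs with h1 h2 h2
  · obtain ⟨rfl, rfl, rfl⟩ := h2
    simp [e]
  · rw [e, Module.Basis.coord_apply, Module.Basis.repr_self, Finsupp.single_apply, if_neg]
    simp only [Prod.mk.injEq, Fin.mk.injEq]
    rintro ⟨rfl, rfl, rfl⟩
    exact h2 ⟨rfl, rfl, rfl⟩
  · obtain ⟨rfl, rfl, rfl⟩ := h2
    exact absurd ⟨hj, hl⟩ h1
  · rfl

theorem coord_eq_zero {i : ZMod D.N} {j l : ℕ} (hjl : ¬ (j < D.r ∧ l < D.r)) :
    (coord i j l : D.U α β γ h →ₗ[k] k) = 0 := dif_neg hjl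

variable {h} in
theorem ext_coord {u v : D.U α β γ h} (huv : ∀ i j l, coord i j l u = coord i j l v) : u = v := by
  refine (basis h).ext_elem fun ⟨i, j, l⟩ => ?_
  have := huv i j l
  rwa [coord, dif_pos ⟨j.2, l.2⟩] at this

theorem a_pow_eq_mon (m : ℕ) : (a h ^ m : D.U α β γ h) = mon (m : ZMod D.N) 0 0 := by
  simp [mon_natCast]

theorem x_eq_mon : (x h : D.U α β γ h) = mon 0 1 0 := by simp [mon]

theorem y_eq_mon : (y h : D.U α β γ h) = mon 0 0 1 := by simp [mon]

theorem coord_a_pow (i : ZMod D.N) (j l m : ℕ) :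
    coord i j l (a h ^ m : D.U α β γ h) = if i = m ∧ j = 0 ∧ l = 0 then 1 else 0 := by
  rw [a_pow_eq_mon, coord_mon D.r_pos D.r_pos]

theorem coord_one (i : ZMod D.N) (j l : ℕ) :
    coord i j l (1 : D.U α β γ h) = if i = 0 ∧ j = 0 ∧ l = 0 then 1 else 0 := by
  simpa using coord_a_pow (γ := γ) h i j l 0

theorem a_pow_injective {i j : ℕ} (e : (a h ^ i : D.U α β γ h) = a h ^ j) :
    (i : ZMod D.N) = j := by
  have := coord_a_pow (γ := γ) h (i : ZMod D.N) 0 0 j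
  rw [← e, coord_a_pow] at this
  by_contra hne
  simp [hne] at this

end U

end Datum

namespace Datum

namespace U

variable {k : Type u} [Field k] {D : Datum k} {α β γ : k} (h : D.Admissible α β)

/-! ### The comultiplication on monomials -/

/-- The coefficient of `a^i x^s y^t ⊗ a^{i+ν(s+t)} x^{s'} y^{t'}` in
`Δ(a^i x^{s+s'} y^{t+t'})`. -/
def comulCoeff (p : k) (s s' t t' : ℕ) : k :=
  p ^ (t * s') * (qChoose p (s + s') s * qChoose p⁻¹ (t + t') t)

theorem comulCoeff_ne_zero (D : Datum k) {s s' t t' : ℕ} (hs : s + s' < D.r) (ht : t + t' < D.r) :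
    comulCoeff (D.q ^ D.ν) s s' t t' ≠ 0 :=
  mul_ne_zero (pow_ne_zero _ D.q_pow_ν_ne_zero)
    (mul_ne_zero (qChoose_ne_zero D.isPrimitiveRoot_r _ _ (by omega) hs)
      (qChoose_ne_zero D.isPrimitiveRoot_r.inv _ _ (by omega) ht))

theorem comul_x_pow (j : ℕ) : Coalgebra.comul (R := k) (x h ^ j : D.U α β γ h) =
    ∑ s ∈ Finset.range (j + 1), qChoose (D.q ^ D.ν) j s •
      ((x h ^ s) ⊗ₜ[k] (a h ^ (D.ν * s) * x h ^ (j - s))) := by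
  have hs := (satisfies (γ := γ) h).commutes
  have hc : (1 ⊗ₜ[k] x h) * (x h ⊗ₜ[k] (a h ^ D.ν)) =
      (D.q ^ D.ν) • ((x h ⊗ₜ[k] (a h ^ D.ν)) * (1 ⊗ₜ[k] x h) :
        D.U α β γ h ⊗[k] D.U α β γ h) := by
    rw [Algebra.TensorProduct.tmul_mul_tmul, Algebra.TensorProduct.tmul_mul_tmul, hs.x_a_pow,
      one_mul, mul_one, TensorProduct.tmul_smul]
  rw [Bialgebra.comul_pow, comul_x, add_pow_qChoose hc]
  refine Finset.sum_congr rfl fun s _ => ?_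
  rw [Algebra.TensorProduct.tmul_pow, Algebra.TensorProduct.tmul_pow,
    Algebra.TensorProduct.tmul_mul_tmul, one_pow, mul_one, ← pow_mul]

theorem comul_y_pow (l : ℕ) : Coalgebra.comul (R := k) (y h ^ l : D.U α β γ h) =
    ∑ t ∈ Finset.range (l + 1), qChoose (D.q ^ D.ν)⁻¹ l t •
      ((y h ^ t) ⊗ₜ[k] (a h ^ (D.ν * t) * y h ^ (l - t))) := by
  have hs := (satisfies (γ := γ) h).commutes
  have hc : (1 ⊗ₜ[k] y h) * (y h ⊗ₜ[k] (a h ^ D.ν)) =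
      (D.q ^ D.ν)⁻¹ • ((y h ⊗ₜ[k] (a h ^ D.ν)) * (1 ⊗ₜ[k] y h) :
        D.U α β γ h ⊗[k] D.U α β γ h) := by
    rw [Algebra.TensorProduct.tmul_mul_tmul, Algebra.TensorProduct.tmul_mul_tmul, hs.y_a_pow,
      one_mul, mul_one, TensorProduct.tmul_smul]
  rw [Bialgebra.comul_pow, comul_y, add_pow_qChoose hc]
  refine Finset.sum_congr rfl fun s _ => ?_
  rw [Algebra.TensorProduct.tmul_pow, Algebra.TensorProduct.tmul_pow,
    Algebra.TensorProduct.tmul_mul_tmul, one_pow, mul_one, ← pow_mul]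

theorem comul_mon (i : ZMod D.N) (j l : ℕ) :
    Coalgebra.comul (R := k) (mon i j l : D.U α β γ h) =
      ∑ s ∈ Finset.range (j + 1), ∑ t ∈ Finset.range (l + 1),
        comulCoeff (D.q ^ D.ν) s (j - s) t (l - t) •
          (mon i s t ⊗ₜ[k] mon (D := D) (i + D.ν * (s + t)) (j - s) (l - t)) := by
  have hs := (satisfies (γ := γ) h).commutes
  obtain ⟨i, rfl⟩ := exists_natCast i
  rw [mon_natCast, Bialgebra.comul_mul, Bialgebra.comul_mul, Bialgebra.comul_pow, comul_a,
    comul_x_pow, comul_y_pow, Algebra.TensorProduct.tmul_pow, Finset.mul_sum (Finset.range (j + 1)),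
    Finset.sum_mul_sum]
  refine Finset.sum_congr rfl fun s hs' => Finset.sum_congr rfl fun t ht' => ?_
  have e1 : s + (j - s) = j := by have := Finset.mem_range.1 hs'; omega
  have e2 : t + (l - t) = l := by have := Finset.mem_range.1 ht'; omega
  have e3 : ((i : ZMod D.N) + D.ν * (s + t)) = ((i + (D.ν * s + D.ν * t) : ℕ) : ZMod D.N) := by
    push_cast; ring
  have e4 : a h ^ i * (a h ^ (D.ν * s) * x h ^ (j - s)) * (a h ^ (D.ν * t) * y h ^ (l - t)) =
      (D.q ^ D.ν) ^ (t * (j - s)) • (a h ^ (i + (D.ν * s + D.ν * t)) * x h ^ (j - s) *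
        y h ^ (l - t) : D.U α β γ h) := by
    rw [← mul_assoc, ← mul_assoc, mul_assoc _ (x h ^ (j - s)), hs.x_pow_a_pow, pow_add, pow_add,
      ← pow_mul]
    simp only [mul_smul_comm, smul_mul_assoc, mul_assoc]
    congr 2
    ring
  rw [e3, mon_natCast, mon_natCast, comulCoeff, e1, e2, mul_smul_comm, mul_smul_comm,
    smul_mul_assoc, Algebra.TensorProduct.tmul_mul_tmul, Algebra.TensorProduct.tmul_mul_tmul, e4,
    TensorProduct.tmul_smul, smul_smul, smul_smul]
  congr 1
  ring

variable {h} in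
/-- The coefficients of `Δ(z)`: each of them is zero or a multiple of one coefficient of `z`, and
the factor is nonzero as long as the exponents of that coefficient are less than `r`. This
determines the subcoalgebras, the grouplike and the skew primitive elements. -/
theorem coord_tensor_coord_comul (i₁ i₂ : ZMod D.N) (j₁ l₁ j₂ l₂ : ℕ) (z : D.U α β γ h) :
    LinearMap.mul' k k (TensorProduct.map (coord i₁ j₁ l₁) (coord i₂ j₂ l₂)
      (Coalgebra.comul (R := k) z)) =
    if i₂ = i₁ + D.ν * (j₁ + l₁) then
      comulCoeff (D.q ^ D.ν) j₁ j₂ l₁ l₂ * coord i₁ (j₁ + j₂) (l₁ + l₂) z else 0 := by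
  let f : D.U α β γ h →ₗ[k] k := LinearMap.mul' k k ∘ₗ
    TensorProduct.map (coord i₁ j₁ l₁) (coord i₂ j₂ l₂) ∘ₗ Coalgebra.comul (R := k)
  let g : D.U α β γ h →ₗ[k] k := (if i₂ = i₁ + D.ν * (j₁ + l₁) then
    comulCoeff (D.q ^ D.ν) j₁ j₂ l₁ l₂ else 0) • coord i₁ (j₁ + j₂) (l₁ + l₂)
  suffices e : f = g by
    have := LinearMap.congr_fun e z
    simpa only [f, g, LinearMap.comp_apply, LinearMap.smul_apply, smul_eq_mul, ite_mul,
      zero_mul] using this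
  refine linearMap_ext fun i j l hj hl => ?_
  have e1 : f (mon i j l) = ∑ s ∈ Finset.range (j + 1), ∑ t ∈ Finset.range (l + 1),
        comulCoeff (D.q ^ D.ν) s (j - s) t (l - t) *
          ((if i₁ = i ∧ j₁ = s ∧ l₁ = t then 1 else 0) *
          (if i₂ = i + D.ν * (s + t) ∧ j₂ = j - s ∧ l₂ = l - t then 1 else 0)) := by
    simp only [f, LinearMap.comp_apply, comul_mon, map_sum, map_smul, TensorProduct.map_tmul,
      LinearMap.mul'_apply, smul_eq_mul]
    refine Finset.sum_congr rfl fun s hs => Finset.sum_congr rfl fun t ht => ?_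
    have hs := Finset.mem_range.1 hs
    have ht := Finset.mem_range.1 ht
    rw [coord_mon (by omega) (by omega), coord_mon (by omega) (by omega)]
  have e2 : g (mon i j l) = (if i₂ = i₁ + D.ν * (j₁ + l₁) then
      comulCoeff (D.q ^ D.ν) j₁ j₂ l₁ l₂ else 0) *
      (if i₁ = i ∧ j₁ + j₂ = j ∧ l₁ + l₂ = l then 1 else 0) := by
    simp only [g, LinearMap.smul_apply, smul_eq_mul, coord_mon hj hl]
  rw [e1, e2]
  by_cases hc : i₁ = i ∧ j₁ + j₂ = j ∧ l₁ + l₂ = l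
  · obtain ⟨rfl, rfl, rfl⟩ := hc
    rw [Finset.sum_eq_single_of_mem j₁ (Finset.mem_range.2 (by omega)),
      Finset.sum_eq_single_of_mem l₁ (Finset.mem_range.2 (by omega))]
    · simp
    · intro t _ ht
      simp [ht.symm]
    · intro s _ hs
      simp [hs.symm]
  · rw [if_neg hc, mul_zero]
    refine Finset.sum_eq_zero fun s hs => Finset.sum_eq_zero fun t ht => ?_
    have hs := Finset.mem_range.1 hs
    have ht := Finset.mem_range.1 ht
    split_ifs with h1 h2
    · exact absurd ⟨h1.1, by omega, by omega⟩ hc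
    all_goals simp

theorem counit_mon (i : ZMod D.N) (j l : ℕ) : Coalgebra.counit (R := k) (mon i j l : D.U α β γ h) =
    if j = 0 ∧ l = 0 then 1 else 0 := by
  rw [counit_eq, mon, map_mul, map_mul, map_pow, map_pow, map_pow, counitHom, lift_a, lift_x,
    lift_y, one_pow, one_mul]
  rcases j with _ | j <;> rcases l with _ | l <;> simp

theorem a_isUnit : IsUnit (a h : D.U α β γ h) :=
  ⟨⟨_, _, (satisfies h).a_mul_inv, (satisfies h).inv_mul_a⟩, rfl⟩

theorem isGroupLikeElem_a_pow (m : ℕ) : IsGroupLikeElem k (a h ^ m : D.U α β γ h) :=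
  (isGroupLikeElem_a h).pow

end U

end Datum

/-! ### Subcoalgebras -/

section Subcoalgebras

variable {k : Type u} [Field k] {C : Type v} [AddCommGroup C] [Module k C] [Coalgebra k C]

/-- A subcoalgebra is stable under the action of the dual algebra. -/
theorem IsSubcoalgebra.lid_rTensor_mem {V : Submodule k C} (hV : IsSubcoalgebra k C V) {c : C}
    (hc : c ∈ V) (f : C →ₗ[k] k) :
    TensorProduct.lid k C (f.rTensor C (Coalgebra.comul (R := k) c)) ∈ V := by
  obtain ⟨t, ht⟩ := hV c hc
  rw [← ht]
  clear ht
  induction t using TensorProduct.induction_on with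
  | zero => simp
  | tmul v w => simpa using V.smul_mem _ w.2
  | add s t hs ht => simp only [map_add]; exact V.add_mem hs ht

theorem isSimpleSubcoalgebra_span_of_isGroupLikeElem {g : C} (hg : IsGroupLikeElem k g) :
    IsSimpleSubcoalgebra k C (Submodule.span k {g}) := by
  refine ⟨?_, ?_, ?_⟩
  · intro c hc
    obtain ⟨t, rfl⟩ := Submodule.mem_span_singleton.1 hc
    have hg' : g ∈ Submodule.span k {g} := Submodule.mem_span_singleton_self g
    refine ⟨t • ((⟨g, hg'⟩ : Submodule.span k {g}) ⊗ₜ ⟨g, hg'⟩), ?_⟩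
    simp [hg.comul_eq_tmul_self]
  · rw [Ne, Submodule.span_singleton_eq_bot]
    exact hg.ne_zero
  · intro W _ hW
    exact (nonzero_span_atom g hg.ne_zero).le_iff.1 hW

end Subcoalgebras

namespace Datum

namespace U

variable {k : Type u} [Field k] {D : Datum k} {α β γ : k} {h : D.Admissible α β}

/-- The contraction of `Δ(z)` with a coordinate function, in coordinates. -/
theorem coord_lid_rTensor_comul (i₁ i₂ : ZMod D.N) (j₁ l₁ j₂ l₂ : ℕ) (z : D.U α β γ h) :
    coord i₂ j₂ l₂ (TensorProduct.lid k _ ((coord i₁ j₁ l₁).rTensor _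
      (Coalgebra.comul (R := k) z))) =
    if i₂ = i₁ + D.ν * (j₁ + l₁) then
      comulCoeff (D.q ^ D.ν) j₁ j₂ l₁ l₂ * coord i₁ (j₁ + j₂) (l₁ + l₂) z else 0 := by
  rw [← coord_tensor_coord_comul]
  generalize Coalgebra.comul (R := k) z = t
  induction t using TensorProduct.induction_on with
  | zero => simp
  | tmul v w => simp
  | add s t hs ht => simp only [map_add, hs, ht]

/-- Every nonzero subcoalgebra contains a power of `a`. -/
theorem exists_a_pow_mem {V : Submodule k (D.U α β γ h)} (hV : IsSubcoalgebra k _ V)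
    (hne : V ≠ ⊥) : ∃ m : ℕ, a h ^ m ∈ V := by
  obtain ⟨c, hc, hc0⟩ := Submodule.exists_mem_ne_zero_of_ne_bot hne
  -- Contract `Δ(c)` with the coordinate function of a monomial of maximal degree in `c`.
  have hex : ∃ d : ℕ, ∃ i j l, D.r + D.r - (j + l) = d ∧ j < D.r ∧ l < D.r ∧
      coord i j l c ≠ 0 := by
    by_contra! hcon
    refine hc0 (ext_coord fun i j l => ?_)
    rw [map_zero]
    by_cases hjl : j < D.r ∧ l < D.r
    · exact hcon _ i j l rfl hjl.1 hjl.2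
    · rw [coord_eq_zero h hjl, LinearMap.zero_apply]
  classical
  obtain ⟨i, j, l, hd, hj, hl, hne⟩ := Nat.find_spec hex
  have hmax : ∀ i' j' l', j' < D.r → l' < D.r → j + l < j' + l' → coord i' j' l' c = 0 := by
    intro i' j' l' hj' hl' hlt
    by_contra h0
    exact Nat.find_min hex (m := D.r + D.r - (j' + l')) (by omega) ⟨i', j', l', rfl, hj', hl', h0⟩
  have hmem := hV.lid_rTensor_mem hc (coord i j l)
  have e : TensorProduct.lid k _ ((coord i j l).rTensor _ (Coalgebra.comul (R := k) c)) =
      (comulCoeff (D.q ^ D.ν) j 0 l 0 * coord i j l c) • a h ^ (i.val + D.ν * (j + l)) := by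
    refine ext_coord fun i' j' l' => ?_
    rw [coord_lid_rTensor_comul, map_smul, coord_a_pow]
    push_cast
    rw [ZMod.natCast_zmod_val]
    by_cases h1 : i' = i + D.ν * (j + l)
    · rw [if_pos h1]
      by_cases h2 : j' = 0 ∧ l' = 0
      · obtain ⟨rfl, rfl⟩ := h2
        simp [h1]
      · rw [if_neg fun h3 => h2 h3.2, smul_zero]
        by_cases h3 : j + j' < D.r ∧ l + l' < D.r
        · rw [hmax _ _ _ h3.1 h3.2 (by omega), mul_zero]
        · rw [coord_eq_zero h h3, LinearMap.zero_apply, mul_zero]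
    · rw [if_neg h1, if_neg fun h2 => h1 h2.1, smul_zero]
  rw [e] at hmem
  exact ⟨_, (V.smul_mem_iff (mul_ne_zero (comulCoeff_ne_zero D (by omega) (by omega)) hne)).1 hmem⟩

theorem isSimpleSubcoalgebra_iff {V : Submodule k (D.U α β γ h)} :
    IsSimpleSubcoalgebra k _ V ↔ ∃ m : ℕ, V = Submodule.span k {a h ^ m} := by
  constructor
  · rintro ⟨h1, h2, h3⟩
    obtain ⟨m, hm⟩ := exists_a_pow_mem h1 h2
    have hs := isSimpleSubcoalgebra_span_of_isGroupLikeElem (isGroupLikeElem_a_pow (γ := γ) h m)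
    have hle := (Submodule.span_singleton_le_iff_mem _ _).2 hm
    exact ⟨m, ((h3 _ hs.1 hle).resolve_left hs.2.1).symm⟩
  · rintro ⟨m, rfl⟩
    exact isSimpleSubcoalgebra_span_of_isGroupLikeElem (isGroupLikeElem_a_pow h m)

variable (h) in
theorem isPointed : IsPointed k (D.U α β γ h) := by
  intro V hV
  obtain ⟨m, rfl⟩ := isSimpleSubcoalgebra_iff.1 hV
  exact finrank_span_singleton (isGroupLikeElem_a_pow h m).ne_zero

/-- The line spanned by a grouplike element is a subcoalgebra, so it contains a power of `a`; the
counit takes the value `1` on both. -/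
theorem exists_eq_a_pow {g : D.U α β γ h} (hg : IsGroupLikeElem k g) : ∃ m : ℕ, g = a h ^ m := by
  have hs := isSimpleSubcoalgebra_span_of_isGroupLikeElem hg
  obtain ⟨m, hm⟩ := exists_a_pow_mem hs.1 hs.2.1
  obtain ⟨c, hc⟩ := Submodule.mem_span_singleton.1 hm
  have := congrArg (Coalgebra.counit (R := k)) hc
  rw [map_smul, hg.counit_eq_one, (isGroupLikeElem_a_pow h m).counit_eq_one, smul_eq_mul,
    mul_one] at this
  exact ⟨m, by rw [← hc, this, one_smul]⟩

variable (h) in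
theorem zpowers_aG : Subgroup.zpowers (aG h : GroupLike k (D.U α β γ h)) = ⊤ := by
  refine (Subgroup.eq_top_iff' _).2 fun g => ?_
  obtain ⟨m, hm⟩ := exists_eq_a_pow g.2
  refine Subgroup.mem_zpowers_iff.2 ⟨m, GroupLike.val_injective ?_⟩
  rw [zpow_natCast, GroupLike.val_pow, hm]
  rfl

variable (h) in
theorem orderOf_aG : orderOf (aG h : GroupLike k (D.U α β γ h)) = D.N := by
  refine Nat.dvd_antisymm (orderOf_dvd_of_pow_eq_one (GroupLike.val_injective ?_)) ?_
  · rw [GroupLike.val_pow]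
    exact (satisfies h).a_pow
  · have e : (a h ^ orderOf (aG h : GroupLike k (D.U α β γ h)) : D.U α β γ h) = a h ^ 0 := by
      have := congrArg GroupLike.val (pow_orderOf_eq_one (aG h : GroupLike k (D.U α β γ h)))
      rw [GroupLike.val_pow] at this
      rw [pow_zero]
      exact this
    have := a_pow_injective h e
    rwa [Nat.cast_zero, ZMod.natCast_eq_zero_iff] at this

end U

end Datum

namespace Datum

namespace U

variable {k : Type u} [Field k] {D : Datum k} {α β γ : k} {h : D.Admissible α β}

/-! ### Skew primitive elements and the coradical filtration -/

@[simp] theorem comulCoeff_zero_left (p : k) (s t : ℕ) : comulCoeff p 0 s 0 t = 1 := by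
  simp [comulCoeff, qChoose]

@[simp] theorem comulCoeff_zero_right (p : k) (s t : ℕ) : comulCoeff p s 0 t 0 = 1 := by
  simp [comulCoeff, qChoose_self]

variable (h) in
theorem coord_x (i : ZMod D.N) (j l : ℕ) :
    coord i j l (x h : D.U α β γ h) = if i = 0 ∧ j = 1 ∧ l = 0 then 1 else 0 := by
  rw [x_eq_mon, coord_mon h.one_lt_r D.r_pos]

variable (h) in
theorem coord_y (i : ZMod D.N) (j l : ℕ) :
    coord i j l (y h : D.U α β γ h) = if i = 0 ∧ j = 0 ∧ l = 1 then 1 else 0 := by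
  rw [y_eq_mon, coord_mon D.r_pos h.one_lt_r]

/-- A sum of two exponents that is at least two can be split nontrivially. -/
theorem exists_split {j l : ℕ} (hjl : 2 ≤ j + l) : ∃ j₁ l₁ j₂ l₂ : ℕ, j₁ + j₂ = j ∧ l₁ + l₂ = l ∧
    0 < j₁ + l₁ ∧ 0 < j₂ + l₂ := by
  rcases j with _ | j
  · exact ⟨0, 1, 0, l - 1, by omega, by omega, by omega, by omega⟩
  · exact ⟨1, 0, j, l, by omega, by omega, by omega, by omega⟩

/-- A skew primitive element is determined by three of its coefficients. -/
theorem eq_of_mem_skewPrimitives {v : ℕ} {z : D.U α β γ h}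
    (hz : z ∈ skewPrimitives k (a h ^ v) 1) :
    z = coord v 0 0 z • (a h ^ v - 1) + (coord 0 1 0 z • x h + coord 0 0 1 z • y h) := by
  have E (i₁ i₂ : ZMod D.N) (j₁ l₁ j₂ l₂ : ℕ) :
      (if i₂ = i₁ + D.ν * (j₁ + l₁) then
        comulCoeff (D.q ^ D.ν) j₁ j₂ l₁ l₂ * coord i₁ (j₁ + j₂) (l₁ + l₂) z else 0) =
      coord i₁ j₁ l₁ z * (if i₂ = v ∧ j₂ = 0 ∧ l₂ = 0 then 1 else 0) +
        (if i₁ = 0 ∧ j₁ = 0 ∧ l₁ = 0 then 1 else 0) * coord i₂ j₂ l₂ z := by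
    have hz' : Coalgebra.comul (R := k) z = z ⊗ₜ[k] (a h ^ v) + 1 ⊗ₜ[k] z := hz
    rw [← coord_tensor_coord_comul, hz', map_add, map_add, TensorProduct.map_tmul,
      TensorProduct.map_tmul, LinearMap.mul'_apply, LinearMap.mul'_apply, coord_a_pow, coord_one]
  refine ext_coord fun i j l => ?_
  simp only [map_add, map_smul, map_sub, coord_a_pow, coord_one, coord_x, coord_y, smul_eq_mul]
  rcases Nat.lt_or_ge (j + l) 2 with h2 | h2
  · have h3 : (j = 0 ∧ l = 0) ∨ ((j = 1 ∧ l = 0) ∨ (j = 0 ∧ l = 1)) := by omega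
    rcases h3 with ⟨rfl, rfl⟩ | h3
    · have E1 := E i i 0 0 0 0
      have E2 := E 0 v 0 0 0 0
      by_cases hi : i = v <;> by_cases hi0 : i = 0
      · subst hi
        simp [hi0] at E1 ⊢
        exact E1
      · subst hi
        simp [hi0]
      · subst hi0
        simp [Ne.symm hi] at E2
        simp [hi]
        linear_combination -E2
      · simpa [hi, hi0] using E1
    · have h4 : ¬ (j = 0 ∧ l = 0) := by omega
      have E1 := E i i 0 0 j l
      by_cases hi0 : i = 0
      · rcases h3 with ⟨rfl, rfl⟩ | ⟨rfl, rfl⟩ <;> simp [hi0]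
      · simp only [Nat.cast_zero, add_zero, mul_zero, if_true, comulCoeff_zero_left, one_mul,
          zero_add, h4, and_false, if_false, hi0, false_and, zero_mul] at E1
        simp [E1, hi0, h4]
  · have e1 : ¬ (j = 0 ∧ l = 0) := by omega
    have e2 : ¬ (j = 1 ∧ l = 0) := by omega
    have e3 : ¬ (j = 0 ∧ l = 1) := by omega
    simp only [e1, e2, e3, and_false, if_false]
    by_cases hr : j < D.r ∧ l < D.r
    · -- A coefficient of degree at least two shows up in `Δ(z)` between two monomials of positive
      -- degree, where `z ⊗ a^v + 1 ⊗ z` has no term.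
      obtain ⟨j₁, l₁, j₂, l₂, rfl, rfl, hp₁, hp₂⟩ := exists_split h2
      have E1 := E i (i + D.ν * (j₁ + l₁)) j₁ l₁ j₂ l₂
      have e4 : ¬ (j₁ = 0 ∧ l₁ = 0) := by omega
      have e5 : ¬ (j₂ = 0 ∧ l₂ = 0) := by omega
      simp only [if_true, e4, e5, and_false, if_false, mul_zero, zero_mul, add_zero] at E1
      simpa [comulCoeff_ne_zero D hr.1 hr.2] using E1
    · rw [coord_eq_zero h hr]
      simp

theorem coord_eq_zero_of_mem_skewPrimitives {v : ℕ} (hv : (v : ZMod D.N) ≠ D.ν) {z : D.U α β γ h}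
    (hz : z ∈ skewPrimitives k (a h ^ v) 1) : coord 0 1 0 z = 0 ∧ coord 0 0 1 z = 0 := by
  have hz' : Coalgebra.comul (R := k) z = z ⊗ₜ[k] (a h ^ v) + 1 ⊗ₜ[k] z := hz
  have E1 := coord_tensor_coord_comul (0 : ZMod D.N) D.ν 1 0 0 0 z
  have E2 := coord_tensor_coord_comul (0 : ZMod D.N) D.ν 0 1 0 0 z
  rw [hz', map_add, map_add, TensorProduct.map_tmul,
    TensorProduct.map_tmul, LinearMap.mul'_apply, LinearMap.mul'_apply, coord_a_pow, coord_one]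
    at E1 E2
  simp [hv.symm] at E1 E2
  exact ⟨E1.symm, E2.symm⟩

variable (h) in
theorem a_pow_sub_one_mem_skewPrimitives (v : ℕ) :
    (a h ^ v - 1 : D.U α β γ h) ∈ skewPrimitives k (a h ^ v) 1 := by
  change Coalgebra.comul (R := k) _ = _
  rw [map_sub, Bialgebra.comul_one, (isGroupLikeElem_a_pow h v).comul_eq_tmul_self,
    TensorProduct.sub_tmul, TensorProduct.tmul_sub, Algebra.TensorProduct.one_def]
  abel

variable (h) in
theorem skewPrimitives_a_pow_ν : skewPrimitives k (a h ^ D.ν : D.U α β γ h) 1 =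
    Submodule.span k {a h ^ D.ν - 1, x h, y h} := by
  refine le_antisymm (fun z hz => ?_) (Submodule.span_le.2 ?_)
  · rw [Submodule.mem_span_triple]
    exact ⟨_, _, _, by rw [add_assoc]; exact (eq_of_mem_skewPrimitives hz).symm⟩
  · rintro z (rfl | rfl | rfl)
    · exact a_pow_sub_one_mem_skewPrimitives h _
    · exact comul_x h
    · exact comul_y h

variable (h) in
theorem skewPrimitives_a_pow {v : ℕ} (hv : (v : ZMod D.N) ≠ D.ν) :
    skewPrimitives k (a h ^ v : D.U α β γ h) 1 = Submodule.span k {a h ^ v - 1} := by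
  refine le_antisymm (fun z hz => ?_) (Submodule.span_le.2 ?_)
  · obtain ⟨h1, h2⟩ := coord_eq_zero_of_mem_skewPrimitives hv hz
    rw [eq_of_mem_skewPrimitives hz, h1, h2, zero_smul, zero_smul, add_zero, add_zero]
    exact Submodule.smul_mem _ _ (Submodule.mem_span_singleton_self _)
  · rintro z rfl
    exact a_pow_sub_one_mem_skewPrimitives h _

theorem a_pow_mem_coradical (m : ℕ) :
    (a h ^ m : D.U α β γ h) ∈ sSup {V | IsSimpleSubcoalgebra k (D.U α β γ h) V} :=
  (le_sSup (isSimpleSubcoalgebra_span_of_isGroupLikeElem (isGroupLikeElem_a_pow h m)) :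
    Submodule.span k {(a h ^ m : D.U α β γ h)} ≤ _) (Submodule.mem_span_singleton_self _)

theorem coord_eq_zero_of_mem_coradical {z : D.U α β γ h}
    (hz : z ∈ sSup {V | IsSimpleSubcoalgebra k (D.U α β γ h) V}) (i : ZMod D.N) {j l : ℕ}
    (hjl : 0 < j + l) : coord i j l z = 0 := by
  have hle : sSup {V | IsSimpleSubcoalgebra k (D.U α β γ h) V} ≤ LinearMap.ker (coord i j l) := by
    refine sSup_le fun V hV => ?_
    obtain ⟨m, rfl⟩ := isSimpleSubcoalgebra_iff.1 hV
    rw [Submodule.span_singleton_le_iff_mem, LinearMap.mem_ker, coord_a_pow, if_neg]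
    omega
  exact hle hz

/-- Elements of `C ⊗ C_0 + C_0 ⊗ C` have no coefficient between two monomials of positive degree. -/
theorem coord_eq_zero_of_mem_coradicalFiltration_one {z : D.U α β γ h}
    (hz : z ∈ coradicalFiltration k (D.U α β γ h) 1) (i : ZMod D.N) {j l : ℕ}
    (hjl : 2 ≤ j + l) : coord i j l z = 0 := by
  by_cases hr : j < D.r ∧ l < D.r
  swap
  · rw [coord_eq_zero h hr, LinearMap.zero_apply]
  obtain ⟨j₁, l₁, j₂, l₂, rfl, rfl, hp₁, hp₂⟩ := exists_split hjl
  obtain ⟨_, ⟨t₁, rfl⟩, _, ⟨t₂, rfl⟩, ht⟩ := Submodule.mem_sup.1 (Submodule.mem_comap.1 hz)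
  have E := coord_tensor_coord_comul i (i + D.ν * (j₁ + l₁)) j₁ l₁ j₂ l₂ z
  have e₁ : TensorProduct.map (coord i j₁ l₁) (coord (D := D) (i + D.ν * (j₁ + l₁)) j₂ l₂)
      (TensorProduct.map LinearMap.id
        (coradicalFiltration k (D.U α β γ h) 0).subtype t₁) = 0 := by
    clear ht
    induction t₁ using TensorProduct.induction_on with
    | zero => simp
    | tmul v w =>
      rw [TensorProduct.map_tmul, TensorProduct.map_tmul, Submodule.subtype_apply,
        coord_eq_zero_of_mem_coradical w.2 _ hp₂, TensorProduct.tmul_zero]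
    | add s t hs ht => simp only [map_add, hs, ht, add_zero]
  have e₂ : TensorProduct.map (coord i j₁ l₁) (coord (D := D) (i + D.ν * (j₁ + l₁)) j₂ l₂)
      (TensorProduct.map (sSup {V | IsSimpleSubcoalgebra k (D.U α β γ h) V}).subtype
        LinearMap.id t₂) = 0 := by
    clear ht
    induction t₂ using TensorProduct.induction_on with
    | zero => simp
    | tmul v w =>
      rw [TensorProduct.map_tmul, TensorProduct.map_tmul, Submodule.subtype_apply,
        coord_eq_zero_of_mem_coradical v.2 _ hp₁, TensorProduct.zero_tmul]
    | add s t hs ht => simp only [map_add, hs, ht, add_zero]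
  rw [← ht, map_add, e₁, e₂, add_zero, map_zero, if_pos rfl] at E
  exact (mul_eq_zero.1 E.symm).resolve_left (comulCoeff_ne_zero D hr.1 hr.2)

variable (h) in
theorem coradicalFiltration_one : coradicalFiltration k (D.U α β γ h) 1 =
    Submodule.span k {u | ∃ i < D.N, u = a h ^ i ∨ u = a h ^ i * x h ∨ u = a h ^ i * y h} := by
  refine le_antisymm (fun z hz => ?_) (Submodule.span_le.2 ?_)
  · rw [← (basis h).sum_repr z]
    refine Submodule.sum_mem _ fun ⟨i, j, l⟩ _ => ?_
    rw [basis_apply]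
    by_cases hjl : 2 ≤ (j : ℕ) + l
    · have := coord_eq_zero_of_mem_coradicalFiltration_one hz i hjl
      rw [coord, dif_pos ⟨j.2, l.2⟩, Module.Basis.coord_apply] at this
      rw [this, zero_smul]
      exact Submodule.zero_mem _
    · refine Submodule.smul_mem _ _ (Submodule.subset_span ⟨i.val, i.val_lt, ?_⟩)
      have h3 : ((j : ℕ) = 0 ∧ (l : ℕ) = 0) ∨ (((j : ℕ) = 1 ∧ (l : ℕ) = 0) ∨
        ((j : ℕ) = 0 ∧ (l : ℕ) = 1)) := by omega
      rcases h3 with ⟨h1, h2⟩ | ⟨h1, h2⟩ | ⟨h1, h2⟩ <;> simp [mon, h1, h2]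
  · have hr (c : D.U α β γ h) (m : ℕ) : c ⊗ₜ[k] (a h ^ m) ∈ LinearMap.range
        (TensorProduct.map (LinearMap.id : D.U α β γ h →ₗ[k] D.U α β γ h)
          (coradicalFiltration k (D.U α β γ h) 0).subtype) :=
      ⟨c ⊗ₜ ⟨a h ^ m, a_pow_mem_coradical m⟩, by simp⟩
    have hl (c : D.U α β γ h) (m : ℕ) : (a h ^ m) ⊗ₜ[k] c ∈ LinearMap.range
        (TensorProduct.map (sSup {V | IsSimpleSubcoalgebra k (D.U α β γ h) V}).subtype
          (LinearMap.id : D.U α β γ h →ₗ[k] D.U α β γ h)) :=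
      ⟨⟨a h ^ m, a_pow_mem_coradical m⟩ ⊗ₜ c, by simp⟩
    rintro z ⟨i, -, rfl | rfl | rfl⟩ <;> refine Submodule.mem_comap.2 ?_
    · rw [(isGroupLikeElem_a_pow h i).comul_eq_tmul_self]
      exact Submodule.mem_sup_left (hr _ _)
    · rw [Bialgebra.comul_mul, (isGroupLikeElem_a_pow h i).comul_eq_tmul_self, comul_x, mul_add,
        Algebra.TensorProduct.tmul_mul_tmul, Algebra.TensorProduct.tmul_mul_tmul, ← pow_add,
        mul_one]
      exact Submodule.add_mem _ (Submodule.mem_sup_left (hr _ _)) (Submodule.mem_sup_right (hl _ _))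
    · rw [Bialgebra.comul_mul, (isGroupLikeElem_a_pow h i).comul_eq_tmul_self, comul_y, mul_add,
        Algebra.TensorProduct.tmul_mul_tmul, Algebra.TensorProduct.tmul_mul_tmul, ← pow_add,
        mul_one]
      exact Submodule.add_mem _ (Submodule.mem_sup_left (hr _ _)) (Submodule.mem_sup_right (hl _ _))

end U

end Datum

/-! ### Integrals -/

section PowerSum

variable {k : Type u} [Field k] {B : Type v} [Ring B] [Algebra k B]

/-- The sum `∑_{i<N} c^i A^i`: if `A^N = 1 = c^N`, it is an eigenvector of the multiplication by
`A`. -/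
def twistedPowerSum (N : ℕ) (c : k) (A : B) : B := ∑ i ∈ Finset.range N, c ^ i • A ^ i

theorem twistedPowerSum_mul {N : ℕ} {c : k} {A : B} (hA : A ^ N = 1) (hc : c ^ N = 1)
    (hc0 : c ≠ 0) : twistedPowerSum N c A * A = c⁻¹ • twistedPowerSum N c A := by
  rw [eq_inv_smul_iff₀ hc0, twistedPowerSum, Finset.sum_mul, Finset.smul_sum]
  have e : ∀ i ∈ Finset.range N, c • (c ^ i • A ^ i * A) = c ^ (i + 1) • A ^ (i + 1) := by
    intro i _
    rw [smul_mul_assoc, smul_smul, ← pow_succ', ← pow_succ]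
  rw [Finset.sum_congr rfl e]
  have h1 := Finset.sum_range_succ (fun i => c ^ i • A ^ i) N
  rw [Finset.sum_range_succ', hA, hc] at h1
  simpa using h1

theorem twistedPowerSum_mul_pow {N : ℕ} {c : k} {A : B} (hA : A ^ N = 1) (hc : c ^ N = 1)
    (hc0 : c ≠ 0) (m : ℕ) :
    twistedPowerSum N c A * A ^ m = (c⁻¹) ^ m • twistedPowerSum N c A := by
  induction m with
  | zero => simp
  | succ m ih =>
    rw [pow_succ, ← mul_assoc, ih, smul_mul_assoc, twistedPowerSum_mul hA hc hc0, smul_smul,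
      ← pow_succ]

theorem twistedPowerSum_one (N : ℕ) (A : B) :
    twistedPowerSum N (1 : k) A = ∑ i ∈ Finset.range N, A ^ i := by simp [twistedPowerSum]

theorem mul_sum_pow_of_smul {N : ℕ} {c : k} {A Z : B} (hZ : Z * A = c • (A * Z)) :
    Z * ∑ i ∈ Finset.range N, A ^ i = twistedPowerSum N c A * Z := by
  rw [twistedPowerSum, Finset.mul_sum, Finset.sum_mul]
  exact Finset.sum_congr rfl fun i _ => by rw [mul_pow_of_smul hZ, smul_mul_assoc]

end PowerSum

/-- The identity among `q`-integers that makes the `γ`-part of `y (∑ a^i) x^{r-1} y^{r-1}` vanish,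
where `r = m + 2`. -/
theorem sq_mul_qInt {k : Type u} [Field k] {p : k} {m : ℕ} (hp : IsPrimitiveRoot p (m + 2)) :
    p ^ 2 * qInt p (m + 1) = qInt p⁻¹ (m + 1) := by
  have h1 := qInt_eq_zero (by omega) hp
  have h2 := qInt_eq_zero (by omega) hp.inv
  have hp0 : p ≠ 0 := hp.ne_zero (by omega)
  rw [qInt_succ'] at h1 h2
  field_simp at h2
  rw [one_div] at h2
  linear_combination p * h1 - h2

namespace Datum

variable {k : Type u} [Field k] {D : Datum k} {α β γ : k}

namespace Satisfies

variable {B : Type v} [Ring B] [Algebra k B] {A X Y : B}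

theorem a_mul_integral (hs : D.Satisfies α β γ A X Y) :
    A * ((∑ i ∈ Finset.range D.N, A ^ i) * X ^ (D.r - 1) * Y ^ (D.r - 1)) =
      (∑ i ∈ Finset.range D.N, A ^ i) * X ^ (D.r - 1) * Y ^ (D.r - 1) := by
  have h1 : A * (∑ i ∈ Finset.range D.N, A ^ i) = ∑ i ∈ Finset.range D.N, A ^ i := by
    have hc : Commute A (∑ i ∈ Finset.range D.N, A ^ i) :=
      Commute.sum_right _ _ _ fun i _ => (Commute.refl A).pow_right i
    rw [hc.eq, ← twistedPowerSum_one (k := k),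
      twistedPowerSum_mul hs.a_pow (one_pow _) one_ne_zero, inv_one, one_smul]
  rw [← mul_assoc, ← mul_assoc, h1]

theorem twistedPowerSum_mul_sub_eq_zero (hs : D.Satisfies α β γ A X Y) {c : k}
    (hc : c = D.q ∨ c = D.q⁻¹) :
    twistedPowerSum D.N c A * (A ^ (D.ν * D.n) - 1) = 0 := by
  have h1 : c ^ D.N = 1 ∧ c ≠ 0 ∧ c⁻¹ ^ (D.ν * D.n) = 1 := by
    rcases hc with rfl | rfl
    · exact ⟨D.q_pow_N, D.q_ne_zero, by rw [inv_pow, D.q_pow_mul_n, inv_one]⟩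
    · exact ⟨by rw [inv_pow, D.q_pow_N, inv_one], inv_ne_zero D.q_ne_zero,
        by rw [inv_inv, D.q_pow_mul_n]⟩
  rw [mul_sub, twistedPowerSum_mul_pow hs.a_pow h1.1 h1.2.1, h1.2.2, one_smul, mul_one, sub_self]

theorem x_mul_integral (hs : D.Satisfies α β γ A X Y) :
    X * ((∑ i ∈ Finset.range D.N, A ^ i) * X ^ (D.r - 1) * Y ^ (D.r - 1)) = 0 := by
  rw [← mul_assoc, ← mul_assoc, mul_sum_pow_of_smul hs.x_a, mul_assoc _ X, ← pow_succ',
    Nat.sub_add_cancel D.r_pos, hs.x_pow, mul_smul_comm,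
    hs.twistedPowerSum_mul_sub_eq_zero (Or.inl rfl), smul_zero, zero_mul]

theorem y_mul_integral (hs : D.Satisfies α β γ A X Y) (h : D.Admissible α β) :
    Y * ((∑ i ∈ Finset.range D.N, A ^ i) * X ^ (D.r - 1) * Y ^ (D.r - 1)) = 0 := by
  have hq : D.q⁻¹ ^ D.N = 1 := by rw [inv_pow, D.q_pow_N, inv_one]
  have hq0 : D.q⁻¹ ≠ 0 := inv_ne_zero D.q_ne_zero
  have hr := D.isPrimitiveRoot_r
  have hyr := hs.y_pow
  obtain ⟨m, hm⟩ : ∃ m, D.r = m + 2 := ⟨D.r - 2, by have := h.one_lt_r; omega⟩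
  rw [hm] at hr hyr ⊢
  have e1 : X ^ (m + 1) * (A ^ (D.ν * D.n) - 1) = (A ^ (D.ν * D.n) - 1) * X ^ (m + 1) := by
    rw [mul_sub, hs.commutes.x_pow_a_pow, ← mul_assoc, D.q_pow_mul_n, one_smul, sub_mul, mul_one,
      one_mul]
  have e2 : twistedPowerSum D.N D.q⁻¹ A * (qInt (D.q ^ D.ν) (m + 1) • A ^ (2 * D.ν) -
      qInt (D.q ^ D.ν)⁻¹ (m + 1) • 1) = 0 := by
    rw [mul_sub, mul_smul_comm, mul_smul_comm, twistedPowerSum_mul_pow hs.a_pow hq hq0, inv_inv,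
      mul_comm 2, pow_mul, smul_smul, mul_comm, sq_mul_qInt hr, mul_one, sub_self]
  have e3 : X ^ (m + 1) * Y * Y ^ (m + 1) = β • ((A ^ (D.ν * D.n) - 1) * X ^ (m + 1)) := by
    rw [mul_assoc, ← pow_succ', hyr, mul_smul_comm, e1]
  rw [Nat.add_sub_cancel (n := m + 1) (m := 1), ← mul_assoc, ← mul_assoc,
    mul_sum_pow_of_smul hs.y_a, mul_assoc _ Y, hs.commutes.y_x_pow, mul_add, add_mul,
    mul_smul_comm, mul_smul_comm, ← mul_assoc _ _ (X ^ m), e2, zero_mul, smul_zero, zero_mul,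
    add_zero, smul_mul_assoc, mul_assoc, e3, mul_smul_comm, ← mul_assoc,
    hs.twistedPowerSum_mul_sub_eq_zero (Or.inr rfl), zero_mul, smul_zero, smul_zero]

open MulOpposite in
/-- The element `(∑ a^i) x^{r-1} y^{r-1}` corresponds to the analogous element of the opposite
algebra. -/
theorem op_integral (hs : D.Satisfies α β γ A X Y) :
    op ((∑ i ∈ Finset.range D.N, A ^ i) * X ^ (D.r - 1) * Y ^ (D.r - 1)) =
      (∑ i ∈ Finset.range D.N, op A ^ i) * op Y ^ (D.r - 1) * op X ^ (D.r - 1) := by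
  have e : ∀ i, X ^ (D.r - 1) * Y ^ (D.r - 1) * A ^ i =
      A ^ i * (X ^ (D.r - 1) * Y ^ (D.r - 1)) := by
    intro i
    have hne : D.q ^ ((D.r - 1) * i) ≠ 0 := pow_ne_zero _ D.q_ne_zero
    rw [mul_assoc, hs.commutes.y_pow_a_pow, mul_smul_comm, ← mul_assoc, hs.commutes.x_pow_a_pow,
      smul_mul_assoc, smul_smul, inv_mul_cancel₀ hne, one_smul, mul_assoc]
  apply unop_injective
  simp only [unop_op, unop_mul, unop_pow, Finset.unop_sum, Finset.sum_mul, mul_assoc]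
  refine Finset.sum_congr rfl fun i _ => ?_
  rw [← mul_assoc (X ^ _), e]

end Satisfies

namespace U

variable (h : D.Admissible α β)

/-- The two-sided integral `(∑ a^i) x^{r-1} y^{r-1}`. -/
noncomputable def integral : D.U α β γ h :=
  (∑ i ∈ Finset.range D.N, a h ^ i) * x h ^ (D.r - 1) * y h ^ (D.r - 1)

theorem integral_mem_leftIntegrals : integral h ∈ leftIntegrals k (D.U α β γ h) := by
  have hs := satisfies (γ := γ) h
  intro u
  rw [counit_eq]
  induction u using induction with
  | hk c => rw [AlgHom.commutes, Algebra.algebraMap_self_apply, Algebra.smul_def]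
  | ha => rw [counitHom, lift_a, one_smul]; exact hs.a_mul_integral
  | hx => rw [counitHom, lift_x, zero_smul]; exact hs.x_mul_integral
  | hy => rw [counitHom, lift_y, zero_smul]; exact hs.y_mul_integral h
  | hadd u v hu hv => rw [add_mul, hu, hv, map_add, add_smul]
  | hmul u v hu hv => rw [mul_assoc, hv, mul_smul_comm, hu, smul_smul, map_mul, mul_comm]

open MulOpposite in
theorem integral_mem_rightIntegrals : integral h ∈ rightIntegrals k (D.U α β γ h) := by
  have hs := satisfies (γ := γ) h
  have e := hs.op_integral
  intro u
  rw [counit_eq]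
  induction u using induction with
  | hk c =>
    rw [AlgHom.commutes, Algebra.algebraMap_self_apply, ← Algebra.commutes, Algebra.smul_def]
  | ha =>
    rw [counitHom, lift_a, one_smul]
    apply op_injective
    rw [op_mul, integral, e]
    exact hs.op_swap.a_mul_integral
  | hx =>
    rw [counitHom, lift_x, zero_smul]
    apply op_injective
    rw [op_mul, integral, e]
    exact hs.op_swap.y_mul_integral h.symm
  | hy =>
    rw [counitHom, lift_y, zero_smul]
    apply op_injective
    rw [op_mul, integral, e]
    exact hs.op_swap.x_mul_integral
  | hadd u v hu hv => rw [mul_add, hu, hv, map_add, add_smul]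
  | hmul u v hu hv => rw [← mul_assoc, hu, smul_mul_assoc, hv, smul_smul, map_mul]

theorem integral_eq_sum_mon : (integral h : D.U α β γ h) =
    ∑ i ∈ Finset.range D.N, mon (i : ZMod D.N) (D.r - 1) (D.r - 1) := by
  rw [integral, Finset.sum_mul, Finset.sum_mul]
  exact Finset.sum_congr rfl fun i _ => (mon_natCast h i _ _).symm

theorem coord_integral (i : ZMod D.N) (j l : ℕ) : coord i j l (integral h : D.U α β γ h) =
    if j = D.r - 1 ∧ l = D.r - 1 then 1 else 0 := by
  have hr := D.r_pos
  rw [integral_eq_sum_mon, map_sum, Finset.sum_eq_single_of_mem i.val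
    (Finset.mem_range.2 i.val_lt)]
  · rw [coord_mon (by omega) (by omega)]
    simp
  · intro m hm hmi
    rw [coord_mon (by omega) (by omega), if_neg]
    rintro ⟨rfl, -⟩
    exact hmi (ZMod.val_cast_of_lt (Finset.mem_range.1 hm)).symm

theorem integral_ne_zero : (integral h : D.U α β γ h) ≠ 0 := by
  intro h0
  have := coord_integral (γ := γ) h 0 (D.r - 1) (D.r - 1)
  rw [h0, map_zero] at this
  simp at this

variable {h}

theorem mon_r_left (i : ZMod D.N) (l : ℕ) : (mon i D.r l : D.U α β γ h) =
    α • (mon (D := D) (i + (D.ν * D.n : ℕ)) 0 l - mon i 0 l) := by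
  have hs := satisfies (γ := γ) h
  obtain ⟨i, rfl⟩ := exists_natCast i
  rw [← Nat.cast_add, mon_natCast, mon_natCast, mon_natCast, hs.x_pow, pow_add]
  simp only [mul_smul_comm, smul_mul_assoc, mul_sub, sub_mul, mul_one, pow_zero]

theorem mon_r_right (i : ZMod D.N) (j : ℕ) : (mon i j D.r : D.U α β γ h) =
    β • (mon (D := D) (i + (D.ν * D.n : ℕ)) j 0 - mon i j 0) := by
  have hs := satisfies (γ := γ) h
  obtain ⟨i, rfl⟩ := exists_natCast i
  rw [← Nat.cast_add, mon_natCast, mon_natCast, mon_natCast, hs.y_pow, mul_smul_comm, mul_sub,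
    mul_assoc, hs.commutes.x_pow_a_pow, ← mul_assoc, D.q_pow_mul_n, one_smul, ← mul_assoc, pow_add,
    mul_one, pow_zero, mul_one, mul_one]

theorem coord_a_mul (i : ZMod D.N) (j l : ℕ) (u : D.U α β γ h) :
    coord (1 + i) j l (a h * u) = coord i j l u := by
  let f : D.U α β γ h →ₗ[k] k := coord (1 + i) j l ∘ₗ LinearMap.mulLeft k (a h)
  suffices e : f = coord i j l from LinearMap.congr_fun e u
  refine linearMap_ext fun i' j' l' hj hl => ?_
  have := a_pow_mul_mon (γ := γ) h 1 i' j' l'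
  rw [pow_one, Nat.cast_one] at this
  simp only [f, LinearMap.comp_apply, LinearMap.mulLeft_apply, this, coord_mon hj hl,
    add_right_inj]

theorem x_mul_mon (i : ZMod D.N) (j l : ℕ) :
    x h * mon i j l = D.q ^ i.val • (mon i (j + 1) l : D.U α β γ h) := by
  rw [mon, mon, ← mul_assoc, ← mul_assoc, (satisfies h).x_a_pow, smul_mul_assoc, smul_mul_assoc,
    mul_assoc (a h ^ _), ← pow_succ']

theorem y_mul_mon_zero (i : ZMod D.N) (l : ℕ) :
    y h * mon i 0 l = (D.q ^ i.val)⁻¹ • (mon i 0 (l + 1) : D.U α β γ h) := by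
  rw [mon, mon, pow_zero, mul_one, ← mul_assoc, (satisfies h).y_a_pow, smul_mul_assoc, mul_assoc,
    ← pow_succ']

theorem y_mul_mon_succ (i : ZMod D.N) (j l : ℕ) :
    y h * mon i (j + 1) l = (D.q ^ i.val)⁻¹ • (((D.q ^ D.ν)⁻¹) ^ (j + 1) • mon i (j + 1) (l + 1) +
      γ • (qInt (D.q ^ D.ν) (j + 1) • mon (D := D) (i + (2 * D.ν : ℕ)) j l -
        qInt (D.q ^ D.ν)⁻¹ (j + 1) • mon i j l) : D.U α β γ h) := by
  have e := mon_natCast (γ := γ) h (i.val + 2 * D.ν) j l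
  rw [Nat.cast_add, ZMod.natCast_zmod_val] at e
  rw [e, mon, mon, mon, ← mul_assoc, ← mul_assoc, (satisfies h).y_a_pow, smul_mul_assoc,
    smul_mul_assoc, mul_assoc (a h ^ _) (y h), (satisfies h).commutes.y_x_pow, pow_succ' (y h),
    pow_add (a h)]
  simp only [mul_add, add_mul, mul_smul_comm, smul_mul_assoc, mul_assoc, sub_mul, mul_sub,
    one_mul]

/-- Left multiplication by `x` shifts coordinates. The terms `x^r` that it produces are linear
combinations of monomials without `x`, so they do not contribute to positive degrees in `x`. -/
theorem coord_x_mul (i : ZMod D.N) {j : ℕ} (hj : j + 1 < D.r) (l : ℕ) (u : D.U α β γ h) :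
    coord i (j + 1) l (x h * u) = D.q ^ i.val * coord i j l u := by
  let f : D.U α β γ h →ₗ[k] k := coord i (j + 1) l ∘ₗ LinearMap.mulLeft k (x h)
  suffices e : f = D.q ^ i.val • coord i j l from LinearMap.congr_fun e u
  refine linearMap_ext fun i' j' l' hj' hl' => ?_
  simp only [f, LinearMap.comp_apply, LinearMap.mulLeft_apply, x_mul_mon, map_smul,
    LinearMap.smul_apply, coord_mon hj' hl', smul_eq_mul]
  rcases Nat.lt_or_ge (j' + 1) D.r with hr | hr
  · rw [coord_mon hr hl']
    by_cases hi : i = i'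
    · simp [hi]
    · simp [hi]
  · have hr' : j' + 1 = D.r := by omega
    rw [hr', mon_r_left, map_smul, map_sub, coord_mon D.r_pos hl', coord_mon D.r_pos hl']
    have : j ≠ j' := by omega
    simp [this]

/-- On the top degree in `x`, left multiplication by `y` shifts coordinates: the terms that come
from `γ` have a lower degree in `x`. -/
theorem coord_y_mul (i : ZMod D.N) {l : ℕ} (hl : l + 1 < D.r) (u : D.U α β γ h) :
    coord i (D.r - 1) (l + 1) (y h * u) =
      (D.q ^ i.val)⁻¹ * ((D.q ^ D.ν)⁻¹ ^ (D.r - 1)) * coord i (D.r - 1) l u := by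
  let f : D.U α β γ h →ₗ[k] k := coord i (D.r - 1) (l + 1) ∘ₗ LinearMap.mulLeft k (y h)
  suffices e : f = ((D.q ^ i.val)⁻¹ * ((D.q ^ D.ν)⁻¹ ^ (D.r - 1))) • coord i (D.r - 1) l from
    LinearMap.congr_fun e u
  have hw (i' : ZMod D.N) {j' l' : ℕ} (hj' : j' < D.r) (hl' : l' < D.r) :
      coord i (D.r - 1) (l + 1) (mon i' j' (l' + 1) : D.U α β γ h) =
        if i = i' ∧ D.r - 1 = j' ∧ l = l' then 1 else 0 := by
    rcases Nat.lt_or_ge (l' + 1) D.r with hr | hr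
    · rw [coord_mon hj' hr]
      simp
    · have hr' : l' + 1 = D.r := by omega
      rw [hr', mon_r_right, map_smul, map_sub, coord_mon hj' D.r_pos, coord_mon hj' D.r_pos]
      have : l ≠ l' := by omega
      simp [this]
  refine linearMap_ext fun i' j' l' hj' hl' => ?_
  simp only [f, LinearMap.comp_apply, LinearMap.mulLeft_apply, LinearMap.smul_apply,
    coord_mon hj' hl', smul_eq_mul]
  rcases j' with _ | j'
  · have : D.r - 1 ≠ 0 := by omega
    rw [y_mul_mon_zero, map_smul, hw _ hj' hl']
    simp [this]
  · have h1 : D.r - 1 ≠ j' := by omega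
    rw [y_mul_mon_succ]
    simp only [map_smul, map_add, map_sub]
    rw [hw _ hj' hl', coord_mon (by omega) hl', coord_mon (by omega) hl']
    simp only [h1, false_and, and_false, if_false, smul_eq_mul]
    split_ifs with h2
    · rw [h2.1, h2.2.1]; ring
    · simp

/-- An element on which the generators act from the left by the counit is a multiple of the
integral. -/
theorem eq_smul_integral {t : D.U α β γ h} (ha : a h * t = t) (hx : x h * t = 0)
    (hy : y h * t = 0) : t = coord 0 (D.r - 1) (D.r - 1) t • integral h := by
  have hq (m : ℕ) : D.q ^ m ≠ 0 := pow_ne_zero _ D.q_ne_zero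
  have ha' (i : ZMod D.N) (j l : ℕ) : coord i j l t = coord 0 j l t := by
    obtain ⟨i, rfl⟩ := exists_natCast i
    induction i with
    | zero => simp
    | succ i ih =>
      have := coord_a_mul (i : ZMod D.N) j l t
      rw [ha] at this
      rw [Nat.cast_succ, add_comm, this, ih]
  refine ext_coord fun i j l => ?_
  rw [map_smul, coord_integral, smul_eq_mul]
  by_cases hjl : j < D.r ∧ l < D.r
  swap
  · rw [coord_eq_zero h hjl, LinearMap.zero_apply, if_neg, mul_zero]
    have := D.r_pos
    omega
  split_ifs with h1
  · rw [h1.1, h1.2, ha', mul_one]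
  · rw [mul_zero]
    by_cases hj : j + 1 < D.r
    · have := coord_x_mul i hj l t
      rw [hx, map_zero] at this
      exact (mul_eq_zero.1 this.symm).resolve_left (hq _)
    · obtain rfl : j = D.r - 1 := by omega
      have := coord_y_mul i (l := l) (by omega) t
      rw [hy, map_zero] at this
      refine (mul_eq_zero.1 this.symm).resolve_left (mul_ne_zero (inv_ne_zero (hq _)) ?_)
      exact pow_ne_zero _ (inv_ne_zero (hq _))

variable (h)

theorem leftIntegrals_eq : leftIntegrals k (D.U α β γ h) = Submodule.span k {integral h} := by
  refine le_antisymm (fun t ht => ?_) ?_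
  · rw [eq_smul_integral (t := t)]
    · exact Submodule.smul_mem _ _ (Submodule.mem_span_singleton_self _)
    · rw [ht, counit_eq, counitHom, lift_a, one_smul]
    · rw [ht, counit_eq, counitHom, lift_x, zero_smul]
    · rw [ht, counit_eq, counitHom, lift_y, zero_smul]
  · rw [Submodule.span_singleton_le_iff_mem]
    exact integral_mem_leftIntegrals h

theorem antipodeLin_a : antipodeLin h (a h : D.U α β γ h) = a h ^ (D.N - 1) := by
  simp [antipodeLin, antipodeHom]

theorem a_pow_mul_inv (m : ℕ) : (a h ^ m * (a h ^ (D.N - 1)) ^ m : D.U α β γ h) = 1 := by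
  rw [← (Commute.self_pow (a h) (D.N - 1)).mul_pow, (satisfies h).a_mul_inv, one_pow]

theorem x_eq_antipodeLin : (x h : D.U α β γ h) =
    -(D.q ^ D.ν • (a h ^ D.ν * antipodeLin h (x h))) := by
  simp only [antipodeLin, antipodeHom, LinearMap.comp_apply, AlgHom.toLinearMap_apply, lift_x,
    LinearEquiv.coe_coe, MulOpposite.coe_opLinearEquiv_symm, MulOpposite.unop_op, mul_neg,
    mul_smul_comm, smul_neg, neg_neg, smul_smul, ← mul_assoc]
  rw [a_pow_mul_inv, mul_inv_cancel₀ D.q_pow_ν_ne_zero, one_smul, one_mul]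

theorem y_eq_antipodeLin : (y h : D.U α β γ h) =
    -((D.q ^ D.ν)⁻¹ • (a h ^ D.ν * antipodeLin h (y h))) := by
  simp only [antipodeLin, antipodeHom, LinearMap.comp_apply, AlgHom.toLinearMap_apply, lift_y,
    LinearEquiv.coe_coe, MulOpposite.coe_opLinearEquiv_symm, MulOpposite.unop_op, mul_neg,
    mul_smul_comm, smul_neg, neg_neg, smul_smul, ← mul_assoc]
  rw [a_pow_mul_inv, inv_mul_cancel₀ D.q_pow_ν_ne_zero, one_smul, one_mul]

theorem antipodeLin_surjective : Function.Surjective (antipodeLin (γ := γ) h) := by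
  have hs := satisfies (γ := γ) h
  have hmul {u v : D.U α β γ h} : (∃ u', antipodeLin h u' = u) → (∃ v', antipodeLin h v' = v) →
      ∃ w, antipodeLin h w = u * v := by
    rintro ⟨u, rfl⟩ ⟨v, rfl⟩
    exact ⟨v * u, antipodeLin_mul h _ _⟩
  have hpow (u : D.U α β γ h) (hu : ∃ u', antipodeLin h u' = u) (m : ℕ) :
      ∃ w, antipodeLin h w = u ^ m := by
    induction m with
    | zero => exact ⟨algebraMap k _ 1, by rw [antipodeLin_algebraMap, map_one, pow_zero]⟩
    | succ m ih => rw [pow_succ]; exact hmul ih hu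
  have ha : ∃ w, antipodeLin h w = (a h : D.U α β γ h) := by
    have e : (a h : D.U α β γ h) = (a h ^ (D.N - 1)) ^ (D.N - 1) := by
      rw [← one_mul ((a h ^ (D.N - 1)) ^ (D.N - 1)), ← hs.a_mul_inv, mul_assoc, ← pow_succ',
        Nat.sub_add_cancel D.N_pos, ← pow_mul, mul_comm (D.N - 1), pow_mul, hs.a_pow, one_pow,
        mul_one]
    rw [e]
    exact hpow _ ⟨_, antipodeLin_a h⟩ _
  intro u
  induction u using induction with
  | hk c => exact ⟨_, antipodeLin_algebraMap h c⟩
  | ha => exact ha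
  | hx =>
    obtain ⟨w, hw⟩ := hmul (hpow _ ha D.ν) ⟨x h, rfl⟩
    exact ⟨-(D.q ^ D.ν • w), by rw [map_neg, map_smul, hw, ← x_eq_antipodeLin]⟩
  | hy =>
    obtain ⟨w, hw⟩ := hmul (hpow _ ha D.ν) ⟨y h, rfl⟩
    exact ⟨-((D.q ^ D.ν)⁻¹ • w), by rw [map_neg, map_smul, hw, ← y_eq_antipodeLin]⟩
  | hadd u v hu hv =>
    obtain ⟨u, rfl⟩ := hu
    obtain ⟨v, rfl⟩ := hv
    exact ⟨u + v, map_add _ _ _⟩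
  | hmul u v hu hv => exact hmul hu hv

/-- The antipode is bijective and maps right integrals to left integrals, so that the right
integrals form a space of dimension at most one. -/
theorem rightIntegrals_eq : rightIntegrals k (D.U α β γ h) = Submodule.span k {integral h} := by
  have hinj : Function.Injective (antipodeLin (γ := γ) h) :=
    LinearMap.injective_iff_surjective.2 (antipodeLin_surjective h)
  have key : ∀ t ∈ rightIntegrals k (D.U α β γ h), antipodeLin h t =
      coord 0 (D.r - 1) (D.r - 1) (antipodeLin h t) • integral h := by
    intro t ht
    have hS (w : D.U α β γ h) : antipodeLin h w * antipodeLin h t =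
        Coalgebra.counit (R := k) w • antipodeLin h t := by
      rw [← antipodeLin_mul, ht w, map_smul]
    refine eq_smul_integral ?_ ?_ ?_
    · have := hS (a h)
      rw [counit_eq, counitHom, lift_a, one_smul, antipodeLin_a] at this
      rw [← this, ← mul_assoc, (satisfies h).a_mul_inv, one_mul, this]
    · have := hS (x h)
      rw [counit_eq, counitHom, lift_x, zero_smul] at this
      rw [x_eq_antipodeLin, neg_mul, smul_mul_assoc, mul_assoc, this, mul_zero, smul_zero, neg_zero]
    · have := hS (y h)
      rw [counit_eq, counitHom, lift_y, zero_smul] at this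
      rw [y_eq_antipodeLin, neg_mul, smul_mul_assoc, mul_assoc, this, mul_zero, smul_zero, neg_zero]
  have hint := integral_mem_rightIntegrals (γ := γ) h
  refine le_antisymm (fun t ht => ?_) ((Submodule.span_singleton_le_iff_mem _ _).2 hint)
  have h1 := key t ht
  have h2 := key _ hint
  set c := coord 0 (D.r - 1) (D.r - 1) (antipodeLin h t)
  set d := coord 0 (D.r - 1) (D.r - 1) (antipodeLin h (integral h : D.U α β γ h))
  have hd : d ≠ 0 := by
    intro h0
    rw [h0, zero_smul] at h2
    exact integral_ne_zero h (hinj (h2.trans (map_zero _).symm))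
  refine Submodule.mem_span_singleton.2 ⟨c * d⁻¹, hinj ?_⟩
  rw [map_smul, h1, h2, smul_smul, inv_mul_cancel_right₀ hd]

theorem isUnimodular : IsUnimodular k (D.U α β γ h) :=
  (leftIntegrals_eq h).trans (rightIntegrals_eq h).symm

end U

end Datum

namespace Datum

namespace U

variable {k : Type u} [Field k] {D : Datum k} {α β γ α' β' γ' : k}

/-! ### Isomorphisms -/

theorem satisfies_smul (h' : D.Admissible α' β') {c d : k} (hα : α = c ^ D.r * α')
    (hβ : β = d ^ D.r * β') (hγ : γ = c * d * γ') :
    D.Satisfies α β γ (a h' : D.U α' β' γ' h') (c • x h') (d • y h') where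
  a_pow := (satisfies h').a_pow
  x_pow := by rw [smul_pow, (satisfies h').x_pow, smul_smul, hα]
  y_pow := by rw [smul_pow, (satisfies h').y_pow, smul_smul, hβ]
  x_a := by rw [smul_mul_assoc, (satisfies h').x_a, mul_smul_comm, smul_comm]
  y_a := by rw [smul_mul_assoc, (satisfies h').y_a, mul_smul_comm, smul_comm]
  y_x := by
    rw [smul_mul_smul_comm, smul_mul_smul_comm, smul_comm, mul_comm d, ← smul_sub,
      (satisfies h').y_x, smul_smul, hγ]

/-- Rescaling `x` and `y` gives isomorphisms between the algebras `U_{α,β,γ}`. -/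
theorem nonempty_bialgEquiv_of_scaling (h : D.Admissible α β) (h' : D.Admissible α' β') {c d : k}
    (hc : c ≠ 0) (hd : d ≠ 0) (hα : α = c ^ D.r * α') (hβ : β = d ^ D.r * β')
    (hγ : γ = c * d * γ') : Nonempty (D.U α β γ h ≃ₐc[k] D.U α' β' γ' h') := by
  let f : D.U α β γ h →ₐ[k] D.U α' β' γ' h' := lift (satisfies_smul h' hα hβ hγ)
  have hcr := pow_ne_zero D.r hc
  have hdr := pow_ne_zero D.r hd
  let g : D.U α' β' γ' h' →ₐ[k] D.U α β γ h := lift (satisfies_smul (c := c⁻¹) (d := d⁻¹) h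
    (by rw [hα, inv_pow, inv_mul_cancel_left₀ hcr]) (by rw [hβ, inv_pow, inv_mul_cancel_left₀ hdr])
    (by rw [hγ]; field_simp))
  let e : D.U α β γ h ≃ₐ[k] D.U α' β' γ' h' := AlgEquiv.ofAlgHom f g
    (algHom_ext (by simp [f, g]) (by simp [f, g, smul_smul, hc]) (by simp [f, g, smul_smul, hd]))
    (algHom_ext (by simp [f, g]) (by simp [f, g, smul_smul, hc]) (by simp [f, g, smul_smul, hd]))
  refine ⟨BialgEquiv.ofAlgEquiv e (algHom_ext ?_ ?_ ?_) (algHom_ext ?_ ?_ ?_)⟩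
  · simp [e, f, counit_eq, counitHom]
  · simp [e, f, counit_eq, counitHom]
  · simp [e, f, counit_eq, counitHom]
  · simp [e, f, comul_a]
  · simp [e, f, comul_x, TensorProduct.smul_tmul']
  · simp [e, f, comul_y, TensorProduct.smul_tmul']

theorem map_mem_skewPrimitives {C C' : Type*} [Ring C] [Bialgebra k C] [Ring C'] [Bialgebra k C']
    (f : C ≃ₐc[k] C') {g z : C} (hz : z ∈ skewPrimitives k g 1) :
    f z ∈ skewPrimitives k (f g) 1 := by
  have hz' : Coalgebra.comul (R := k) z = z ⊗ₜ[k] g + 1 ⊗ₜ[k] z := hz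
  change Coalgebra.comul (R := k) (f z) = _
  rw [← CoalgHomClass.map_comp_comul_apply, hz', map_add]
  simp

/-- For `n > 2`, an isomorphism of Hopf algebras rescales `x` and `y`: their images are skew
primitive, hence combinations of `a^v - 1`, `x` and `y`, and these are eigenvectors for the
commutation with a power of `a` whose eigenvalues `1`, `q`, `q⁻¹` are distinct. -/
theorem exists_scaling_of_bialgEquiv (h : D.Admissible α β) (h' : D.Admissible α' β')
    (hα : α ≠ 0) (hn : 2 < D.n) (f : D.U α β γ h ≃ₐc[k] D.U α' β' γ' h') :
    ∃ (m : ℕ) (c d : k), (m * D.ν : ZMod D.N) = D.ν ∧ f (a h) = a h' ^ m ∧ f (x h) = c • x h' ∧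
      f (y h) = d • y h' := by
  have hg : IsGroupLikeElem k (f (a h)) := (isGroupLikeElem_a h).map f
  obtain ⟨m, hm⟩ := exists_eq_a_pow hg
  have hq := D.isPrimitiveRoot
  have hskew (z : D.U α β γ h) (hz : z ∈ skewPrimitives k (a h ^ D.ν) 1) :
      f z ∈ skewPrimitives k (a h' ^ (m * D.ν)) 1 := by
    have := map_mem_skewPrimitives f hz
    rwa [map_pow, hm, ← pow_mul] at this
  have hx := hskew (x h) (comul_x h)
  have hy := hskew (y h) (comul_y h)
  have hxa : f (x h) * a h' ^ m = D.q • (a h' ^ m * f (x h)) := by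
    rw [← hm, ← map_mul, ← map_mul, (satisfies h).x_a, map_smul]
  have hya : f (y h) * a h' ^ m = D.q⁻¹ • (a h' ^ m * f (y h)) := by
    rw [← hm, ← map_mul, ← map_mul, (satisfies h).y_a, map_smul]
  have hx0 : f (x h) ≠ 0 := by
    intro h0
    have h1 : (x h : D.U α β γ h) = 0 := f.injective (h0.trans (map_zero f).symm)
    have := coord_x (γ := γ) h 0 1 0
    rw [h1] at this
    simp at this
  -- In the basis of monomials, the commutation relation with a power of `a` is diagonal.
  have hcoord (c e₁ e₂ e₃ : k) (v : ℕ)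
      (hE : (e₁ • (a h' ^ v - 1) + (e₂ • x h' + e₃ • y h') : D.U α' β' γ' h') * a h' ^ m =
        c • (a h' ^ m * (e₁ • (a h' ^ v - 1) + (e₂ • x h' + e₃ • y h')))) :
      (1 - c) • (e₁ • (a h' ^ v - 1) : D.U α' β' γ' h') = 0 ∧ (D.q ^ m - c) * e₂ = 0 ∧
        ((D.q ^ m)⁻¹ - c) * e₃ = 0 := by
    have hs := satisfies (γ := γ') h'
    have h1 : a h' ^ m * (e₁ • (1 - c) • (a h' ^ v - 1) + (((D.q ^ m - c) * e₂) • x h' +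
        (((D.q ^ m)⁻¹ - c) * e₃) • y h') : D.U α' β' γ' h') = 0 := by
      rw [← sub_eq_zero] at hE
      rw [← hE]
      have hc : (a h' ^ v - 1) * a h' ^ m = a h' ^ m * (a h' ^ v - 1 : D.U α' β' γ' h') := by
        rw [sub_mul, mul_sub, ← pow_add, ← pow_add, add_comm, one_mul, mul_one]
      simp only [add_mul, mul_add, smul_mul_assoc, mul_smul_comm, hs.x_a_pow, hs.y_a_pow, hc]
      module
    have h2 := ((a_isUnit (γ := γ') h').pow m).mul_right_eq_zero.1 h1
    have hX := congrArg (coord 0 1 0) h2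
    have hY := congrArg (coord 0 0 1) h2
    simp [coord_a_pow, coord_one, coord_x, coord_y] at hX hY
    have hX' : (D.q ^ m - c) * e₂ = 0 := by simpa using hX
    have hY' : ((D.q ^ m)⁻¹ - c) * e₃ = 0 := by simpa using hY
    refine ⟨?_, hX', hY'⟩
    rw [hX', hY', zero_smul, zero_smul, add_zero, add_zero] at h2
    rwa [smul_comm]
  have hxe := eq_of_mem_skewPrimitives hx
  have hye := eq_of_mem_skewPrimitives hy
  set c₁ := coord ((m * D.ν : ℕ) : ZMod D.N) 0 0 (f (x h))
  set c₂ := coord 0 1 0 (f (x h))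
  set c₃ := coord 0 0 1 (f (x h))
  set d₁ := coord ((m * D.ν : ℕ) : ZMod D.N) 0 0 (f (y h))
  set d₂ := coord 0 1 0 (f (y h))
  set d₃ := coord 0 0 1 (f (y h))
  have hq1 : 1 - D.q ≠ 0 := sub_ne_zero.2 (hq.ne_one D.one_lt_n).symm
  have hq1' : 1 - D.q⁻¹ ≠ 0 := sub_ne_zero.2 (hq.inv.ne_one D.one_lt_n).symm
  obtain ⟨hx1, hx2, hx3⟩ := hcoord D.q c₁ c₂ c₃ (m * D.ν) (by rw [← hxe]; exact hxa)
  obtain ⟨hy1, hy2, hy3⟩ := hcoord D.q⁻¹ d₁ d₂ d₃ (m * D.ν) (by rw [← hye]; exact hya)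
  rw [smul_eq_zero_iff_right hq1] at hx1
  rw [smul_eq_zero_iff_right hq1'] at hy1
  rw [hx1, zero_add] at hxe
  rw [hy1, zero_add] at hye
  have hmν : (m * D.ν : ZMod D.N) = D.ν := by
    by_contra hne
    obtain ⟨e1, e2⟩ := coord_eq_zero_of_mem_skewPrimitives (by push_cast; exact hne) hx
    refine hx0 ?_
    rw [hxe]
    simp [c₂, c₃, e1, e2]
  -- As `n` and `ν` are coprime, `m ν = ν` modulo `N` implies `q ^ m = q`.
  have hqm : D.q ^ m = D.q := by
    have h1 : m * D.ν ≡ 1 * D.ν [MOD D.n] := by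
      have : ((m * D.ν : ℕ) : ZMod D.N) = (D.ν : ℕ) := by push_cast; exact hmν
      rw [one_mul]
      exact ((ZMod.natCast_eq_natCast_iff _ _ _).1 this).of_dvd D.n_dvd_N
    have h2 : m ≡ 1 [MOD D.n] :=
      Nat.ModEq.cancel_right_of_coprime (h.of_ne_zero fun h0 => hα h0.1).1 h1
    simpa using pow_eq_pow_of_modEq h2 hq.pow_eq_one
  have hq2 : D.q - D.q⁻¹ ≠ 0 := by
    intro h0
    have h1 : D.q ^ 2 = 1 := by
      rw [sub_eq_zero] at h0
      rw [sq]
      nth_rewrite 2 [h0]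
      exact mul_inv_cancel₀ D.q_ne_zero
    exact absurd (Nat.le_of_dvd two_pos (hq.dvd_of_pow_eq_one 2 h1)) (by omega)
  rw [hqm] at hx3 hy2
  have hx3' : c₃ = 0 :=
    (mul_eq_zero.1 hx3).resolve_left (by rw [← neg_sub]; exact neg_ne_zero.2 hq2)
  have hy2' : d₂ = 0 := (mul_eq_zero.1 hy2).resolve_left hq2
  refine ⟨m, c₂, d₃, hmν, hm, ?_, ?_⟩
  · rw [hxe, hx3', zero_smul, add_zero]
  · rw [hye, hy2', zero_smul, zero_add]

theorem a_pow_sub_one_ne_zero (h : D.Admissible α β) {m : ℕ} (hm : ¬ D.N ∣ m) :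
    (a h ^ m - 1 : D.U α β γ h) ≠ 0 := by
  intro h0
  have e : (a h ^ m : D.U α β γ h) = a h ^ 0 := by rw [pow_zero]; exact sub_eq_zero.1 h0
  have := a_pow_injective h e
  rw [Nat.cast_zero, ZMod.natCast_eq_zero_iff] at this
  exact hm this

/-- With `f x = c x` and `f y = d y`, applying `f` to the relations gives `α = c^n α'`, `β = d^n β'`
and `γ = c d γ'`; this requires `a^{νn} ≠ 1` and `a^{2ν} ≠ 1`. -/
theorem invariant_of_bialgEquiv (h : D.Admissible α β) (h' : D.Admissible α' β')
    (hα : α ≠ 0) (hγ : γ ≠ 0) (hγ' : γ' ≠ 0) (hν : ¬ D.N ∣ 2 * D.ν) (hn : 2 < D.n)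
    (f : D.U α β γ h ≃ₐc[k] D.U α' β' γ' h') :
    α * β / γ ^ D.n = α' * β' / γ' ^ D.n := by
  obtain ⟨m, c, d, hm, ha, hx, hy⟩ := exists_scaling_of_bialgEquiv h h' hα hn f
  have h0 : ¬ (α = 0 ∧ β = 0) := fun h0 => hα h0.1
  have hs := satisfies (γ := γ) h
  have hs' := satisfies (γ := γ') h'
  have hpow (t : ℕ) : (a h' ^ m) ^ (D.ν * t) = (a h' ^ (D.ν * t) : D.U α' β' γ' h') := by
    rw [← pow_mul, ← mul_assoc, pow_mul _ (m * D.ν), pow_mul _ D.ν t,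
      a_pow_eq_of_cast_eq h' (i := m * D.ν) (i' := D.ν)]
    push_cast
    exact hm
  have hne := a_pow_sub_one_ne_zero (γ := γ') h' (h.of_ne_zero h0).2
  have hne2 := a_pow_sub_one_ne_zero (γ := γ') h' hν
  have e1 : α = c ^ D.n * α' := by
    have := congrArg f hs.x_pow
    rw [map_pow, hx, smul_pow, hs'.x_pow, map_smul, map_sub, map_pow, ha, map_one, hpow,
      smul_smul] at this
    rw [← h.r_eq h0]
    exact (smul_left_injective k hne this).symm
  have e2 : β = d ^ D.n * β' := by
    have := congrArg f hs.y_pow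
    rw [map_pow, hy, smul_pow, hs'.y_pow, map_smul, map_sub, map_pow, ha, map_one, hpow,
      smul_smul] at this
    rw [← h.r_eq h0]
    exact (smul_left_injective k hne this).symm
  have e3 : γ = c * d * γ' := by
    have := congrArg f hs.y_x
    rw [map_sub, map_smul, map_mul, map_mul, hx, hy, smul_mul_smul_comm, smul_mul_smul_comm,
      smul_comm, mul_comm d, ← smul_sub, hs'.y_x, map_smul, map_sub, map_pow, ha, map_one,
      mul_comm 2, hpow, smul_smul, mul_comm D.ν] at this
    exact (smul_left_injective k hne2 this).symm
  rw [div_eq_div_iff (pow_ne_zero _ hγ) (pow_ne_zero _ hγ'), e1, e2, e3]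
  ring

end U

end Datum

/-! ### Crossed products from central cleft extensions -/

open Coalgebra

section

variable {k : Type u} [Field k] {C : Type v} [AddCommGroup C] [Module k C] [Coalgebra k C]
  {V : Type w} [AddCommGroup V] [Module k V]

theorem _root_.Coalgebra.Repr.sum_counit_left_smul_map {c : C} {ι : Type*} (R : Repr k c ι)
    (f : C →ₗ[k] V) : ∑ i ∈ R.index, counit (R := k) (R.left i) • f (R.right i) = f c := by
  simp only [← map_smul, ← map_sum, sum_counit_smul]

theorem _root_.Coalgebra.Repr.sum_counit_right_smul_map {c : C} {ι : Type*} (R : Repr k c ι)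
    (f : C →ₗ[k] V) : ∑ i ∈ R.index, counit (R := k) (R.right i) • f (R.left i) = f c := by
  have e := congrArg (TensorProduct.rid k V) (sum_map_tmul_counit_eq f c (repr := R))
  simpa only [map_sum, TensorProduct.rid_tmul, one_smul] using e

end

/-- An `H`-comodule algebra `B` together with a central algebra map `A → B` and a section
`j : H → B` such that `a ⊗ h ↦ a j(h)` is an isomorphism of comodules `A ⊗ H ≃ B`. The comodule
axioms for the coaction `ρ` are not needed: its values on `A` and on `j(H)` determine it. -/
structure CentralExtension (k : Type u) [Field k] (A : Type v) [CommRing A] [Algebra k A]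
    (H : Type v) [Ring H] [HopfAlgebra k H] (B : Type w) [Ring B] [Algebra k B] where
  /-- the inclusion of the central subalgebra -/
  ι : A →ₐ[k] B
  /-- the section -/
  j : H →ₗ[k] B
  /-- the isomorphism `a ⊗ h ↦ a j(h)` -/
  φ : A ⊗[k] H ≃ₗ[k] B
  /-- the coaction -/
  ρ : B →ₐ[k] B ⊗[k] H
  central : ∀ a b, ι a * b = b * ι a
  j_one : j 1 = 1
  φ_tmul : ∀ a h, φ (a ⊗ₜ h) = ι a * j h
  ρ_ι : ∀ a, ρ (ι a) = ι a ⊗ₜ 1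
  ρ_j : ∀ h, ρ (j h) = j.rTensor H (comul (R := k) h)

namespace CentralExtension

variable {k : Type u} [Field k] {A : Type v} [CommRing A] [Algebra k A]
  {H : Type v} [Ring H] [HopfAlgebra k H] {B : Type w} [Ring B] [Algebra k B]
  (E : CentralExtension k A H B)

/-- The projection `B ≃ A ⊗ H → A` given by the counit of `H`. -/
noncomputable def proj : B →ₗ[k] A :=
  (TensorProduct.rid k A).toLinearMap ∘ₗ (counit (R := k) (A := H)).lTensor A ∘ₗ
    E.φ.symm.toLinearMap

theorem proj_ι_mul_j (a : A) (h : H) : E.proj (E.ι a * E.j h) = counit (R := k) h • a := by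
  rw [← E.φ_tmul]
  simp [proj]

theorem proj_ι_mul (a : A) (b : B) : E.proj (E.ι a * b) = a * E.proj b := by
  obtain ⟨t, rfl⟩ := E.φ.surjective b
  induction t using TensorProduct.induction_on with
  | zero => simp
  | tmul a' h =>
    rw [E.φ_tmul, ← mul_assoc, ← map_mul, proj_ι_mul_j, proj_ι_mul_j, mul_smul_comm]
  | add s t hs ht => rw [map_add, mul_add, map_add, hs, ht, map_add, mul_add]

/-- The isomorphism `B ≃ A ⊗ H` is recovered from the coaction and the projection `B → A`. -/
theorem φ_symm_eq (b : B) : E.φ.symm b = E.proj.rTensor H (E.ρ b) := by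
  obtain ⟨t, rfl⟩ := E.φ.surjective b
  rw [LinearEquiv.symm_apply_apply]
  induction t using TensorProduct.induction_on with
  | zero => simp
  | tmul a h =>
    rw [E.φ_tmul, map_mul, E.ρ_ι, E.ρ_j, ← (ℛ k h).eq, map_sum, Finset.mul_sum, map_sum]
    simp only [LinearMap.rTensor_tmul, Algebra.TensorProduct.tmul_mul_tmul, one_mul, proj_ι_mul_j,
      TensorProduct.smul_tmul]
    rw [← TensorProduct.tmul_sum, sum_counit_smul]
  | add s t hs ht => simp only [map_add, ← hs, ← ht]

/-- The cocycle of a central extension, determined by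
`j(h) j(l) = ∑ σ(h₁, l₁) j(h₂ l₂)`. -/
noncomputable def cocycle : H →ₗ[k] H →ₗ[k] A :=
  LinearMap.mk₂ k (fun h l => E.proj (E.j h * E.j l)) (by simp [add_mul]) (by simp)
    (by simp [mul_add]) (by simp)

theorem cocycle_apply (h l : H) : E.cocycle h l = E.proj (E.j h * E.j l) := rfl

theorem φ_symm_j_mul_j {h l : H} {ι κ : Type*} (R : Repr k h ι) (S : Repr k l κ) :
    E.φ.symm (E.j h * E.j l) = ∑ i ∈ R.index, ∑ j ∈ S.index,
      E.cocycle (R.left i) (S.left j) ⊗ₜ (R.right i * S.right j) := by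
  rw [φ_symm_eq, map_mul, E.ρ_j, E.ρ_j, ← R.eq, ← S.eq, map_sum, map_sum, Finset.sum_mul_sum,
    map_sum]
  simp [cocycle_apply, map_sum]

theorem j_mul_j {h l : H} {ι κ : Type*} (R : Repr k h ι) (S : Repr k l κ) :
    E.j h * E.j l = ∑ i ∈ R.index, ∑ j ∈ S.index,
      E.ι (E.cocycle (R.left i) (S.left j)) * E.j (R.right i * S.right j) := by
  have e := congrArg E.φ (E.φ_symm_j_mul_j R S)
  simpa only [LinearEquiv.apply_symm_apply, map_sum, E.φ_tmul] using e

/-- The crossed system of a central extension; the action is trivial. Associativity of `B` gives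
the cocycle condition. -/
noncomputable def crossedSystem
    (hE : IsUnit (WithConv.toConv (TensorProduct.lift E.cocycle))) : CrossedSystem k A H where
  act := (LinearMap.lsmul k A).comp (counit (R := k))
  σ := E.cocycle
  act_mul h a b R := by
    have e := R.sum_counit_left_smul_map (counit (R := k))
    simp only [smul_eq_mul] at e
    simp only [LinearMap.comp_apply, LinearMap.lsmul_apply, smul_mul_smul_comm,
      ← Finset.sum_smul, e]
  act_one h := by simp [Algebra.algebraMap_eq_smul_one]
  one_act a := by simp
  twisted h l a R S := by
    have e1 (i) : ∑ j ∈ S.index, counit (R := k) (S.left j) • E.cocycle i (S.right j) =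
        E.cocycle i l := S.sum_counit_left_smul_map _
    have e2 (i) : ∑ j ∈ S.index, counit (R := k) (S.right j) • E.cocycle i (S.left j) =
        E.cocycle i l := S.sum_counit_right_smul_map _
    have e3 : ∑ i ∈ R.index, counit (R := k) (R.left i) • E.cocycle (R.right i) l =
        E.cocycle h l := R.sum_counit_left_smul_map (E.cocycle.flip l)
    have e4 : ∑ i ∈ R.index, counit (R := k) (R.right i) • E.cocycle (R.left i) l =
        E.cocycle h l := R.sum_counit_right_smul_map (E.cocycle.flip l)
    have e5 (c d : k) (b : A) : c • d • a * b = a * (c • d • b) := by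
      rw [smul_mul_assoc, smul_mul_assoc, mul_smul_comm, mul_smul_comm]
    have e6 (c d : k) (b : A) : b * (c * d) • a = a * (c • d • b) := by
      rw [← e5, mul_comm, mul_smul]
    simp only [LinearMap.comp_apply, LinearMap.lsmul_apply, Bialgebra.counit_mul, e5, e6,
      ← Finset.mul_sum, ← Finset.smul_sum, e1, e2, e3, e4]
  σ_one h := by
    rw [cocycle_apply, E.j_one, mul_one, ← one_mul (E.j h), ← map_one E.ι, proj_ι_mul_j,
      Algebra.algebraMap_eq_smul_one]
  one_σ h := by
    rw [cocycle_apply, E.j_one, ← map_one E.ι, proj_ι_mul_j, Algebra.algebraMap_eq_smul_one]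
  cocycle h l m R S T := by
    have e1 : E.proj (E.j h * E.j l * E.j m) = ∑ i ∈ R.index, ∑ j ∈ S.index,
        E.cocycle (R.left i) (S.left j) * E.cocycle (R.right i * S.right j) m := by
      rw [E.j_mul_j R S]
      simp only [Finset.sum_mul, map_sum, mul_assoc, proj_ι_mul, cocycle_apply]
    have e2 : E.proj (E.j h * E.j l * E.j m) = ∑ j ∈ S.index, ∑ t ∈ T.index,
        E.cocycle (S.left j) (T.left t) * E.cocycle h (S.right j * T.right t) := by
      rw [mul_assoc, E.j_mul_j S T]
      simp only [Finset.mul_sum, map_sum, ← mul_assoc, ← E.central _ (E.j h)]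
      simp only [mul_assoc, proj_ι_mul, cocycle_apply]
    rw [← e1, e2, Finset.sum_comm]
    refine Finset.sum_congr rfl fun j _ => ?_
    rw [Finset.sum_comm]
    refine Finset.sum_congr rfl fun t _ => ?_
    have e3 : ∑ i ∈ R.index, counit (R := k) (R.left i) •
        E.cocycle (R.right i) (S.right j * T.right t) = E.cocycle h (S.right j * T.right t) :=
      R.sum_counit_left_smul_map (E.cocycle.flip _)
    simp only [LinearMap.comp_apply, LinearMap.lsmul_apply, smul_mul_assoc, ← mul_smul_comm,
      ← Finset.mul_sum, e3]
  exists_inv := by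
    obtain ⟨τ, h1, h2⟩ := isUnit_iff_exists.1 hE
    refine ⟨TensorProduct.curry τ.ofConv, fun h l R S => ⟨?_, ?_⟩⟩
    · have e := congrArg (fun f => f.ofConv (h ⊗ₜ l)) h1
      simpa [(R.tmul S).convMul_apply, Coalgebra.Repr.tmul, Finset.sum_product, mul_comm] using e
    · have e := congrArg (fun f => f.ofConv (h ⊗ₜ l)) h2
      simpa [(R.tmul S).convMul_apply, Coalgebra.Repr.tmul, Finset.sum_product, mul_comm] using e

/-- A central extension with convolution invertible cocycle is a crossed product. -/
theorem isCrossedProduct (hE : IsUnit (WithConv.toConv (TensorProduct.lift E.cocycle))) :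
    IsCrossedProduct k A H B := by
  refine ⟨E.crossedSystem hE, E.φ, by rw [E.φ_tmul, map_one, E.j_one, one_mul], ?_⟩
  intro a b h g R R' S
  have e (i) : E.φ (∑ j ∈ (R' i).index, ∑ l ∈ S.index,
      (a * (E.crossedSystem hE).act (R.left i) b *
        (E.crossedSystem hE).σ ((R' i).left j) (S.left l)) ⊗ₜ[k]
          ((R' i).right j * S.right l)) =
      counit (R := k) (R.left i) • (E.ι (a * b) * (E.j (R.right i) * E.j g)) := by
    rw [E.j_mul_j (R' i) S]
    simp only [crossedSystem, map_sum, E.φ_tmul, map_mul, LinearMap.comp_apply,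
      LinearMap.lsmul_apply, map_smul, mul_smul_comm, smul_mul_assoc, Finset.mul_sum,
      Finset.smul_sum, mul_assoc]
  have e' : ∑ i ∈ R.index, counit (R := k) (R.left i) •
      (E.ι (a * b) * (E.j (R.right i) * E.j g)) = E.ι (a * b) * (E.j h * E.j g) :=
    R.sum_counit_left_smul_map
      (LinearMap.mulLeft k (E.ι (a * b)) ∘ₗ LinearMap.mulRight k (E.j g) ∘ₗ E.j)
  rw [map_sum, Finset.sum_congr rfl fun i _ => e i, e', E.φ_tmul, E.φ_tmul, map_mul, mul_assoc,
    mul_assoc, ← mul_assoc (E.j h), ← E.central b (E.j h), mul_assoc]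

end CentralExtension

namespace Datum

namespace U

open Coalgebra

variable {k : Type u} [Field k] {D : Datum k} {α β γ : k} (h : D.Admissible α β)

/-! ### Invertibility of cocycles on `U_{α,β,γ}` -/

variable {h} in
/-- The comultiplication of a monomial as a sum of tensors of monomials. -/
noncomputable def monRepr (i : ZMod D.N) (j l : ℕ) :
    Repr k (mon i j l : D.U α β γ h) (ℕ × ℕ) where
  index := Finset.range (j + 1) ×ˢ Finset.range (l + 1)
  left p := comulCoeff (D.q ^ D.ν) p.1 (j - p.1) p.2 (l - p.2) • mon i p.1 p.2
  right p := mon (D := D) (i + D.ν * (p.1 + p.2)) (j - p.1) (l - p.2)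
  eq := by
    rw [comul_mon, Finset.sum_product]
    simp only [TensorProduct.smul_tmul']

/-- A linear map on `U ⊗ U` is convolution invertible if its values on pairs of grouplike elements
are invertible. Indeed, convolution by `σ` is triangular with respect to the degree of monomials,
and in finite dimension injectivity suffices. -/
theorem isUnit_conv {A : Type v} [Ring A] [Algebra k A] [Module.Finite k A]
    (σ : D.U α β γ h ⊗[k] D.U α β γ h →ₗ[k] A)
    (hσ : ∀ i i' : ZMod D.N, IsUnit (σ (mon i 0 0 ⊗ₜ mon i' 0 0))) :
    IsUnit (WithConv.toConv σ) := by
  have : Module.Finite k (WithConv (D.U α β γ h ⊗[k] D.U α β γ h →ₗ[k] A)) :=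
    Module.Finite.equiv (WithConv.linearEquiv k _).symm
  have : IsArtinianRing (WithConv (D.U α β γ h ⊗[k] D.U α β γ h →ₗ[k] A)) :=
    IsArtinianRing.of_finite k _
  rw [IsArtinianRing.isUnit_iff_isRightRegular]
  refine (injective_iff_map_eq_zero (AddMonoidHom.mulRight (WithConv.toConv σ))).2 fun f hf => ?_
  replace hf : f * WithConv.toConv σ = 0 := hf
  have key (d : ℕ) : ∀ (i i' : ZMod D.N) (j l j' l' : ℕ), j < D.r → l < D.r → j' < D.r →
      l' < D.r → j + l + (j' + l') = d → f.ofConv (mon i j l ⊗ₜ mon i' j' l') = 0 := by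
    induction d using Nat.strong_induction_on with
    | _ d ih =>
    intro i i' j l j' l' hj hl hj' hl' hd
    have e := congrArg (fun g => g.ofConv (mon i j l ⊗ₜ[k] mon i' j' l')) hf
    simp only [((monRepr i j l).tmul (monRepr i' j' l')).convMul_apply] at e
    -- By induction, only the term of top degree on the left survives.
    rw [Finset.sum_eq_single ((j, l), (j', l'))] at e
    · simp only [Repr.tmul_left, Repr.tmul_right, monRepr, Nat.sub_self, comulCoeff_zero_right,
        one_smul] at e
      exact (hσ _ _).mul_left_eq_zero.1 e
    · rintro ⟨⟨s, t⟩, ⟨s', t'⟩⟩ hm hne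
      simp only [Repr.tmul_index, monRepr, Finset.mem_product, Finset.mem_range] at hm
      simp only [ne_eq, Prod.mk.injEq] at hne
      simp only [Repr.tmul_left, Repr.tmul_right, monRepr, ← TensorProduct.smul_tmul',
        TensorProduct.tmul_smul, map_smul]
      rw [ih (s + t + (s' + t')) (by omega) i i' s t s' t' (by omega) (by omega) (by omega)
        (by omega) rfl]
      simp
    · intro hm
      simp [monRepr] at hm
  apply WithConv.ofConv_injective
  refine TensorProduct.ext (linearMap_ext fun i j l hj hl =>
    linearMap_ext fun i' j' l' hj' hl' => ?_)
  exact key _ i i' j l j' l' hj hl hj' hl' rfl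

/-! ### The crossed product decomposition -/

variable {h} {D' : Datum k} {h' : D'.Admissible 0 0}

section

variable (hN : D'.N = D.n) (hq : D'.q = D.q) (hν : D'.ν ≡ D.ν [MOD D.n])

include hq hν in
theorem q_pow_ν_eq : D'.q ^ D'.ν = D.q ^ D.ν := by
  rw [hq]
  exact pow_eq_pow_of_modEq hν D.isPrimitiveRoot.pow_eq_one

include hq hν in
theorem r_eq_of_modEq : D'.r = D.r := by rw [r, r, q_pow_ν_eq hq hν]

include hN in
theorem a_pow_eq_of_modEq {m m' : ℕ} (e : m ≡ m' [MOD D.n]) :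
    (a h' ^ m : D'.U 0 0 1 h') = a h' ^ m' :=
  a_pow_eq_of_cast_eq h' ((ZMod.natCast_eq_natCast_iff _ _ _).2 (hN ▸ e))

include hN hq hν in
/-- If `D'` has the parameters `(n, n, ν mod n, q)` and `γ = s²`, then `a ↦ a`, `x ↦ s x`, `y ↦ s y`
defines a map from `U_{α,β,γ}` to the algebra of `D'` with `α = β = 0` and `γ = 1`. -/
theorem satisfies_quotient (s : k) (hs : s * s = γ) :
    D.Satisfies α β γ (a h' : D'.U 0 0 1 h') (s • x h') (s • y h') where
  a_pow := by
    rw [a_pow_eq_of_modEq hN (m' := 0) ((Nat.modEq_zero_iff_dvd).2 D.n_dvd_N), pow_zero]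
  x_pow := by
    rw [a_pow_eq_of_modEq hN (m' := 0) ((Nat.modEq_zero_iff_dvd).2 (dvd_mul_left _ _)), smul_pow,
      ← r_eq_of_modEq hq hν, (satisfies h').x_pow]
    simp
  y_pow := by
    rw [a_pow_eq_of_modEq hN (m' := 0) ((Nat.modEq_zero_iff_dvd).2 (dvd_mul_left _ _)), smul_pow,
      ← r_eq_of_modEq hq hν, (satisfies h').y_pow]
    simp
  x_a := by rw [smul_mul_assoc, (satisfies h').x_a, mul_smul_comm, smul_comm, hq]
  y_a := by rw [smul_mul_assoc, (satisfies h').y_a, mul_smul_comm, smul_comm, hq]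
  y_x := by
    rw [smul_mul_smul_comm, smul_mul_smul_comm, smul_comm, ← smul_sub, ← q_pow_ν_eq hq hν,
      (satisfies h').y_x, one_smul, hs, a_pow_eq_of_modEq hN (hν.mul_left 2)]

end

instance : NeZero (D.N / D.n) :=
  ⟨(Nat.div_pos (Nat.le_of_dvd D.N_pos D.n_dvd_N) D.n_pos).ne'⟩

variable (h) in
theorem a_pow_n_mul_eq {m m' : ℕ} (e : m ≡ m' [MOD D.N / D.n]) :
    (a h ^ (D.n * m) : D.U α β γ h) = a h ^ (D.n * m') := by
  refine a_pow_eq_of_cast_eq h ((ZMod.natCast_eq_natCast_iff _ _ _).2 ?_)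
  rw [← Nat.mul_div_cancel' D.n_dvd_N]
  exact e.mul_left' _

variable (h) in
/-- The central subalgebra generated by `a^n`, as the image of the group algebra of `ℤ/(N/n)`. -/
noncomputable def centralHom :
    MonoidAlgebra k (Multiplicative (ZMod (D.N / D.n))) →ₐ[k] D.U α β γ h :=
  MonoidAlgebra.lift k _ _
    { toFun := fun t => a h ^ (D.n * t.toAdd.val)
      map_one' := by simp
      map_mul' := fun t t' => by
        rw [← pow_add, ← mul_add]
        refine a_pow_n_mul_eq h ?_
        rw [toAdd_mul, ZMod.val_add]
        exact Nat.mod_modEq _ _ }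

variable (D) in
/-- The element `m` of `ℤ/(N/n)`, as an element of the group algebra. -/
noncomputable def groupElem (m : ℕ) : MonoidAlgebra k (Multiplicative (ZMod (D.N / D.n))) :=
  MonoidAlgebra.of k _ (Multiplicative.ofAdd (m : ZMod (D.N / D.n)))

theorem isUnit_groupElem (m : ℕ) : IsUnit (groupElem D m) :=
  (Group.isUnit _).map (MonoidAlgebra.of k _)

theorem centralHom_groupElem (m : ℕ) :
    centralHom h (groupElem D m) = (a h ^ (D.n * m) : D.U α β γ h) := by
  rw [centralHom, groupElem, MonoidAlgebra.lift_of]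
  refine a_pow_n_mul_eq h ?_
  rw [toAdd_ofAdd, ZMod.val_natCast]
  exact Nat.mod_modEq _ _

theorem induction_groupElem {P : MonoidAlgebra k (Multiplicative (ZMod (D.N / D.n))) → Prop}
    (t : MonoidAlgebra k (Multiplicative (ZMod (D.N / D.n)))) (hP : ∀ m, P (groupElem D m))
    (hadd : ∀ t t', P t → P t' → P (t + t')) (hsmul : ∀ (c : k) t, P t → P (c • t)) : P t := by
  refine MonoidAlgebra.induction_on t (fun g => ?_) hadd hsmul
  have := hP g.toAdd.val
  rwa [groupElem, ZMod.natCast_zmod_val, ofAdd_toAdd] at this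

/-- The image of the group algebra is central because `q^n = 1`. -/
theorem centralHom_mul (t : MonoidAlgebra k (Multiplicative (ZMod (D.N / D.n))))
    (u : D.U α β γ h) : centralHom h t * u = u * centralHom h t := by
  have hs := satisfies (γ := γ) h
  have hqn (m : ℕ) : D.q ^ (D.n * m) = 1 := by
    rw [pow_mul, D.isPrimitiveRoot.pow_eq_one, one_pow]
  induction t using induction_groupElem with
  | hP m =>
    rw [centralHom_groupElem]
    induction u using induction with
    | hk c => exact (Algebra.commutes c _).symm
    | ha => rw [← pow_succ, ← pow_succ']
    | hx => rw [hs.x_a_pow, hqn, one_smul]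
    | hy => rw [hs.y_a_pow, hqn, inv_one, one_smul]
    | hadd u v hu hv => rw [mul_add, add_mul, hu, hv]
    | hmul u v hu hv => rw [← mul_assoc, hu, mul_assoc, hv, mul_assoc]
  | hadd t t' ht ht' => rw [map_add, mul_add, add_mul, ht, ht']
  | hsmul c t ht => rw [map_smul, smul_mul_assoc, mul_smul_comm, ht]

/-- The section `a^i x^j y^l ↦ s^{-(j+l)} a^i x^j y^l` of the quotient map `a ↦ a`, `x ↦ s x`,
`y ↦ s y`, where `0 ≤ i < n`. -/
noncomputable def quotientSection (h : D.Admissible α β) (γ : k) (h' : D'.Admissible 0 0) (s : k) :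
    D'.U 0 0 1 h' →ₗ[k] D.U α β γ h :=
  (basis h').constr k fun t =>
    (s ^ ((t.2.1 : ℕ) + t.2.2))⁻¹ • (a h ^ t.1.val * x h ^ (t.2.1 : ℕ) * y h ^ (t.2.2 : ℕ))

theorem quotientSection_mon (s : k) (i : ZMod D'.N) {j l : ℕ} (hj : j < D'.r) (hl : l < D'.r) :
    quotientSection h γ h' s (mon i j l) =
      (s ^ (j + l))⁻¹ • (a h ^ i.val * x h ^ j * y h ^ l) := by
  have e := (basis (γ := 1) h').constr_basis k (fun t =>
    (s ^ ((t.2.1 : ℕ) + t.2.2))⁻¹ • (a h ^ t.1.val * x h ^ (t.2.1 : ℕ) * y h ^ (t.2.2 : ℕ) :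
      D.U α β γ h)) (i, ⟨j, hj⟩, ⟨l, hl⟩)
  rwa [basis_apply] at e

section

variable (hN : D'.N = D.n) (hq : D'.q = D.q) (hν : D'.ν ≡ D.ν [MOD D.n]) {s : k}
  (hs : s * s = γ) (hs0 : s ≠ 0)

include hN in
theorem centralHom_mul_quotientSection (m : ℕ) {j l : ℕ} (hj : j < D'.r) (hl : l < D'.r) :
    centralHom h (groupElem D (m / D.n)) * quotientSection h γ h' s (mon m j l) =
      (s ^ (j + l))⁻¹ • (a h ^ m * x h ^ j * y h ^ l) := by
  rw [centralHom_groupElem, quotientSection_mon s _ hj hl, mul_smul_comm, ← mul_assoc, ← mul_assoc,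
    ← pow_add, ZMod.val_natCast, hN, Nat.div_add_mod]

/-- The coaction of the quotient `a ↦ a`, `x ↦ s x`, `y ↦ s y` on `U_{α,β,γ}`. -/
noncomputable def quotientCoaction (h : D.Admissible α β) (h' : D'.Admissible 0 0) :
    D.U α β γ h →ₐ[k] D.U α β γ h ⊗[k] D'.U 0 0 1 h' :=
  (Algebra.TensorProduct.map (AlgHom.id k _)
    (lift (satisfies_quotient (h' := h') hN hq hν s hs))).comp (comulHom h)

theorem quotientCoaction_centralHom (t : MonoidAlgebra k (Multiplicative (ZMod (D.N / D.n)))) :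
    quotientCoaction hN hq hν hs h h' (centralHom h t) = centralHom h t ⊗ₜ 1 := by
  induction t using induction_groupElem with
  | hP m =>
    rw [centralHom_groupElem, quotientCoaction, AlgHom.comp_apply, ← comul_eq,
      (isGroupLikeElem_a_pow h _).comul_eq_tmul_self, Algebra.TensorProduct.map_tmul,
      AlgHom.id_apply, map_pow, lift_a,
      a_pow_eq_of_modEq hN (m' := 0) ((Nat.modEq_zero_iff_dvd).2 (dvd_mul_right _ _)), pow_zero]
  | hadd t t' ht ht' => rw [map_add, map_add, ht, ht', TensorProduct.add_tmul]
  | hsmul c t ht => rw [map_smul, map_smul, ht, TensorProduct.smul_tmul']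

include hs0 in
/-- The section is colinear. -/
theorem quotientCoaction_quotientSection (u : D'.U 0 0 1 h') :
    quotientCoaction hN hq hν hs h h' (quotientSection h γ h' s u) =
      (quotientSection h γ h' s).rTensor _ (comul (R := k) u) := by
  refine LinearMap.congr_fun (f := (quotientCoaction hN hq hν hs h h').toLinearMap ∘ₗ
    quotientSection h γ h' s) (g := (quotientSection h γ h' s).rTensor _ ∘ₗ comul)
    (linearMap_ext fun i j l hj hl => ?_) u
  have hν' : (D.ν : ZMod D'.N) = D'.ν := by
    rw [ZMod.natCast_eq_natCast_iff, hN]; exact hν.symm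
  have hπ (m j l : ℕ) : lift (satisfies_quotient (α := α) (β := β) (h' := h') hN hq hν s hs)
      (mon (m : ZMod D.N) j l : D.U α β γ h) = s ^ (j + l) • mon (m : ZMod D'.N) j l := by
    rw [mon_natCast, mon_natCast, map_mul, map_mul, map_pow, map_pow, map_pow, lift_a, lift_x,
      lift_y, smul_pow, smul_pow, mul_smul_comm, mul_smul_comm, smul_mul_assoc, smul_smul, pow_add,
      mul_comm (s ^ l)]
  simp only [LinearMap.comp_apply, AlgHom.toLinearMap_apply]
  rw [quotientSection_mon s i hj hl, map_smul, ← mon_natCast, quotientCoaction, AlgHom.comp_apply,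
    ← comul_eq, comul_mon, comul_mon, q_pow_ν_eq hq hν]
  simp only [map_sum, map_smul, Finset.smul_sum]
  refine Finset.sum_congr rfl fun b hb => Finset.sum_congr rfl fun c hc => ?_
  have hb' : b < j + 1 := Finset.mem_range.1 hb
  have hc' : c < l + 1 := Finset.mem_range.1 hc
  have e : ((i.val : ℕ) : ZMod D.N) + D.ν * (b + c) = ((i.val + D.ν * (b + c) : ℕ) : ZMod D.N) := by
    push_cast; rfl
  have e' : ((i.val + D.ν * (b + c) : ℕ) : ZMod D'.N) = i + D'.ν * (b + c) := by
    push_cast; rw [hν', ZMod.natCast_zmod_val]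
  rw [e, Algebra.TensorProduct.map_tmul, hπ, e', LinearMap.rTensor_tmul,
    quotientSection_mon s i (by omega) (by omega), AlgHom.id_apply, mon_natCast,
    TensorProduct.tmul_smul, ← TensorProduct.smul_tmul', smul_smul, smul_smul, smul_smul]
  congr 1
  have e2 : j + l = (b + c) + (j - b + (l - c)) := by omega
  rw [e2, pow_add]
  field_simp

/-- The map `t ⊗ u ↦ t j(u)` from `k[ℤ/(N/n)] ⊗ U'` to `U_{α,β,γ}`, where `j` is the section of the
quotient `U'`, is surjective on monomials; the dimensions are equal. -/
theorem bijective_centralHom_mul_quotientSection (hr' : D'.r = D.r)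
    (hN : D'.N = D.n) (hs0 : s ≠ 0) :
    Function.Bijective (LinearMap.mul' k (D.U α β γ h) ∘ₗ
      TensorProduct.map (centralHom h).toLinearMap (quotientSection h γ h' s)) := by
  set φ := LinearMap.mul' k (D.U α β γ h) ∘ₗ
      TensorProduct.map (centralHom h).toLinearMap (quotientSection h γ h' s)
  have hsurj : Function.Surjective φ := by
    rw [← LinearMap.range_eq_top, eq_top_iff, ← (monomialBasis h).span_eq, Submodule.span_le]
    rintro _ ⟨⟨i, j, l⟩, rfl⟩
    refine ⟨groupElem D (i / D.n) ⊗ₜ (s ^ ((j : ℕ) + l) • mon (i : ℕ) j l), ?_⟩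
    have e := centralHom_mul_quotientSection (h := h) (γ := γ) (h' := h') hN (s := s) i
      (hr'.symm ▸ j.2 : (j : ℕ) < D'.r) (hr'.symm ▸ l.2 : (l : ℕ) < D'.r)
    simp only [φ, LinearMap.comp_apply, TensorProduct.map_tmul, LinearMap.mul'_apply,
      AlgHom.toLinearMap_apply, map_smul, mul_smul_comm, e, smul_smul]
    rw [mul_inv_cancel₀ (pow_ne_zero _ hs0), one_smul, monomialBasis_apply]
  refine ⟨(LinearMap.injective_iff_surjective_of_finrank_eq_finrank ?_).2 hsurj, hsurj⟩
  rw [Module.finrank_tensorProduct, finrank_eq, finrank_eq, hr', hN, ← mul_assoc]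
  congr 1
  rw [(MonoidAlgebra.coeffLinearEquiv k).finrank_eq, Module.finrank_finsupp_self,
    Fintype.card_multiplicative, ZMod.card, Nat.div_mul_cancel D.n_dvd_N]

end

end U

end Datum

namespace Datum

variable {k : Type u} [Field k] {D : Datum k} {α β γ : k}

/-- If `n` and `ν` are coprime, the root of unity `q` is `ω^ν` for a primitive `n`-th root of
unity `ω`. -/
theorem exists_radfordDatum (hc : Nat.Coprime D.n D.ν) : ∃ R : RadfordDatum k,
    R.N = D.n ∧ R.ν ≡ D.ν [MOD D.n] ∧ R.toDatum.q = D.q := by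
  have hn := D.one_lt_n
  have hc' : Nat.Coprime D.n (D.ν % D.n) := by
    rw [Nat.coprime_comm, Nat.Coprime, ← Nat.gcd_rec]; exact hc
  obtain ⟨t, -, ht⟩ := Nat.exists_mul_mod_eq_one_of_coprime hc'.symm hn
  have ht' : D.ν % D.n * t ≡ 1 [MOD D.n] := ht.trans (Nat.mod_eq_of_lt hn).symm
  have htc : Nat.Coprime t D.n :=
    Nat.coprime_of_mul_modEq_one (D.ν % D.n) (by rwa [mul_comm] at ht')
  have hν0 : D.ν % D.n ≠ 0 := by
    intro h0
    simp [h0] at ht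
  refine ⟨⟨D.n, D.ν % D.n, D.q ^ t, by omega, Nat.mod_lt _ (by omega), fun hd => ?_,
    D.isPrimitiveRoot.pow_of_coprime t htc⟩, rfl, Nat.mod_modEq _ _, ?_⟩
  · have := (hc'.pow_right 2).eq_one_of_dvd hd
    omega
  · change (D.q ^ t) ^ (D.ν % D.n) = D.q
    rw [← pow_mul, mul_comm, pow_eq_pow_of_modEq ht' D.isPrimitiveRoot.pow_eq_one, pow_one]

namespace U

/-- The extension is central, and its cocycle takes the value `(a^n)^e` on `(a^i, a^m)`, where `e`
is the carry of the sum of `i` and `m` modulo `n`. -/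
theorem isCrossedProduct (h : D.Admissible α β) {s : k} (hs : s * s = γ) (hs0 : s ≠ 0)
    {R : RadfordDatum k} (hN : R.N = D.n) (hν : R.ν ≡ D.ν [MOD D.n]) (hq : R.toDatum.q = D.q) :
    IsCrossedProduct k (MonoidAlgebra k (Multiplicative (ZMod (D.N / D.n)))) R.U
      (D.U α β γ h) := by
  have h1 : (1 : R.U) = mon ((0 : ℕ) : ZMod R.toDatum.N) 0 0 := by
    rw [mon_natCast]; simp
  let E : CentralExtension k (MonoidAlgebra k (Multiplicative (ZMod (D.N / D.n)))) R.U
      (D.U α β γ h) :=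
    { ι := centralHom h
      j := quotientSection h γ R.admissible s
      φ := LinearEquiv.ofBijective _ (bijective_centralHom_mul_quotientSection
        (r_eq_of_modEq hq hν) hN hs0)
      ρ := quotientCoaction hN hq hν hs h R.admissible
      central := centralHom_mul
      j_one := by
        rw [h1, quotientSection_mon s _ R.toDatum.r_pos R.toDatum.r_pos]
        simp
      φ_tmul := fun _ _ => rfl
      ρ_ι := quotientCoaction_centralHom hN hq hν hs
      ρ_j := quotientCoaction_quotientSection hN hq hν hs hs0 }
  refine E.isCrossedProduct (isUnit_conv _ _ fun i i' => ?_)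
  have e : E.cocycle (mon i 0 0) (mon i' 0 0) = groupElem D ((i.val + i'.val) / D.n) := by
    have e1 : E.j (mon i 0 0) * E.j (mon i' 0 0) =
        E.ι (groupElem D ((i.val + i'.val) / D.n)) *
          E.j (mon ((i.val + i'.val : ℕ) : ZMod R.toDatum.N) 0 0) := by
      rw [centralHom_mul_quotientSection hN _ R.toDatum.r_pos R.toDatum.r_pos,
        quotientSection_mon s _ R.toDatum.r_pos R.toDatum.r_pos,
        quotientSection_mon s _ R.toDatum.r_pos R.toDatum.r_pos]
      simp [pow_add]
    rw [E.cocycle_apply, e1, E.proj_ι_mul_j, counit_mon]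
    simp
  rw [TensorProduct.lift.tmul, e]
  exact isUnit_groupElem _

end U

end Datum

end PointedHopf

theorem proposition3p1 {k : Type*} [Field k] (D : Datum k) (α β γ : k) (h : D.Admissible α β)
    (a x y : D.U α β γ h) (ha : a = Datum.U.a h) (hx : x = Datum.U.x h) (hy : y = Datum.U.y h) :
    -- (1) pointed, and the group of grouplike elements is generated by `a`, of order `N`
    (IsPointed k (D.U α β γ h) ∧
      Subgroup.zpowers (Datum.U.aG h : GroupLike k (D.U α β γ h)) = ⊤ ∧
      orderOf (Datum.U.aG h : GroupLike k (D.U α β γ h)) = D.N) ∧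
    -- (2) the basis and the dimension
    ((∃ b : Module.Basis (Fin D.N × Fin D.r × Fin D.r) k (D.U α β γ h),
        ∀ i j l, b (i, j, l) = a ^ (i : ℕ) * x ^ (j : ℕ) * y ^ (l : ℕ)) ∧
      Module.finrank k (D.U α β γ h) = D.N * D.r ^ 2) ∧
    -- (3) the skew primitives and the first term of the coradical filtration
    (skewPrimitives k (a ^ D.ν) 1 = Submodule.span k {a ^ D.ν - 1, x, y} ∧
      (∀ v : ℕ, ¬ v ≡ D.ν [MOD D.N] →
        skewPrimitives k (a ^ v) 1 = Submodule.span k {a ^ v - 1}) ∧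
      coradicalFiltration k (D.U α β γ h) 1 =
        Submodule.span k {u | ∃ i < D.N, u = a ^ i ∨ u = a ^ i * x ∨ u = a ^ i * y}) ∧
    -- (4) the two-sided integral; the factor `1/N` is present when `N` is invertible in `k`
    ((((∑ i ∈ Finset.range D.N, a ^ i) * x ^ (D.r - 1) * y ^ (D.r - 1) ≠ 0 ∧
        (∑ i ∈ Finset.range D.N, a ^ i) * x ^ (D.r - 1) * y ^ (D.r - 1) ∈
          leftIntegrals k (D.U α β γ h) ⊓ rightIntegrals k (D.U α β γ h)) ∧
      ((D.N : k) ≠ 0 →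
        ((D.N : k)⁻¹ • ∑ i ∈ Finset.range D.N, a ^ i) * x ^ (D.r - 1) * y ^ (D.r - 1) ≠ 0 ∧
        ((D.N : k)⁻¹ • ∑ i ∈ Finset.range D.N, a ^ i) * x ^ (D.r - 1) * y ^ (D.r - 1) ∈
          leftIntegrals k (D.U α β γ h) ⊓ rightIntegrals k (D.U α β γ h))) ∧
      IsUnimodular k (D.U α β γ h)) ∧
    -- (5) the crossed product with Radford's algebra `U_{(n,ν,ω)}`, `ν` taken modulo `n`
    (α ≠ 0 → β ≠ 0 → γ ≠ 0 → IsSquare γ →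
      ∃ R : RadfordDatum k, R.N = D.n ∧ R.ν ≡ D.ν [MOD D.n] ∧
        IsCrossedProduct k (MonoidAlgebra k (Multiplicative (ZMod (D.N / D.n)))) R.U
          (D.U α β γ h)) ∧
    -- (6) isomorphisms of Hopf algebras
    (∀ (α' β' γ' : k) (h' : D.Admissible α' β'),
      α ≠ 0 → β ≠ 0 → α' ≠ 0 → β' ≠ 0 →
      -- (a)
      ((∃ c : k, c ^ D.n = α / α') → (∃ d : k, d ^ D.n = β / β') →
        Nonempty (D.U α β 0 h ≃ₐc[k] D.U α' β' 0 h')) ∧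
      -- (b)
      (γ ≠ 0 → γ' ≠ 0 → ¬ D.N ∣ 2 * D.ν →
        (2 < D.n → Nonempty (D.U α β γ h ≃ₐc[k] D.U α' β' γ' h') →
          α * β / γ ^ D.n = α' * β' / γ' ^ D.n) ∧
        ((∃ c : k, c ^ D.n = α / α') → α * β / γ ^ D.n = α' * β' / γ' ^ D.n →
          Nonempty (D.U α β γ h ≃ₐc[k] D.U α' β' γ' h')))) := by
  subst ha hx hy
  have hint : Datum.U.integral h ∈
      leftIntegrals k (D.U α β γ h) ⊓ rightIntegrals k (D.U α β γ h) :=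
    ⟨Datum.U.integral_mem_leftIntegrals h, Datum.U.integral_mem_rightIntegrals h⟩
  refine ⟨⟨Datum.U.isPointed h, Datum.U.zpowers_aG h, Datum.U.orderOf_aG h⟩,
    ⟨⟨Datum.U.monomialBasis h, fun i j l => Datum.U.monomialBasis_apply h (i, j, l)⟩,
      Datum.U.finrank_eq h⟩,
    ⟨Datum.U.skewPrimitives_a_pow_ν h, fun v hv => Datum.U.skewPrimitives_a_pow h
      fun e => hv ((ZMod.natCast_eq_natCast_iff _ _ _).1 e), Datum.U.coradicalFiltration_one h⟩,
    ⟨⟨⟨Datum.U.integral_ne_zero h, hint⟩, fun hN => ?_⟩, Datum.U.isUnimodular h⟩, ?_, ?_⟩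
  · rw [smul_mul_assoc, smul_mul_assoc]
    exact ⟨smul_ne_zero (inv_ne_zero hN) (Datum.U.integral_ne_zero h), Submodule.smul_mem _ _ hint⟩
  · rintro hα - hγ ⟨s, hs⟩
    obtain ⟨R, hN, hν, hq⟩ := Datum.exists_radfordDatum (h.of_ne_zero fun h0 => hα h0.1).1
    refine ⟨R, hN, hν, Datum.U.isCrossedProduct h hs.symm ?_ hN hν hq⟩
    rintro rfl
    exact hγ (by rw [hs, mul_zero])
  · intro α' β' γ' h' hα hβ hα' hβ'
    have hr : D.r = D.n := h.r_eq fun h0 => hα h0.1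
    have hn : D.n ≠ 0 := D.n_pos.ne'
    refine ⟨?_, fun hγ hγ' hν => ⟨?_, ?_⟩⟩
    · rintro ⟨c, hc⟩ ⟨d, hd⟩
      refine Datum.U.nonempty_bialgEquiv_of_scaling h h' (c := c) (d := d) ?_ ?_ ?_ ?_ ?_
      · rintro rfl
        rw [zero_pow hn] at hc
        exact div_ne_zero hα hα' hc.symm
      · rintro rfl
        rw [zero_pow hn] at hd
        exact div_ne_zero hβ hβ' hd.symm
      · rw [hr, hc, div_mul_cancel₀ _ hα']
      · rw [hr, hd, div_mul_cancel₀ _ hβ']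
      · rw [mul_zero]
    · rintro hn2 ⟨f⟩
      exact Datum.U.invariant_of_bialgEquiv h h' hα hγ hγ' hν hn2 f
    · rintro ⟨c, hc⟩ hinv
      have hc0 : c ≠ 0 := by
        rintro rfl
        rw [zero_pow hn] at hc
        exact div_ne_zero hα hα' hc.symm
      -- `γ = c d γ'` forces the choice of `d`; the invariant then gives `β = d ^ n β'`
      refine Datum.U.nonempty_bialgEquiv_of_scaling h h' (c := c) (d := γ / (c * γ')) hc0
        (div_ne_zero hγ (mul_ne_zero hc0 hγ')) ?_ ?_ ?_
      · rw [hr, hc, div_mul_cancel₀ _ hα']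
      · rw [hr, div_pow, mul_pow, hc]
        rw [div_eq_div_iff (pow_ne_zero _ hγ) (pow_ne_zero _ hγ')] at hinv
        have hγn := pow_ne_zero D.n hγ'
        field_simp
        linear_combination hinv
      · field_simp
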